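/- Let $D$ be a diagram, without virtual crossings, of a classical oriented tangle $T$ in the ball with exactly one string (a properly embedded oriented interval running from its input to its output) and $m-1$ oriented closed components, $m\ge 1$. A set $S$ of $n$ crossings of $D$ is called a descending $n$-state if (i) smoothing all crossings of $S$ respecting the orientation produces a diagram $D(S)$ without closed components, i.e. a single string, and (ii) when one follows $D(S)$ from its input to its output, one enters the neighbourhood of each smoothed crossing of $S$ for the first time along the former overpass and for the second time along the former underpass. Let $\operatorname{sign}(S)$ be the product of the signs (local writhes) of the crossings in $S$, and put $$c_n(D)=\sum_{S\ \text{descending } n\text{-state}}\operatorname{sign}(S),\qquad \nabla(T)=\nabla(D)=\sum_{n\ge 0}c_n(D)\,z^n\in\mathbb Z[z].$$ Let $\bar T$ be the closed oriented link obtained from $T$ by the braid-type closure, i.e. by joining the output of the string to its input by an arc outside of the diagram. Then $\bar T$ has $m$ components, and $\nabla(T)$ is the Conway polynomial of $\bar T$. Here the Conway polynomial is the function $L\mapsto\nabla(L)\in\mathbb Z[z]$ on (diagrams of) non-empty oriented classical links that is determined by the following properties: it is invariant under the Reidemeister moves, it equals $1$ on the unknot, and it satisfies the skein relation $\nabla(L_+)-\nabla(L_-)=z\,\nabla(L_0)$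 for any three diagrams $L_+,L_-,L_0$ that coincide outside of a disk in which they show a positive crossing, a negative crossing, and the smoothing of this crossing respecting the orientation, respectively. (That there is exactly one such function is part of the statement.) -/

import Mathlib

open Polynomial

namespace ConwayTangle

noncomputable section

/-! ### Permutations of finite sets -/

theorem exists_return {α : Type} [Finite α] (σ : Equiv.Perm α) (p : α → Prop) (x : α)
    (hx : p x) : ∃ n : ℕ, p ((σ ^ (n + 1)) x) := by
  refine ⟨orderOf σ - 1, ?_⟩
  have h : orderOf σ - 1 + 1 = orderOf σ := Nat.sub_add_cancel (orderOf_pos σ)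
  rw [h, pow_orderOf_eq_one]
  exact hx

open Classical in
/-- The first point of the forward `σ`-orbit of `x` which satisfies `p` again. -/
def returnPoint {α : Type} [Finite α] (σ : Equiv.Perm α) (p : α → Prop) (x : {x // p x}) :
    {x // p x} :=
  ⟨(σ ^ (Nat.find (exists_return σ p x.1 x.2) + 1)) x.1,
    Nat.find_spec (exists_return σ p x.1 x.2)⟩

theorem returnPoint_injective {α : Type} [Finite α] (σ : Equiv.Perm α) (p : α → Prop) :
    Function.Injective (returnPoint σ p) := by
  classical
  have key : ∀ x y : {x // p x},
      Nat.find (exists_return σ p x.1 x.2) ≤ Nat.find (exists_return σ p y.1 y.2) →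
      returnPoint σ p x = returnPoint σ p y → x = y := by
    intro x y hle hxy
    have hxy' : (σ ^ (Nat.find (exists_return σ p x.1 x.2) + 1)) x.1
        = (σ ^ (Nat.find (exists_return σ p y.1 y.2) + 1)) y.1 := congrArg Subtype.val hxy
    obtain ⟨d, hd⟩ := Nat.exists_eq_add_of_le hle
    have h1 : Nat.find (exists_return σ p y.1 y.2) + 1
        = (Nat.find (exists_return σ p x.1 x.2) + 1) + d := by omega
    rw [h1, pow_add σ (_ + 1) d, Equiv.Perm.mul_apply] at hxy'
    have h2 : x.1 = (σ ^ d) y.1 := (Equiv.injective _) hxy'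
    cases d with
    | zero => exact Subtype.ext (by simpa using h2)
    | succ e =>
      have h3 : p ((σ ^ (e + 1)) y.1) := h2 ▸ x.2
      exact absurd h3 (Nat.find_min (exists_return σ p y.1 y.2) (by omega))
  intro x y hxy
  rcases le_total (Nat.find (exists_return σ p x.1 x.2))
    (Nat.find (exists_return σ p y.1 y.2)) with h | h
  · exact key x y h hxy
  · exact (key y x h hxy.symm).symm

/-- The first return permutation of `σ` on the set of points satisfying `p`: the points not
satisfying `p` are deleted from the cycles of `σ`. -/
def firstReturn {α : Type} [Finite α] (σ : Equiv.Perm α) (p : α → Prop) :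
    Equiv.Perm {x // p x} :=
  Equiv.ofBijective (returnPoint σ p)
    (Finite.injective_iff_bijective.mp (returnPoint_injective σ p))

/-- The set of cycles of `σ`, fixed points included. -/
abbrev Cycles {α : Type} (σ : Equiv.Perm α) : Type :=
  Quotient (Equiv.Perm.SameCycle.setoid σ)

/-- The cycle of `σ` through `x`. -/
abbrev cycleOf {α : Type} (σ : Equiv.Perm α) (x : α) : Cycles σ :=
  Quotient.mk (Equiv.Perm.SameCycle.setoid σ) x

/-- The number of cycles of `σ`, fixed points included. -/
def numCycles {α : Type} (σ : Equiv.Perm α) : ℕ := Nat.card (Cycles σ)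

/-- The number of cycles of `σ` none of whose points satisfies `p`. -/
def numCyclesAvoiding {α : Type} (σ : Equiv.Perm α) (p : α → Prop) : ℕ :=
  Nat.card {z : Cycles σ // ∀ x, cycleOf σ x = z → ¬ p x}

/-! ### Passages through crossings

A crossing `c` is passed twice when one travels along a diagram: `(c, true)` is the passage along
the overpass and `(c, false)` the passage along the underpass. -/

/-- The passages of a set of crossings. -/
abbrev Passage (C : Type) : Type := C × Bool

open Classical in
/-- Exchange the two passages of every crossing in `S`. -/
def flipAt {C : Type} (S : Set C) : Equiv.Perm (Passage C) :=
  Function.Involutive.toPerm (fun q => if q.1 ∈ S then (q.1, !q.2) else q) (by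
    rintro ⟨c, b⟩
    by_cases h : c ∈ S <;> simp [h])

/-- The permutation of the passages of the crossings not in `S`, obtained from `σ` by deleting the
passages of the crossings in `S`. -/
def erasePassages {C : Type} [Finite C] (σ : Equiv.Perm (Passage C)) (S : Set C) :
    Equiv.Perm (Passage {c : C // c ∉ S}) :=
  (Equiv.prodSubtypeFstEquivSubtypeProd (β := Bool) (p := fun c : C => c ∉ S)).permCongr
    (firstReturn σ (fun q => q.1 ∉ S))

/-! ### Link diagrams -/

/-- An oriented (possibly virtual) link diagram, recorded by its signed Gauss diagram. -/
structure LinkDiagram where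
  /-- the (real) crossings -/
  Crossing : Type
  finite : Finite Crossing
  /-- `next q` is the first passage entered after leaving the passage `q` -/
  next : Equiv.Perm (Passage Crossing)
  /-- the sign (local writhe) of a crossing -/
  sign : Crossing → ℤˣ
  /-- the number of components that pass through no crossing -/
  circles : ℕ

namespace LinkDiagram

instance (L : LinkDiagram) : Finite L.Crossing := L.finite

/-- The number of components of the link. -/
def numComponents (L : LinkDiagram) : ℕ := numCycles L.next + L.circles

/-- The four half-edges at each crossing: `(q, true)` is the outgoing and `(q, false)` the incoming
half-edge of the passage `q`. -/
abbrev HalfEdge (L : LinkDiagram) : Type := Passage L.Crossing × Bool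

/-- Pass to the other half of an edge. -/
def acrossEdge (L : LinkDiagram) : Equiv.Perm L.HalfEdge where
  toFun h := if h.2 then (L.next h.1, false) else (L.next.symm h.1, true)
  invFun h := if h.2 then (L.next h.1, false) else (L.next.symm h.1, true)
  left_inv := by rintro ⟨q, _ | _⟩ <;> simp
  right_inv := by rintro ⟨q, _ | _⟩ <;> simp

/-- The counterclockwise successor of a half-edge at its crossing. At a positive crossing the
counterclockwise order is: over out, under out, over in, under in. At a negative crossing it is:
over out, under in, over in, under out. -/
def rotate (L : LinkDiagram) : Equiv.Perm L.HalfEdge where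
  toFun h := ((h.1.1, !h.1.2), if L.sign h.1.1 = 1 then xor h.2 (!h.1.2) else xor h.2 h.1.2)
  invFun h := ((h.1.1, !h.1.2), if L.sign h.1.1 = 1 then xor h.2 h.1.2 else xor h.2 (!h.1.2))
  left_inv := by rintro ⟨⟨c, _ | _⟩, _ | _⟩ <;> by_cases h : L.sign c = 1 <;> simp [h]
  right_inv := by rintro ⟨⟨c, _ | _⟩, _ | _⟩ <;> by_cases h : L.sign c = 1 <;> simp [h]

/-- The number of faces: boundary circles of the band surface thickening the crossings and the
edges between them. -/
def numFaces (L : LinkDiagram) : ℕ := numCycles (L.rotate * L.acrossEdge)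

/-- The number of connected components of the 4-valent graph formed by the crossings and the edges
between them. -/
def numPieces (L : LinkDiagram) : ℕ :=
  Nat.card (MulAction.orbitRel.Quotient
    (Subgroup.closure ({L.rotate, L.acrossEdge} : Set (Equiv.Perm L.HalfEdge))) L.HalfEdge)

/-- The diagram can be drawn in the plane (equivalently, on the sphere) without virtual crossings.
By Euler's formula this says `V - E + F = 2 * numPieces`, where `V` is the number of crossings and
`E = 2 * V`: every connected piece of the graph has genus zero. -/
def IsPlanar (L : LinkDiagram) : Prop :=
  L.numFaces = Nat.card L.Crossing + 2 * L.numPieces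

/-- Delete the crossings in `S` from the Gauss diagram. Components all of whose crossings are
deleted become circles without crossings. -/
def delete (L : LinkDiagram) (S : Set L.Crossing) : LinkDiagram where
  Crossing := {c : L.Crossing // c ∉ S}
  finite := inferInstance
  next := erasePassages L.next S
  sign c := L.sign c.1
  circles := L.circles + numCyclesAvoiding L.next (fun q => q.1 ∉ S)

/-- Smooth the crossing `c` respecting the orientation: one enters along one passage of `c` and
leaves along the other one. -/
def smooth (L : LinkDiagram) (c : L.Crossing) : LinkDiagram where
  Crossing := {x : L.Crossing // x ∉ ({c} : Set L.Crossing)}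
  finite := inferInstance
  next := erasePassages (L.next * flipAt {c}) {c}
  sign x := L.sign x.1
  circles := L.circles +
    numCyclesAvoiding (L.next * flipAt {c}) (fun q => q.1 ∉ ({c} : Set L.Crossing))

open Classical in
/-- Exchange overpass and underpass at the crossing `c`. -/
def changeCrossing (L : LinkDiagram) (c : L.Crossing) : LinkDiagram where
  Crossing := L.Crossing
  finite := L.finite
  next := flipAt {c} * L.next * flipAt {c}
  sign := Function.update L.sign c (-L.sign c)
  circles := L.circles

/-- The passages `u` and `v` are consecutive: `v` comes right after `u` if `s = 1`, and
`u` comes right after `v` if `s = -1`. -/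
def Consecutive (L : LinkDiagram) (s : ℤˣ) (u v : Passage L.Crossing) : Prop :=
  (s = 1 ∧ L.next u = v) ∨ (s = -1 ∧ L.next v = u)

open Classical in
/-- Interchange the passages in each of the pairs `u₁, v₁`, `u₂, v₂`, `u₃, v₃`. -/
def interchange (L : LinkDiagram) (u₁ v₁ u₂ v₂ u₃ v₃ : Passage L.Crossing) : LinkDiagram where
  Crossing := L.Crossing
  finite := L.finite
  next := (Equiv.swap u₁ v₁ * Equiv.swap u₂ v₂ * Equiv.swap u₃ v₃) * L.next *
    (Equiv.swap u₁ v₁ * Equiv.swap u₂ v₂ * Equiv.swap u₃ v₃)⁻¹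
  sign := L.sign
  circles := L.circles

/-- The Reidemeister moves, for all orientations, each move in one of its two directions. -/
inductive Move : LinkDiagram → LinkDiagram → Prop
  /-- renaming the crossings -/
  | relabel (L L' : LinkDiagram) (e : L.Crossing ≃ L'.Crossing)
      (hnext : ∀ q : Passage L.Crossing,
        L'.next (e q.1, q.2) = (e (L.next q).1, (L.next q).2))
      (hsign : ∀ c, L'.sign (e c) = L.sign c)
      (hcircles : L'.circles = L.circles) : Move L L'
  /-- removing a kink -/
  | one (L : LinkDiagram) (c : L.Crossing) (b : Bool)
      (h : L.next (c, b) = (c, !b)) : Move L (L.delete {c})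
  /-- removing two crossings at which one strand passes over another one (the two strands run in
  the same or in opposite directions) -/
  | two (L : LinkDiagram) (a b : L.Crossing) (hab : a ≠ b) (hsign : L.sign a = -L.sign b)
      (hover : L.next (a, true) = (b, true))
      (hunder : L.next (a, false) = (b, false) ∨ L.next (b, false) = (a, false)) :
      Move L (L.delete {a, b})
  /-- moving a strand past a crossing. The top strand passes over the middle one at `x` and over
  the bottom one at `y`; the middle strand passes over the bottom one at `w`. The numbers `t`, `m`,
  `b` tell in which direction the sides of the triangle on the top, middle and bottom strands are
  traversed, and the equations between signs say that the three sides bound a triangle. -/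
  | three (L : LinkDiagram) (x y w : L.Crossing) (hxy : x ≠ y) (hxw : x ≠ w) (hyw : y ≠ w)
      (t m b : ℤˣ)
      (htop : L.Consecutive t (x, true) (y, true))
      (hmiddle : L.Consecutive m (x, false) (w, true))
      (hbottom : L.Consecutive b (y, false) (w, false))
      (h₁ : m * L.sign x = b * L.sign y) (h₂ : m * L.sign w = t * L.sign y) :
      Move L (L.interchange (x, true) (y, true) (x, false) (w, true) (y, false) (w, false))

end LinkDiagram

/-- A diagram of a classical link with at least one component. -/
structure ClassicalLinkDiagram extends LinkDiagram where
  planar : toLinkDiagram.IsPlanar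
  nonempty : Nonempty toLinkDiagram.Crossing ∨ 0 < toLinkDiagram.circles

/-- The diagram of the unknot without crossings. -/
def unknot : ClassicalLinkDiagram where
  Crossing := Empty
  finite := inferInstance
  next := 1
  sign := fun _ => 1
  circles := 1
  planar := by
    simp [LinkDiagram.IsPlanar, LinkDiagram.numFaces, LinkDiagram.numPieces, numCycles]
  nonempty := Or.inr Nat.one_pos

/-- The axioms of the Conway polynomial: it is a link invariant, equals `1` on the unknot, and
satisfies the skein relation `∇(L₊) - ∇(L₋) = z ∇(L₀)`. -/
structure IsConwayPolynomial (P : ClassicalLinkDiagram → ℤ[X]) : Prop where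
  invariant : ∀ L L' : ClassicalLinkDiagram,
    LinkDiagram.Move L.toLinkDiagram L'.toLinkDiagram → P L = P L'
  unknot : P unknot = 1
  skein : ∀ (Lp Lm L0 : ClassicalLinkDiagram) (c : Lp.Crossing), Lp.sign c = 1 →
    Lm.toLinkDiagram = Lp.toLinkDiagram.changeCrossing c →
    L0.toLinkDiagram = Lp.toLinkDiagram.smooth c →
    P Lp - P Lm = X * P L0

/-! ### One-string tangle diagrams -/

/-- A (possibly virtual) diagram of an oriented tangle with one string and any number of closed
components. -/
structure TangleDiagram where
  /-- the (real) crossings -/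
  Crossing : Type
  finite : Finite Crossing
  /-- `next (some q)` is what one meets after leaving the passage `q`: the next passage, or `none`
  if one arrives at the output of the string. `next none` is what one meets after starting at the
  input of the string. -/
  next : Equiv.Perm (Option (Passage Crossing))
  /-- the sign (local writhe) of a crossing -/
  sign : Crossing → ℤˣ
  /-- the number of closed components that pass through no crossing -/
  circles : ℕ

namespace TangleDiagram

instance (T : TangleDiagram) : Finite T.Crossing := T.finite

instance (T : TangleDiagram) : Fintype T.Crossing := Fintype.ofFinite _

/-- The number of closed components; the string is the cycle through `none`. -/
def numClosedComponents (T : TangleDiagram) : ℕ :=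
  Nat.card {z : Cycles T.next // z ≠ cycleOf T.next none} + T.circles

/-- Follow the diagram obtained from `T` by smoothing the crossings in `S`: on entering a passage
of a smoothed crossing one leaves along the other passage. -/
def smoothedNext (T : TangleDiagram) (S : Set T.Crossing) :
    Equiv.Perm (Option (Passage T.Crossing)) :=
  T.next * Equiv.optionCongr (flipAt S)

/-- A state `S` is coherent: smoothing `S` leaves no closed components. (The ordering of a
tangle with one string is always coherent.) -/
def IsCoherent (T : TangleDiagram) (S : Set T.Crossing) : Prop :=
  T.circles = 0 ∧ ∀ q, (T.smoothedNext S).SameCycle none q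

/-- A state `S` is descending: it is coherent and, following the smoothed string from its input,
one enters the neighbourhood of each crossing of `S` for the first time along the overpass. -/
def IsDescending (T : TangleDiagram) (S : Set T.Crossing) : Prop :=
  T.IsCoherent S ∧ ∀ s ∈ S, ∃ i : ℕ,
    (T.smoothedNext S ^ i) none = some (s, true) ∧
    ∀ j < i, (T.smoothedNext S ^ j) none ≠ some (s, false)

open Classical in
/-- `c_n(T)`: the sum of the signs of all descending `n`-states. -/
def coeff (T : TangleDiagram) (n : ℕ) : ℤ :=
  ∑ S ∈ Finset.univ.filter (fun S : Finset T.Crossing =>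
      S.card = n ∧ T.IsDescending (S : Set T.Crossing)),
    ∏ s ∈ S, (T.sign s : ℤ)

/-- `∇(T) = ∑ c_n(T) z^n`; there are no `n`-states if `n` exceeds the number of crossings. -/
def nabla (T : TangleDiagram) : ℤ[X] :=
  ∑ n ∈ Finset.range (Nat.card T.Crossing + 1), C (T.coeff n) * X ^ n

open Classical in
/-- The closure: the output of the string is joined to its input by an arc without crossings. -/
def closure (T : TangleDiagram) : LinkDiagram where
  Crossing := T.Crossing
  finite := T.finite
  next := Equiv.removeNone T.next
  sign := T.sign
  circles := T.circles + if T.next none = none then 1 else 0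

end TangleDiagram

/-- A diagram of a classical tangle with one string. A diagram with a single string can be drawn
in a disk, with the endpoints of the string on the boundary and without virtual crossings, if and
only if its closure can be drawn on the sphere: the sphere is obtained from the disk by collapsing
the boundary together with the closing arc to a point of the closed string. -/
structure ClassicalTangleDiagram extends TangleDiagram where
  planar : toTangleDiagram.closure.IsPlanar

theorem closure_nonempty (T : TangleDiagram) :
    Nonempty T.closure.Crossing ∨ 0 < T.closure.circles := by
  classical
  rcases isEmpty_or_nonempty T.Crossing with h | h
  · right
    have h1 : T.next none = none := Subsingleton.elim _ _
    simp [TangleDiagram.closure, h1]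
  · exact Or.inl h

/-- The closure of a classical tangle with one string, as a classical link diagram. -/
def ClassicalTangleDiagram.closure (T : ClassicalTangleDiagram) : ClassicalLinkDiagram where
  toLinkDiagram := T.toTangleDiagram.closure
  planar := T.planar
  nonempty := closure_nonempty T.toTangleDiagram

end

end ConwayTangle

/-! A one-string tangle is a link diagram cut open at one point, so the state sum is a polynomial
attached to a link diagram with a chosen cut. Two of its properties are purely combinatorial and
need no planarity. The first is the skein relation (`TangleDiagram.skein`): a coherent state
containing the crossing `c` enters `c` first along exactly one of its passages, so exactly one of
the diagram and its crossing change accepts it, with opposite signs. The second is invariance under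
Reidemeister moves performed away from the cut. A smoothed kink splits off a circle. For bigons and
triangles the states are grouped by their part outside of the picture; the outside matters only
through the way it connects the ends of the strands and through the order in which its arcs are
traversed, which leaves a finite verification (`bigon_balanced`, `triangle_balanced`).

What remains is independence of the cut (`LinkDiagram.cutInvariant_of_isPlanar`), and here planarity
enters. The proof is by induction on the number of crossings. Pushing the cut along its component
past one crossing affects only the states containing this crossing. Their contribution is zero when
the crossing is passed along its underpass; along its overpass it is a multiple of the polynomial of
the smoothed diagram, cut at two different places, and the induction hypothesis applies
(`LinkDiagram.cutAfter_nabla_next`). To reach other components the diagram is simplified. Crossing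
changes are permitted, because the skein relation expresses their effect by a diagram with fewer
crossings; kinks and bigons can be removed once they appear, and triangles can be flipped.

That every planar diagram can be simplified in this way is `LinkDiagram.reduction`. The faces are
labelled by their distance from a base face of their connected piece. A checkerboard colouring makes
the labels of adjacent faces differ by exactly one. A discharging argument, in which each crossing
distributes four units of charge over its corners, shows that some face with nonzero label is a
monogon, a bigon, or a triangle with a corner at which the labels descend by two towards the
opposite face (`IsLabelling.exists_isSmall`). Flipping such a triangle lowers the sum of the labels,
so the process ends.

Planarity is used in the homological form `Exact`: every cycle modulo 2 on the edges is the boundary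
of a set of faces. A dimension count identifies this with Euler's formula
(`LinkDiagram.isPlanar_iff_exact`). In this form it passes easily to smoothings, deletions, crossing
changes and triangle flips.

Existence of the Conway polynomial then follows by cutting a diagram anywhere, away from a given
move. For uniqueness, the difference of two candidates vanishes by the same reduction. Diagrams
without crossings are settled by the skein relation at a kink, whose two resolutions have the same
value, together with cancellation of `X`. -/

namespace ConwayTangle

noncomputable section

/-! ### Paths and first return maps -/

section Paths
variable {X Y : Type}

/-- Starting from `x`, the map `f` visits the entries of `l` and then `y`. -/
def Path (f : X → X) : X → List X → X → Prop
  | x, [], y => f x = y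
  | x, a :: l, y => f x = a ∧ Path f a l y

theorem path_append_cons {f : X → X} {x y a : X} {l₁ l₂ : List X} :
    Path f x (l₁ ++ a :: l₂) y ↔ Path f x l₁ a ∧ Path f a l₂ y := by
  induction l₁ generalizing x with
  | nil => simp [Path]
  | cons b l ih => simp [Path, ih, and_assoc]

theorem Path.congr {f f' : X → X} {x y : X} {l : List X} (h : Path f x l y)
    (hx : f' x = f x) (hl : ∀ a ∈ l, f' a = f a) : Path f' x l y := by
  induction l generalizing x with
  | nil => exact hx.trans h
  | cons b l ih =>
    exact ⟨hx.trans h.1, ih h.2 (hl b (by simp)) fun a ha => hl a (by simp [ha])⟩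

/-- Both paths follow the same map from the same point and stop at their first point in `p`. -/
theorem Path.unique (p : X → Prop) {f : X → X} {x y y' : X} {l l' : List X}
    (h : Path f x l y) (h' : Path f x l' y') (hl : ∀ a ∈ l, ¬ p a) (hl' : ∀ a ∈ l', ¬ p a)
    (hy : p y) (hy' : p y') : l = l' ∧ y = y' := by
  induction l generalizing x l' with
  | nil =>
    cases l' with
    | nil => exact ⟨rfl, h.symm.trans h'⟩
    | cons b l' => exact absurd (h'.1 ▸ h ▸ hy) (hl' b (by simp))
  | cons a l ih =>
    cases l' with
    | nil => exact absurd (h.1 ▸ h' ▸ hy') (hl a (by simp))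
    | cons b l' =>
      have hab : a = b := h.1.symm.trans h'.1
      subst hab
      have := ih h.2 h'.2 (fun c hc => hl c (by simp [hc])) (fun c hc => hl' c (by simp [hc]))
      exact ⟨by rw [this.1], this.2⟩

theorem Path.split {f : X → X} {x a z : X} {l₁ l : List X} (h₁ : Path f x l₁ a)
    (h : Path f x l z) (hl₁ : z ∉ l₁) (ha : a ≠ z) :
    ∃ r, l = l₁ ++ a :: r ∧ Path f a r z := by
  induction l₁ generalizing x l with
  | nil =>
    cases l with
    | nil => exact absurd (h₁.symm.trans h) ha
    | cons b r =>
      have : b = a := h.1.symm.trans h₁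
      subst this
      exact ⟨r, rfl, h.2⟩
  | cons c l₁ ih =>
    cases l with
    | nil => exact absurd (h.symm.trans h₁.1) (fun e => hl₁ (by simp [e]))
    | cons b r =>
      have : b = c := h.1.symm.trans h₁.1
      subst this
      obtain ⟨r', rfl, hr⟩ := ih h₁.2 h.2 (fun e => hl₁ (by simp [e]))
      exact ⟨r', rfl, hr⟩

theorem Path.sameCycle {f : Equiv.Perm X} {x y : X} {l : List X} (h : Path f x l y) :
    f.SameCycle x y := by
  induction l generalizing x with
  | nil => exact ⟨1, h⟩
  | cons a l ih => exact Equiv.Perm.SameCycle.trans ⟨1, h.1⟩ (ih h.2)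

theorem path_range (f : Equiv.Perm X) (x : X) (n : ℕ) :
    Path f x ((List.range n).map fun k => (f ^ (k + 1)) x) ((f ^ (n + 1)) x) := by
  induction n with
  | zero => simp [Path]
  | succ n ih =>
    rw [List.range_succ, List.map_append, List.map_singleton, path_append_cons]
    refine ⟨ih, ?_⟩
    simp only [Path]
    rw [pow_succ' f (n + 1), Equiv.Perm.mul_apply]

theorem Path.pow_apply {f : Equiv.Perm X} {x y : X} {l : List X} (h : Path f x l y)
    (i : ℕ) (hi : i < l.length) : (f ^ (i + 1)) x = l[i] := by
  induction l generalizing x i with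
  | nil => simp at hi
  | cons a l ih =>
    cases i with
    | zero => simpa using h.1
    | succ i =>
      rw [pow_succ, Equiv.Perm.mul_apply, h.1, ih h.2 i (by simpa using hi)]
      simp

/-- `g` is the first return map of `f` to the points of the form `j y`. -/
def IsErase (f : Equiv.Perm X) (g : Equiv.Perm Y) (j : Y → X) : Prop :=
  ∀ y, ∃ l : List X, Path f (j y) l (j (g y)) ∧ ∀ a ∈ l, a ∉ Set.range j

theorem IsErase.unique {f : Equiv.Perm X} {g g' : Equiv.Perm Y} {j : Y → X}
    (hj : Function.Injective j) (h : IsErase f g j) (h' : IsErase f g' j) : g = g' := by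
  ext y
  obtain ⟨l, hl, hl'⟩ := h y
  obtain ⟨k, hk, hk'⟩ := h' y
  exact hj (hl.unique (· ∈ Set.range j) hk hl' hk' ⟨_, rfl⟩ ⟨_, rfl⟩).2

theorem firstReturn_isErase [Finite X] (f : Equiv.Perm X) (p : X → Prop) :
    IsErase f (firstReturn f p) Subtype.val := by
  classical
  intro y
  refine ⟨_, path_range f y.1 (Nat.find (exists_return f p y.1 y.2)), ?_⟩
  intro a ha
  simp only [List.mem_map, List.mem_range] at ha
  obtain ⟨k, hk, rfl⟩ := ha
  rintro ⟨z, hz⟩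
  exact Nat.find_min (exists_return f p y.1 y.2) hk (hz ▸ z.2)

theorem IsErase.permCongr {Z : Type} {f : Equiv.Perm X} {g : Equiv.Perm Y} {j : Y → X}
    (h : IsErase f g j) (e : Y ≃ Z) : IsErase f (e.permCongr g) (j ∘ e.symm) := by
  intro z
  obtain ⟨l, hl, hl'⟩ := h (e.symm z)
  refine ⟨l, by simpa using hl, fun a ha => ?_⟩
  rintro ⟨w, hw⟩
  exact hl' a ha ⟨e.symm w, hw⟩

theorem exists_isErase [Finite X] (f : Equiv.Perm X) {j : Y → X} (hj : Function.Injective j) :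
    ∃ g : Equiv.Perm Y, IsErase f g j := by
  refine ⟨(Equiv.ofInjective j hj).symm.permCongr (firstReturn f (· ∈ Set.range j)), ?_⟩
  exact (firstReturn_isErase f (· ∈ Set.range j)).permCongr (Equiv.ofInjective j hj).symm

/-- The inclusion of the passages of the crossings not in `S`. -/
def inclPassage {C : Type} (S : Set C) (q : Passage {c : C // c ∉ S}) : Passage C := (q.1.1, q.2)

theorem inclPassage_injective {C : Type} (S : Set C) : Function.Injective (inclPassage S) := by
  rintro ⟨⟨c, hc⟩, b⟩ ⟨⟨c', hc'⟩, b'⟩ h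
  simp only [inclPassage, Prod.mk.injEq] at h
  simp [h.1, h.2]

theorem mem_range_inclPassage {C : Type} {S : Set C} {q : Passage C} :
    q ∈ Set.range (inclPassage S) ↔ q.1 ∉ S := by
  constructor
  · rintro ⟨r, rfl⟩; exact r.1.2
  · intro h; exact ⟨(⟨q.1, h⟩, q.2), rfl⟩

theorem erasePassages_isErase {C : Type} [Finite C] (σ : Equiv.Perm (Passage C)) (S : Set C) :
    IsErase σ (erasePassages σ S) (inclPassage S) :=
  (firstReturn_isErase σ (fun q => q.1 ∉ S)).permCongr
    (Equiv.prodSubtypeFstEquivSubtypeProd (β := Bool) (p := fun c : C => c ∉ S))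

theorem exists_map_some {l : List (Option X)} (h : none ∉ l) : ∃ l' : List X, l = l'.map some := by
  induction l with
  | nil => exact ⟨[], rfl⟩
  | cons a l ih =>
    obtain ⟨l', rfl⟩ := ih (fun e => h (by simp [e]))
    cases a with
    | none => simp at h
    | some a => exact ⟨a :: l', rfl⟩

theorem Path.removeNone {f : Equiv.Perm (Option X)} {x y : X} {l : List X}
    (h : Path f (some x) (l.map some) (some y)) : Path (Equiv.removeNone f) x l y := by
  induction l generalizing x with
  | nil =>
    have := Equiv.removeNone_some f ⟨_, h⟩
    exact Option.some_injective _ (this.trans h)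
  | cons a l ih =>
    have := Equiv.removeNone_some f ⟨_, h.1⟩
    exact ⟨Option.some_injective _ (this.trans h.1), ih h.2⟩

/-- `removeNone` sews the output of the string to its input, so an arc arriving at `none` continues
with the arc that starts there. -/
theorem Path.removeNone_through {f : Equiv.Perm (Option X)} {x y : X} {l l' : List X}
    (h : Path f (some x) (l.map some) none) (h' : Path f none (l'.map some) (some y)) :
    Path (Equiv.removeNone f) x (l ++ l') y := by
  induction l generalizing x with
  | nil =>
    have hx := Equiv.removeNone_none f h
    cases l' with
    | nil => exact Option.some_injective _ (hx.trans h')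
    | cons a l' => exact ⟨Option.some_injective _ (hx.trans h'.1), h'.2.removeNone⟩
  | cons a l ih =>
    have := Equiv.removeNone_some f ⟨_, h.1⟩
    exact ⟨Option.some_injective _ (this.trans h.1), ih h.2⟩

theorem map_some_notMem_range {j : Y → X} {l : List X}
    (h : ∀ a ∈ l.map some, a ∉ Set.range (Option.map j)) : ∀ a ∈ l, a ∉ Set.range j := by
  rintro a ha ⟨y, rfl⟩
  exact h (some (j y)) (List.mem_map_of_mem ha) ⟨some y, rfl⟩

theorem IsErase.exists_list {f : Equiv.Perm (Option X)} {g : Equiv.Perm (Option Y)} {j : Y → X}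
    (h : IsErase f g (Option.map j)) (y : Option Y) :
    ∃ l : List X, Path f (y.map j) (l.map some) ((g y).map j) ∧ ∀ a ∈ l, a ∉ Set.range j := by
  obtain ⟨l, hl, hl'⟩ := h y
  obtain ⟨l, rfl⟩ := exists_map_some (fun e => hl' _ e ⟨none, rfl⟩)
  exact ⟨l, hl, map_some_notMem_range hl'⟩

theorem IsErase.of_list {f : Equiv.Perm (Option X)} {g : Equiv.Perm (Option Y)} {j : Y → X}
    (h : ∀ y : Option Y, ∃ l : List X, Path f (y.map j) (l.map some) ((g y).map j) ∧
      ∀ a ∈ l, a ∉ Set.range j) : IsErase f g (Option.map j) := by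
  intro y
  obtain ⟨l, hl, hl'⟩ := h y
  refine ⟨_, hl, ?_⟩
  simp only [List.mem_map, Set.mem_range, not_exists, forall_exists_index, and_imp]
  rintro _ a ha rfl z hz
  cases z with
  | none => simp at hz
  | some z => exact hl' a ha ⟨z, by simpa using hz⟩

theorem IsErase.removeNone {f : Equiv.Perm (Option X)} {g : Equiv.Perm (Option Y)} {j : Y → X}
    (h : IsErase f g (Option.map j)) : IsErase (Equiv.removeNone f) (Equiv.removeNone g) j := by
  intro y
  obtain ⟨l, hl, hl'⟩ := h.exists_list (some y)
  rcases hg : g (some y) with _ | y'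
  · obtain ⟨k, hk, hk'⟩ := h.exists_list none
    have e := Equiv.removeNone_none g hg
    rw [hg] at hl
    rw [← e] at hk
    refine ⟨l ++ k, hl.removeNone_through hk, ?_⟩
    intro a ha
    rcases List.mem_append.1 ha with ha | ha
    exacts [hl' a ha, hk' a ha]
  · have e := Equiv.removeNone_some g ⟨_, hg⟩
    rw [← e] at hl
    exact ⟨l, hl.removeNone, hl'⟩

end Paths

/-! ### Traversals -/

section Trav
variable {A B : Type}

/-- The cycle of `f` through `none` consists of all points, in the order given by the list. -/
def Trav (f : Equiv.Perm (Option A)) (ℓ : List A) : Prop :=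
  Path f none (ℓ.map some) none ∧ ∀ a, a ∈ ℓ

theorem path_none_unique {f : Option A → Option A} {x : Option A} {ℓ ℓ' : List A}
    (h : Path f x (ℓ.map some) none) (h' : Path f x (ℓ'.map some) none) : ℓ = ℓ' := by
  have := (h.unique (· = none) h' (by simp) (by simp) rfl rfl).1
  exact List.map_injective_iff.2 (Option.some_injective _) this

theorem Trav.unique {f : Equiv.Perm (Option A)} {ℓ ℓ' : List A} (h : Trav f ℓ) (h' : Trav f ℓ') :
    ℓ = ℓ' := path_none_unique h.1 h'.1

theorem pair_sublist_iff {a b : A} {ℓ : List A} :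
    [a, b].Sublist ℓ ↔ ∃ l₁ l₂ l₃, ℓ = l₁ ++ a :: (l₂ ++ b :: l₃) := by
  constructor
  · intro h
    rw [List.cons_sublist_iff] at h
    obtain ⟨r₁, r₂, rfl, h₁, h₂⟩ := h
    obtain ⟨s, t, rfl⟩ := List.append_of_mem h₁
    rw [List.singleton_sublist] at h₂
    obtain ⟨s', t', rfl⟩ := List.append_of_mem h₂
    exact ⟨s, t ++ s', t', by simp⟩
  · rintro ⟨l₁, l₂, l₃, rfl⟩
    refine List.Sublist.trans ?_ (List.sublist_append_right _ _)
    refine List.Sublist.cons_cons _ (List.Sublist.trans ?_ (List.sublist_append_right _ _))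
    simp

theorem path_none_nodup {f : Equiv.Perm (Option A)} {x : Option A} {ℓ : List A}
    (h : Path f x (ℓ.map some) none) : ℓ.Nodup := by
  rw [List.nodup_iff_sublist]
  intro a ha
  obtain ⟨l₁, l₂, l₃, rfl⟩ := pair_sublist_iff.1 ha
  simp only [List.map_append, List.map_cons] at h
  have h₁ := (path_append_cons.1 h).2
  have h₂ := (path_append_cons.1 h₁).2
  have h₁' : Path f (some a) ((l₂ ++ a :: l₃).map some) none := by simpa using h₁
  have := congrArg List.length (path_none_unique h₁' h₂)
  simp at this
  omega

theorem Trav.nodup {f : Equiv.Perm (Option A)} {ℓ : List A} (h : Trav f ℓ) : ℓ.Nodup :=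
  path_none_nodup h.1

/-- The list is read off from the first return of `none` to itself. -/
theorem exists_trav_iff [Finite A] {f : Equiv.Perm (Option A)} :
    (∃ ℓ, Trav f ℓ) ↔ ∀ a, f.SameCycle none a := by
  classical
  constructor
  · rintro ⟨ℓ, h, hc⟩ a
    cases a with
    | none => rfl
    | some a =>
      obtain ⟨s, t, rfl⟩ := List.append_of_mem (hc a)
      rw [List.map_append, List.map_cons, path_append_cons] at h
      exact h.1.sameCycle
  · intro h
    have hex := exists_return f (· = none) none rfl
    obtain ⟨n, hn, hmin⟩ : ∃ n, (f ^ (n + 1)) none = none ∧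
        ∀ m < n, (f ^ (m + 1)) none ≠ none :=
      ⟨Nat.find hex, Nat.find_spec hex, fun m hm => Nat.find_min hex hm⟩
    have hp := path_range f none n
    rw [hn] at hp
    obtain ⟨ℓ, hℓ⟩ : ∃ ℓ : List A, (List.range n).map (fun k => (f ^ (k + 1)) none)
        = ℓ.map some := by
      apply exists_map_some
      simp only [List.mem_map, List.mem_range, not_exists, not_and]
      exact hmin
    rw [hℓ] at hp
    refine ⟨ℓ, hp, fun a => ?_⟩
    obtain ⟨i, -, hi⟩ := (h (some a)).exists_pow_eq'
    -- `none` has period `n + 1`, so exponents may be reduced modulo `n + 1`.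
    have hr : (f ^ (i % (n + 1))) none = some a := by
      rw [← hi]
      conv_rhs => rw [← Nat.mod_add_div i (n + 1), pow_add, Equiv.Perm.mul_apply, pow_mul]
      have : ∀ k : ℕ, ((f ^ (n + 1)) ^ k) none = none := by
        intro k
        induction k with
        | zero => rfl
        | succ k ih => rw [pow_succ, Equiv.Perm.mul_apply, hn, ih]
      rw [this]
    have hlt := Nat.mod_lt i (Nat.succ_pos n)
    rcases hk : i % (n + 1) with _ | k
    · rw [hk] at hr; simp at hr
    · rw [hk] at hr hlt
      have : some a ∈ ℓ.map some := by
        rw [← hℓ, ← hr]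
        exact List.mem_map.2 ⟨k, List.mem_range.2 (by omega), rfl⟩
      simpa using this

/-- Translates the definition of a descending state, in terms of powers of the permutation, into the
order of two entries in the traversal. All later arguments compare sublists. -/
theorem Trav.before_iff {f : Equiv.Perm (Option A)} {ℓ : List A} (h : Trav f ℓ) {a b : A}
    (hab : a ≠ b) : (∃ i : ℕ, (f ^ i) none = some a ∧ ∀ j < i, (f ^ j) none ≠ some b) ↔
      [a, b].Sublist ℓ := by
  have hnd := h.nodup
  have key : ∀ (s t : List A), ℓ = s ++ t → ∀ i (hi : i < s.length),
      (f ^ (i + 1)) none = some s[i] := by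
    rintro s t rfl i hi
    rw [h.1.pow_apply i (by simp; omega), List.getElem_map, List.getElem_append_left hi]
  constructor
  · rintro ⟨i, hi, hlt⟩
    obtain ⟨s, t, rfl⟩ := List.append_of_mem (h.2 a)
    have hb := h.2 b
    simp only [List.mem_append, List.mem_cons, hab.symm, false_or] at hb
    rcases hb with hb | hb
    · exfalso
      obtain ⟨u, v, rfl⟩ := List.append_of_mem hb
      have h₁ := key (u ++ [b]) (v ++ a :: t) (by simp) u.length (by simp)
      simp only [List.getElem_concat_length] at h₁
      have h₂ : i ≤ u.length := by
        by_contra hc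
        rcases eq_or_ne i (u.length + 1) with rfl | hne
        · exact hab (Option.some_injective _ (hi.symm.trans h₁))
        · exact hlt _ (by omega) h₁
      cases i with
      | zero => simp at hi
      | succ i =>
        have h₃ := key u (b :: v ++ a :: t) (by simp) i (by omega)
        have h₄ : a ∈ u := by
          rw [Option.some_injective _ (hi.symm.trans h₃)]
          exact List.getElem_mem _
        have := List.disjoint_of_nodup_append hnd
        exact this (List.mem_append_left _ h₄) (by simp)
    · obtain ⟨u, v, rfl⟩ := List.append_of_mem hb
      exact pair_sublist_iff.2 ⟨_, _, _, rfl⟩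
  · intro hs
    obtain ⟨l₁, l₂, l₃, rfl⟩ := pair_sublist_iff.1 hs
    refine ⟨l₁.length + 1, ?_, ?_⟩
    · have := key (l₁ ++ [a]) (l₂ ++ b :: l₃) (by simp) l₁.length (by simp)
      simpa using this
    · intro j hj hb
      cases j with
      | zero => simp at hb
      | succ j =>
        have h₃ := key l₁ _ rfl j (by omega)
        have h₄ : b ∈ l₁ := by
          rw [Option.some_injective _ (hb.symm.trans h₃)]
          exact List.getElem_mem _
        exact List.disjoint_of_nodup_append hnd h₄ (by simp)

theorem sublist_map_iff_of_injective {j : B → A} (hj : Function.Injective j) {l l' : List B} :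
    (l.map j).Sublist (l'.map j) ↔ l.Sublist l' := by
  constructor
  · intro h
    obtain ⟨k, hk, hk'⟩ := List.sublist_map_iff.1 h
    rwa [List.map_injective_iff.2 hj hk']
  · exact fun h => h.map j

/-- Erasing points of a cycle filters its traversal, which in particular preserves the order of the
points that are kept. -/
theorem Path.erase {f : Equiv.Perm (Option A)} {g : Equiv.Perm (Option B)} {j : B → A}
    (he : IsErase f g (Option.map j)) (x : Option B) (ℓ : List A)
    (h : Path f (x.map j) (ℓ.map some) none) :
    ∃ ℓ' : List B, Path g x (ℓ'.map some) none ∧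
      open Classical in ℓ'.map j = ℓ.filter (· ∈ Set.range j) := by
  classical
  -- The recursion jumps to the next kept point, so the induction runs over a bound for the length.
  obtain ⟨n, hn⟩ : ∃ n, ℓ.length ≤ n := ⟨_, le_rfl⟩
  induction n generalizing x ℓ with
  | zero =>
    obtain rfl : ℓ = [] := by simpa using hn
    refine ⟨[], ?_, rfl⟩
    obtain ⟨l, hl, hl'⟩ := he.exists_list x
    have hu := hl.unique (· ∈ Set.range (Option.map j)) h (y' := none)
      (by
        simp only [List.mem_map, Set.mem_range, not_exists, forall_exists_index, and_imp]
        rintro _ a ha rfl z hz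
        cases z with
        | none => simp at hz
        | some z => exact hl' a ha ⟨z, by simpa using hz⟩) (by simp) ⟨_, rfl⟩ ⟨none, rfl⟩
    exact Option.map_eq_none_iff.1 hu.2
  | succ n ih =>
    obtain ⟨l, hl, hl'⟩ := he.exists_list x
    have hfl : l.filter (· ∈ Set.range j) = [] := by
      simpa [List.filter_eq_nil_iff] using hl'
    rcases hg : g x with _ | y
    · rw [hg] at hl
      obtain rfl := path_none_unique hl h
      exact ⟨[], by simpa [Path] using hg, by rw [hfl]; rfl⟩
    · rw [hg] at hl
      obtain ⟨r, hr, hp⟩ := hl.split h (by simp) (by simp)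
      have hnr : none ∉ r := by
        intro e
        have : none ∈ ℓ.map some := by rw [hr]; simp [e]
        simp at this
      obtain ⟨r, rfl⟩ := exists_map_some hnr
      have hℓ : ℓ = l ++ j y :: r := by
        apply List.map_injective_iff.2 (Option.some_injective A)
        simpa using hr
      subst hℓ
      obtain ⟨k, hk, hk'⟩ := ih (some y) r hp (by simp at hn; omega)
      refine ⟨y :: k, ⟨hg, hk⟩, ?_⟩
      rw [List.filter_append, hfl, List.filter_cons_of_pos (by simp), List.map_cons, hk']
      rfl

theorem Trav.erase {f : Equiv.Perm (Option A)} {g : Equiv.Perm (Option B)} {j : B → A}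
    (he : IsErase f g (Option.map j)) (hj : Function.Injective j) {ℓ : List A} (h : Trav f ℓ) :
    ∃ ℓ' : List B, Trav g ℓ' ∧ open Classical in ℓ'.map j = ℓ.filter (· ∈ Set.range j) := by
  classical
  obtain ⟨k, hk, hk'⟩ := Path.erase he none ℓ h.1
  refine ⟨k, ⟨hk, fun b => ?_⟩, by convert hk'⟩
  have : j b ∈ k.map j := by
    rw [hk']
    simpa using h.2 (j b)
  obtain ⟨b', hb', e⟩ := List.mem_map.1 this
  exact hj e ▸ hb'

theorem Trav.pair_erase {f : Equiv.Perm (Option A)} {g : Equiv.Perm (Option B)} {j : B → A}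
    (he : IsErase f g (Option.map j)) (hj : Function.Injective j) {ℓ : List A} {ℓ' : List B}
    (h : Trav f ℓ) (h' : Trav g ℓ') {a b : B} : [a, b].Sublist ℓ' ↔ [j a, j b].Sublist ℓ := by
  classical
  obtain ⟨k, hk, hk'⟩ := h.erase he hj
  obtain rfl := hk.unique h'
  rw [← sublist_map_iff_of_injective hj, hk']
  constructor
  · exact fun hs => hs.trans List.filter_sublist
  · intro hs
    have := hs.filter (fun x => decide (x ∈ Set.range j))
    simpa using this

theorem IsErase.sameCycle {f : Equiv.Perm A} {g : Equiv.Perm B} {j : B → A}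
    (he : IsErase f g j) [Finite B] {a b : B} (h : g.SameCycle a b) :
    f.SameCycle (j a) (j b) := by
  obtain ⟨i, -, rfl⟩ := h.exists_pow_eq'
  clear h
  induction i with
  | zero => exact Equiv.Perm.SameCycle.refl _ _
  | succ i ih =>
    rw [pow_succ', Equiv.Perm.mul_apply]
    obtain ⟨l, hl, -⟩ := he ((g ^ i) a)
    exact ih.trans hl.sameCycle

/-- Erasing points neither creates nor destroys the property of having a single cycle, unless
there is a cycle all of whose points are erased. -/
theorem IsErase.exists_trav_iff [Finite A] [Finite B] {f : Equiv.Perm (Option A)}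
    {g : Equiv.Perm (Option B)} {j : B → A} (he : IsErase f g (Option.map j))
    (hj : Function.Injective j) :
    (∃ ℓ, Trav f ℓ) ↔ (∃ ℓ, Trav g ℓ) ∧ ∀ a, ∃ b : Option B, f.SameCycle (b.map j) a := by
  constructor
  · rintro ⟨ℓ, h⟩
    obtain ⟨k, hk, -⟩ := h.erase he hj
    exact ⟨⟨k, hk⟩, fun a => ⟨none, ConwayTangle.exists_trav_iff.1 ⟨ℓ, h⟩ a⟩⟩
  · rintro ⟨h, hc⟩
    rw [ConwayTangle.exists_trav_iff] at h ⊢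
    intro a
    obtain ⟨b, hb⟩ := hc a
    exact (he.sameCycle (h b)).trans hb

end Trav

/-! ### Counting cycles -/

section Cycles
variable {X Y A B : Type}

theorem IsErase.sameCycle_iff [Finite X] [Finite Y] {f : Equiv.Perm X} {g : Equiv.Perm Y}
    {j : Y → X} (he : IsErase f g j) (hj : Function.Injective j) {a b : Y} :
    f.SameCycle (j a) (j b) ↔ g.SameCycle a b := by
  refine ⟨fun h => ?_, he.sameCycle⟩
  obtain ⟨n, -, hn⟩ := h.exists_pow_eq'
  clear h
  induction n using Nat.strong_induction_on generalizing a with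
  | _ n ih =>
    obtain ⟨l, hl, hl'⟩ := he a
    rcases Nat.eq_zero_or_pos n with rfl | hpos
    · exact hj hn ▸ Equiv.Perm.SameCycle.refl _ _
    have hlast : (f ^ (l.length + 1)) (j a) = j (g a) := by
      have : Path f (j a) (l ++ j (g a) :: []) (f (j (g a))) :=
        path_append_cons.2 ⟨hl, rfl⟩
      rw [this.pow_apply l.length (by simp)]
      simp
    rcases lt_or_ge (l.length) n with hlt | hge
    · have h₁ : (f ^ (n - (l.length + 1))) (j (g a)) = j b := by
        rw [← hlast, ← Equiv.Perm.mul_apply, ← pow_add, Nat.sub_add_cancel hlt, hn]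
      exact Equiv.Perm.SameCycle.trans ⟨1, by simp⟩ (ih _ (by omega) h₁)
    -- Stopping before the first return would make `j b` one of the erased points.
    · obtain ⟨m, rfl⟩ : ∃ m, n = m + 1 := ⟨n - 1, by omega⟩
      rw [hl.pow_apply m hge] at hn
      exact absurd ⟨b, hn.symm⟩ (hl' _ (List.getElem_mem _))

theorem removeNone_isErase (f : Equiv.Perm (Option A)) :
    IsErase f (Equiv.removeNone f) some := by
  intro a
  rcases h : f (some a) with _ | b
  · exact ⟨[none], ⟨h, (Equiv.removeNone_none f h).symm⟩, by simp⟩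
  · exact ⟨[], (Equiv.removeNone_some f ⟨_, h⟩).symm, by simp⟩

theorem Path.apply_mem {f : X → X} {x y : X} {l : List X} (h : Path f x l y) :
    f x ∈ l ∨ f x = y := by
  cases l with
  | nil => exact Or.inr h
  | cons a l => exact Or.inl (by rw [h.1]; simp)

theorem Path.apply_mem_of_mem {f : X → X} {x y a : X} {l : List X} (h : Path f x l y)
    (ha : a ∈ l) : f a ∈ l ∨ f a = y := by
  obtain ⟨s, t, rfl⟩ := List.append_of_mem ha
  rcases (path_append_cons.1 h).2.apply_mem with h | h
  · exact Or.inl (by simp [h])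
  · exact Or.inr h

theorem Path.mem_of_sameCycle [Finite X] {f : Equiv.Perm X} {x a : X} {l : List X}
    (h : Path f x l x) (ha : f.SameCycle x a) : a = x ∨ a ∈ l := by
  obtain ⟨n, -, rfl⟩ := ha.exists_pow_eq'
  clear ha
  induction n with
  | zero => exact Or.inl rfl
  | succ n ih =>
    rw [pow_succ', Equiv.Perm.mul_apply]
    rcases ih with h' | h'
    · rw [h']; exact h.apply_mem.symm
    · exact (h.apply_mem_of_mem h').symm

/-- Detects when a string loses all its crossings, so that its closure becomes a circle without
crossings. -/
theorem IsErase.apply_none_iff [Finite A] {f : Equiv.Perm (Option A)}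
    {g : Equiv.Perm (Option B)} {j : B → A} (he : IsErase f g (Option.map j)) :
    g none = none ↔ ∀ a, f.SameCycle none (some a) → a ∉ Set.range j := by
  obtain ⟨l, hl, hl'⟩ := he.exists_list none
  constructor
  · intro hg a ha
    rw [hg] at hl
    rcases hl.mem_of_sameCycle ha with h | h
    · simp at h
    · exact hl' a (by simpa using h)
  · intro h
    rcases hg : g none with _ | b
    · rfl
    · rw [hg] at hl
      exact absurd ⟨b, rfl⟩ (h (j b) hl.sameCycle)

theorem cycleOf_eq_iff {f : Equiv.Perm X} {x y : X} :
    cycleOf f x = cycleOf f y ↔ f.SameCycle x y := Quotient.eq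

theorem numCyclesAvoiding_eq_zero_iff [Finite X] {f : Equiv.Perm X} {p : X → Prop} :
    numCyclesAvoiding f p = 0 ↔ ∀ x, ∃ y, p y ∧ f.SameCycle y x := by
  unfold numCyclesAvoiding
  rw [Finite.card_eq_zero_iff, isEmpty_subtype]
  constructor
  · intro h x
    have := h (cycleOf f x)
    push Not at this
    obtain ⟨y, hy, hp⟩ := this
    exact ⟨y, hp, cycleOf_eq_iff.1 hy⟩
  · intro h z
    induction z using Quotient.inductionOn with
    | _ x =>
    obtain ⟨y, hp, hy⟩ := h x
    intro hz
    exact hz y (cycleOf_eq_iff.2 hy) hp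

-- On the left the cycle of `none` never counts as avoiding, since the condition is vacuous at
-- `none`. After `none` is removed, this cycle either disappears (if `none` was fixed) or counts
-- like any other. The two correction terms record exactly this.
open Classical in
theorem numCyclesAvoiding_removeNone [Finite A] (f : Equiv.Perm (Option A)) (p : A → Prop) :
    numCyclesAvoiding f (fun o => ∀ a ∈ o, p a) +
      (if ∀ a, f.SameCycle none (some a) → ¬ p a then 1 else 0) =
    numCyclesAvoiding (Equiv.removeNone f) p + (if f none = none then 1 else 0) := by
  have hs : ∀ {a b : A}, Equiv.Perm.SameCycle (Equiv.removeNone f) a b ↔ f.SameCycle (some a) (some b) :=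
    fun {a b} => ((removeNone_isErase f).sameCycle_iff (Option.some_injective A)).symm
  let ψ : Cycles (Equiv.removeNone f) → Cycles f :=
    Quotient.map some (fun a b h => hs.1 h)
  have hψ : ∀ a, ψ (cycleOf _ a) = cycleOf f (some a) := fun a => rfl
  have hψi : Function.Injective ψ := by
    intro x y
    induction x using Quotient.inductionOn
    induction y using Quotient.inductionOn
    intro h
    exact cycleOf_eq_iff.2 (hs.2 (cycleOf_eq_iff.1 h))
  have hnone : f none = none ↔ ∀ a, ¬ f.SameCycle none (some a) := by
    constructor
    · intro h a ha
      obtain ⟨n, -, hn⟩ := ha.exists_pow_eq'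
      have : ∀ k : ℕ, (f ^ k) none = none := by
        intro k
        induction k with
        | zero => rfl
        | succ k ih => rw [pow_succ, Equiv.Perm.mul_apply, h, ih]
      rw [this] at hn
      simp at hn
    · intro h
      rcases hf : f none with _ | a
      · rfl
      · exact absurd ⟨1, by simpa using hf⟩ (h a)
  let P : Cycles (Equiv.removeNone f) → Prop := fun z => ∀ x, cycleOf _ x = z → ¬ p x
  let Q : Cycles f → Prop := fun z => ∀ o, cycleOf _ o = z → ¬ (∀ a ∈ o, p a)
  have hQ : ∀ z, P z → ψ z ≠ cycleOf f none → Q (ψ z) := by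
    rintro z hz hne o ho
    cases o with
    | none => exact absurd ho.symm hne
    | some a =>
      have := hz a (hψi (by rw [hψ, ho]))
      simpa using this
  have hQn : ∀ z, Q z → z ≠ cycleOf f none := by
    rintro z hz rfl
    exact hz none rfl (by simp)
  have hP : ∀ z, Q z → ∃ y, P y ∧ ψ y = z := by
    intro z hz
    induction z using Quotient.inductionOn with
    | _ o =>
    cases o with
    | none => exact absurd rfl (hQn _ hz)
    | some a =>
      refine ⟨cycleOf _ a, ?_, rfl⟩
      intro x hx
      have := hz (some x) (by rw [← hψ, hx]; rfl)
      simpa using this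
  change Nat.card {z // Q z} + _ = Nat.card {z // P z} + _
  by_cases hn : f none = none
  · have e : {z // P z} ≃ {z // Q z} := by
      refine Equiv.ofBijective (fun z => ⟨ψ z.1, hQ z.1 z.2 ?_⟩) ⟨?_, ?_⟩
      · rcases z with ⟨z, hz⟩
        induction z using Quotient.inductionOn with
        | _ a => exact fun h => hnone.1 hn a (cycleOf_eq_iff.1 h).symm
      · intro x y h
        exact Subtype.ext (hψi (congrArg Subtype.val h))
      · rintro ⟨z, hz⟩
        obtain ⟨y, hy, rfl⟩ := hP z hz
        exact ⟨⟨y, hy⟩, rfl⟩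
    rw [Nat.card_congr e, if_pos hn, if_pos]
    intro a ha
    exact absurd ha (hnone.1 hn a)
  · rw [if_neg hn]
    obtain ⟨a₀, ha₀⟩ : ∃ a, f.SameCycle none (some a) := by
      by_contra hc
      push Not at hc
      exact hn (hnone.2 hc)
    by_cases hav : ∀ a, f.SameCycle none (some a) → ¬ p a
    · rw [if_pos hav]
      have hP₀ : P (cycleOf _ a₀) := by
        intro x hx
        exact hav x (ha₀.trans (hs.1 (cycleOf_eq_iff.1 hx.symm)))
      have hψ₀ : ψ (cycleOf _ a₀) = cycleOf f none := cycleOf_eq_iff.2 ha₀.symm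
      have e : {z // P z} ≃ Option {z // Q z} := by
        refine Equiv.ofBijective (fun z => if h : ψ z.1 = cycleOf f none then none else
          some ⟨ψ z.1, hQ z.1 z.2 h⟩) ⟨?_, ?_⟩
        · rintro ⟨x, hx⟩ ⟨y, hy⟩ h
          simp only at h
          split_ifs at h with h₁ h₂ h₂
          · exact Subtype.ext (hψi (h₁.trans h₂.symm))
          · exact Subtype.ext (hψi (congrArg Subtype.val (Option.some_injective _ h)))
        · rintro (_ | ⟨z, hz⟩)
          · exact ⟨⟨_, hP₀⟩, by simp [hψ₀]⟩
          · obtain ⟨y, hy, rfl⟩ := hP z hz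
            exact ⟨⟨y, hy⟩, by simp [hQn _ hz]⟩
      rw [Nat.card_congr e, Finite.card_option]
    · rw [if_neg hav]
      have e : {z // P z} ≃ {z // Q z} := by
        refine Equiv.ofBijective (fun z => ⟨ψ z.1, hQ z.1 z.2 ?_⟩) ⟨?_, ?_⟩
        · rcases z with ⟨z, hz⟩
          intro h
          apply hav
          intro b hb
          refine hz b (hψi ?_)
          rw [hψ, h]
          exact cycleOf_eq_iff.2 hb.symm
        · intro x y h
          exact Subtype.ext (hψi (congrArg Subtype.val h))
        · rintro ⟨z, hz⟩
          obtain ⟨y, hy, rfl⟩ := hP z hz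
          exact ⟨⟨y, hy⟩, rfl⟩
      rw [Nat.card_congr e]

end Cycles

/-! ### Operations on tangle diagrams -/

theorem flipAt_apply {C : Type} (S : Set C) [DecidablePred (· ∈ S)] (q : Passage C) :
    flipAt S q = if q.1 ∈ S then (q.1, !q.2) else q := by
  simp [flipAt, Function.Involutive.toPerm]

theorem flipAt_of_mem {C : Type} {S : Set C} {q : Passage C} (h : q.1 ∈ S) :
    flipAt S q = (q.1, !q.2) := by
  classical rw [flipAt_apply, if_pos h]

theorem flipAt_of_notMem {C : Type} {S : Set C} {q : Passage C} (h : q.1 ∉ S) :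
    flipAt S q = q := by
  classical rw [flipAt_apply, if_neg h]

theorem flipAt_fst {C : Type} (S : Set C) (q : Passage C) : (flipAt S q).1 = q.1 := by
  by_cases h : q.1 ∈ S
  · rw [flipAt_of_mem h]
  · rw [flipAt_of_notMem h]

theorem flipAt_mul_self {C : Type} (S : Set C) : flipAt S * flipAt S = 1 := by
  ext1 q
  by_cases h : q.1 ∈ S
  · simp [flipAt_of_mem, h]
  · simp [flipAt_of_notMem, h]

theorem flipAt_union {C : Type} {S I : Set C} (h : Disjoint S I) :
    flipAt (S ∪ I) = flipAt I * flipAt S := by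
  ext1 q
  rw [Equiv.Perm.mul_apply]
  by_cases hS : q.1 ∈ S
  · have hI : q.1 ∉ I := fun hI => Set.disjoint_left.1 h hS hI
    rw [flipAt_of_mem hS, flipAt_of_notMem (q := (q.1, !q.2)) hI,
      flipAt_of_mem (Or.inl hS : q.1 ∈ S ∪ I)]
  · rw [flipAt_of_notMem hS]
    by_cases hI : q.1 ∈ I
    · rw [flipAt_of_mem hI, flipAt_of_mem (Or.inr hI : q.1 ∈ S ∪ I)]
    · rw [flipAt_of_notMem hI, flipAt_of_notMem (S := S ∪ I) (fun h => h.elim hS hI)]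

theorem flipAt_comm {C : Type} (S I : Set C) : flipAt S * flipAt I = flipAt I * flipAt S := by
  ext1 q
  simp only [Equiv.Perm.mul_apply]
  by_cases hS : q.1 ∈ S <;> by_cases hI : q.1 ∈ I <;>
    simp [flipAt_of_mem, flipAt_of_notMem, hS, hI]

@[simp] theorem optionCongr_mul {A : Type} (e f : Equiv.Perm A) :
    Equiv.optionCongr (e * f) = (Equiv.optionCongr e * Equiv.optionCongr f :
      Equiv.Perm (Option A)) := by
  ext1 x
  cases x <;> rfl

namespace LinkDiagram

theorem mk_congr {C : Type} {fin : Finite C} {next next' : Equiv.Perm (Passage C)}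
    {sign sign' : C → ℤˣ} {k k' : ℕ} (h : next = next') (hs : sign = sign') (hk : k = k') :
    LinkDiagram.mk C fin next sign k = LinkDiagram.mk C fin next' sign' k' := by
  subst h hs hk; rfl

end LinkDiagram

namespace TangleDiagram

theorem mk_congr {C : Type} {fin : Finite C} {next next' : Equiv.Perm (Option (Passage C))}
    {sign sign' : C → ℤˣ} {k k' : ℕ} (h : next = next') (hs : sign = sign') (hk : k = k') :
    TangleDiagram.mk C fin next sign k = TangleDiagram.mk C fin next' sign' k' := by
  subst h hs hk; rfl

/-- Follow `f` instead of `T.next`, and delete the crossings in `E`. -/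
abbrev eraseWith (T : TangleDiagram) (f : Equiv.Perm (Option (Passage T.Crossing)))
    (E : Set T.Crossing) : TangleDiagram where
  Crossing := {c : T.Crossing // c ∉ E}
  finite := inferInstance
  next := Classical.choose
    (exists_isErase f (Option.map_injective (inclPassage_injective E)))
  sign c := T.sign c.1
  circles := T.circles + numCyclesAvoiding f (fun o => ∀ q ∈ o, q.1 ∉ E)

theorem eraseWith_isErase (T : TangleDiagram) (f : Equiv.Perm (Option (Passage T.Crossing)))
    (E : Set T.Crossing) : IsErase f (T.eraseWith f E).next (Option.map (inclPassage E)) :=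
  Classical.choose_spec (exists_isErase f (Option.map_injective (inclPassage_injective E)))

/-- Delete the crossings in `E`. -/
abbrev delete (T : TangleDiagram) (E : Set T.Crossing) : TangleDiagram := T.eraseWith T.next E

/-- Smooth the crossing `c`. -/
abbrev smooth (T : TangleDiagram) (c : T.Crossing) : TangleDiagram :=
  T.eraseWith (T.smoothedNext {c}) {c}

/-- Exchange overpass and underpass at the crossing `c`. -/
abbrev changeCrossing (T : TangleDiagram) (c : T.Crossing) : TangleDiagram where
  Crossing := T.Crossing
  finite := T.finite
  next := Equiv.optionCongr (flipAt {c}) * T.next * Equiv.optionCongr (flipAt {c})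
  sign := open Classical in Function.update T.sign c (-T.sign c)
  circles := T.circles

theorem smoothedNext_some (T : TangleDiagram) (S : Set T.Crossing) (q : Passage T.Crossing) :
    T.smoothedNext S (some q) = T.next (some (flipAt S q)) := rfl

/-- If the whole string is erased, the link acquires a circle; on the tangle side it is the closing
arc of a string with `next none = none`. The two corrections in `numCyclesAvoiding_removeNone` match
these cases. -/
theorem eraseWith_closure_circles (T : TangleDiagram)
    (f : Equiv.Perm (Option (Passage T.Crossing))) (E : Set T.Crossing)
    (hf : f none = T.next none) :
    (T.eraseWith f E).closure.circles = T.closure.circles +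
      numCyclesAvoiding (Equiv.removeNone f) (fun q => q.1 ∉ E) := by
  classical
  have h := numCyclesAvoiding_removeNone f (fun q => q.1 ∉ E)
  have h' := (T.eraseWith_isErase f E).apply_none_iff
  have h'' : (∀ a, f.SameCycle none (some a) → ¬ a.1 ∉ E) ↔
      (T.eraseWith f E).next none = none := by
    rw [h']
    exact forall₂_congr fun a _ => not_congr mem_range_inclPassage.symm
  rw [hf] at h
  change T.circles + numCyclesAvoiding f (fun o => ∀ q ∈ o, q.1 ∉ E) +
      (if (T.eraseWith f E).next none = none then 1 else 0) =
    T.circles + (if T.next none = none then 1 else 0) + _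
  by_cases hg : (T.eraseWith f E).next none = none
  · rw [if_pos hg]
    rw [if_pos (h''.2 hg)] at h
    omega
  · rw [if_neg hg]
    rw [if_neg (mt h''.1 hg)] at h
    omega

theorem eraseWith_closure_next (T : TangleDiagram)
    (f : Equiv.Perm (Option (Passage T.Crossing))) (E : Set T.Crossing) :
    (T.eraseWith f E).closure.next = erasePassages (Equiv.removeNone f) E :=
  (T.eraseWith_isErase f E).removeNone.unique (inclPassage_injective E)
    (erasePassages_isErase _ E)

theorem delete_closure (T : TangleDiagram) (E : Set T.Crossing) :
    (T.delete E).closure = T.closure.delete E :=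
  LinkDiagram.mk_congr (T.eraseWith_closure_next T.next E) rfl
    (T.eraseWith_closure_circles T.next E rfl)

theorem removeNone_mul_optionCongr {A : Type} (f : Equiv.Perm (Option A)) (e : Equiv.Perm A) :
    Equiv.removeNone (f * Equiv.optionCongr e) = Equiv.removeNone f * e := by
  ext1 a
  apply Option.some_injective
  rw [Equiv.Perm.mul_apply]
  rcases h : f (some (e a)) with _ | b
  · rw [Equiv.removeNone_none f h, Equiv.removeNone_none _ (by simpa using h)]
    rfl
  · rw [Equiv.removeNone_some f ⟨_, h⟩, Equiv.removeNone_some _ ⟨b, by simpa using h⟩]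
    rfl

theorem smooth_closure (T : TangleDiagram) (c : T.Crossing) :
    (T.smooth c).closure = T.closure.smooth c := by
  have e : Equiv.removeNone (T.smoothedNext {c}) = Equiv.removeNone T.next * flipAt {c} :=
    removeNone_mul_optionCongr _ _
  refine LinkDiagram.mk_congr ?_ rfl ?_
  · exact (T.eraseWith_closure_next (T.smoothedNext {c}) {c}).trans
      (congrArg (fun g => erasePassages g {c}) e)
  · exact (T.eraseWith_closure_circles (T.smoothedNext {c}) {c} rfl).trans
      (congrArg (fun g => T.closure.circles +
        numCyclesAvoiding g (fun q : Passage T.Crossing => q.1 ∉ ({c} : Set T.Crossing))) e)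

/-- The string has as many companions as the closure has components besides the closed string. -/
theorem closure_numComponents (T : TangleDiagram) :
    T.closure.numComponents = T.numClosedComponents + 1 := by
  classical
  have h := numCyclesAvoiding_removeNone T.next (fun _ => False)
  have h₁ : numCyclesAvoiding T.next (fun o => ∀ q ∈ o, False) =
      Nat.card {z : Cycles T.next // z ≠ cycleOf T.next none} := by
    refine Nat.card_congr (Equiv.subtypeEquivRight fun z => ?_)
    constructor
    · rintro hz rfl
      exact hz none rfl (by simp)
    · rintro hz (_ | q) ho hq
      · exact hz ho.symm
      · exact hq q rfl
  have h₂ : numCyclesAvoiding (Equiv.removeNone T.next) (fun _ => False) =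
      numCycles (Equiv.removeNone T.next) :=
    Nat.card_congr (Equiv.subtypeUnivEquiv fun z => by simp)
  rw [h₁, h₂] at h
  simp only [not_false_eq_true, implies_true, if_true] at h
  simp only [LinkDiagram.numComponents, closure, numClosedComponents]
  omega

end TangleDiagram

/-! ### Cutting a link diagram open -/

/-- Cut the edge leaving the passage `r`. -/
abbrev LinkDiagram.cutAfter (L : LinkDiagram) (r : Passage L.Crossing) : TangleDiagram where
  Crossing := L.Crossing
  finite := L.finite
  next := open Classical in Equiv.optionCongr L.next * Equiv.swap none (some r)
  sign := L.sign
  circles := L.circles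

namespace LinkDiagram

variable (L : LinkDiagram)

theorem cutAfter_next_none (r : Passage L.Crossing) :
    (L.cutAfter r).next none = some (L.next r) := by
  classical
  change (Equiv.optionCongr L.next * Equiv.swap none (some r)) none = _
  rw [Equiv.Perm.mul_apply, Equiv.swap_apply_left]
  rfl

theorem cutAfter_next_self (r : Passage L.Crossing) :
    (L.cutAfter r).next (some r) = none := by
  classical
  change (Equiv.optionCongr L.next * Equiv.swap none (some r)) (some r) = _
  rw [Equiv.Perm.mul_apply, Equiv.swap_apply_right]
  rfl

theorem cutAfter_next_of_ne {r q : Passage L.Crossing} (h : q ≠ r) :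
    (L.cutAfter r).next (some q) = some (L.next q) := by
  classical
  have : Equiv.swap none (some r) (some q) = some q :=
    Equiv.swap_apply_of_ne_of_ne (by simp) (by simpa using h)
  change (Equiv.optionCongr L.next * Equiv.swap none (some r)) (some q) = _
  rw [Equiv.Perm.mul_apply, this]
  rfl

theorem cutAfter_closure (r : Passage L.Crossing) : (L.cutAfter r).closure = L := by
  classical
  have e : Equiv.removeNone (L.cutAfter r).next = L.next := by
    ext1 q
    apply Option.some_injective
    by_cases h : q = r
    · rw [h]
      exact (Equiv.removeNone_none (L.cutAfter r).next (L.cutAfter_next_self r)).trans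
        (L.cutAfter_next_none r)
    · exact (Equiv.removeNone_some (L.cutAfter r).next ⟨_, L.cutAfter_next_of_ne h⟩).trans
        (L.cutAfter_next_of_ne h)
  have e' : (L.cutAfter r).closure.circles = L.circles := by
    have h : ¬ (L.cutAfter r).next none = none := by simp
    simp only [TangleDiagram.closure, if_neg h]
    rfl
  exact LinkDiagram.mk_congr e rfl e'

end LinkDiagram

theorem TangleDiagram.eq_cutAfter (T : TangleDiagram) {r : Passage T.Crossing}
    (h : T.next (some r) = none) : T = T.closure.cutAfter r := by
  classical
  have hn : T.next none ≠ none := by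
    intro e
    have := T.next.injective (h.trans e.symm)
    simp at this
  have e : T.next = (T.closure.cutAfter r).next := by
    ext1 x
    rcases x with _ | q
    · refine Eq.trans ?_ (T.closure.cutAfter_next_none r).symm
      exact (Equiv.removeNone_none T.next h).symm
    · by_cases hq : q = r
      · subst hq
        rw [h]
        exact (T.closure.cutAfter_next_self q).symm
      · refine Eq.trans ?_ (T.closure.cutAfter_next_of_ne hq).symm
        refine (Equiv.removeNone_some T.next ?_).symm
        rcases h' : T.next (some q) with _ | b
        · have := T.next.injective (h'.trans h.symm)
          simp [hq] at this
        · exact ⟨b, rfl⟩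
  have e' : T.circles = T.closure.circles := by
    simp only [closure, if_neg hn, add_zero]
  exact TangleDiagram.mk_congr e rfl e'

/-! ### Erasing points and smoothing the remaining crossings -/

section Erase
variable {X Y A B : Type}

/-- Since `u` moves only kept points, the erased stretches between returns are the same for `f` and
`f * u`. -/
theorem IsErase.mul {f u : Equiv.Perm X} {g u' : Equiv.Perm Y} {j : Y → X} (h : IsErase f g j)
    (hu : ∀ y, u (j y) = j (u' y)) (hu' : ∀ a, a ∉ Set.range j → u a = a) :
    IsErase (f * u) (g * u') j := by
  intro y
  obtain ⟨l, hl, hl'⟩ := h (u' y)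
  refine ⟨l, ?_, hl'⟩
  cases l with
  | nil =>
    change f (u (j y)) = _
    rw [hu]; exact hl
  | cons a l =>
    refine ⟨?_, hl.2.congr ?_ ?_⟩
    · change f (u (j y)) = _
      rw [hu]; exact hl.1
    · exact congrArg f (hu' a (hl' a (by simp)))
    · exact fun b hb => congrArg f (hu' b (hl' b (by simp [hb])))

/-- A cycle of `f * u` missing `p` would see only fixed points of `u`, hence would be a cycle of `f`
missing `p`. -/
theorem forall_exists_sameCycle_mul [Finite X] {f u : Equiv.Perm X} {p : X → Prop}
    (hu : ∀ a, ¬ p a → u a = a) (h : ∀ a, ∃ b, p b ∧ f.SameCycle b a) :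
    ∀ a, ∃ b, p b ∧ (f * u).SameCycle b a := by
  intro a
  by_contra hc
  push Not at hc
  have hp : ∀ n : ℕ, ((f * u) ^ n) a = (f ^ n) a := by
    intro n
    induction n with
    | zero => rfl
    | succ n ih =>
      have : ¬ p (((f * u) ^ n) a) := fun hp => hc _ hp (Equiv.Perm.SameCycle.symm ⟨n, by simp⟩)
      rw [pow_succ', pow_succ', Equiv.Perm.mul_apply, Equiv.Perm.mul_apply, ih,
        Equiv.Perm.mul_apply, hu _ (ih ▸ this)]
  obtain ⟨b, hb, hs⟩ := h a
  obtain ⟨n, -, hn⟩ := hs.symm.exists_pow_eq'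
  exact hc b hb (Equiv.Perm.SameCycle.symm ⟨n, by rw [zpow_natCast, hp, hn]⟩)

theorem forall_exists_sameCycle_mul_iff [Finite X] {f u : Equiv.Perm X} {p : X → Prop}
    (hu : ∀ a, ¬ p a → u a = a) :
    (∀ a, ∃ b, p b ∧ (f * u).SameCycle b a) ↔ ∀ a, ∃ b, p b ∧ f.SameCycle b a := by
  refine ⟨fun h => ?_, forall_exists_sameCycle_mul hu⟩
  have := forall_exists_sameCycle_mul (f := f * u) (u := u⁻¹) (p := p)
    (fun a ha => by rw [Equiv.Perm.inv_eq_iff_eq, hu a ha]) h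
  simpa using this

end Erase

/-! ### Descending states of erased and smoothed diagrams -/

namespace TangleDiagram

theorem isDescending_iff (T : TangleDiagram) (S : Set T.Crossing) :
    T.IsDescending S ↔ T.circles = 0 ∧ ∃ ℓ, Trav (T.smoothedNext S) ℓ ∧
      ∀ s ∈ S, [(s, true), (s, false)].Sublist ℓ := by
  unfold IsDescending IsCoherent
  rw [← exists_trav_iff]
  constructor
  · rintro ⟨⟨h, ℓ, hℓ⟩, hs⟩
    exact ⟨h, ℓ, hℓ, fun s hS => (hℓ.before_iff (by simp)).1 (hs s hS)⟩
  · rintro ⟨h, ℓ, hℓ, hs⟩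
    exact ⟨⟨h, ℓ, hℓ⟩, fun s hS => (hℓ.before_iff (by simp)).2 (hs s hS)⟩

theorem IsDescending.exists_trav {T : TangleDiagram} {S : Set T.Crossing}
    (h : T.IsDescending S) : ∃ ℓ, Trav (T.smoothedNext S) ℓ :=
  let ⟨_, ℓ, hℓ, _⟩ := (T.isDescending_iff S).1 h
  ⟨ℓ, hℓ⟩

theorem isDescending_iff_of_trav {T : TangleDiagram} {S : Set T.Crossing}
    {ℓ : List (Passage T.Crossing)} (h : Trav (T.smoothedNext S) ℓ) :
    T.IsDescending S ↔ T.circles = 0 ∧ ∀ s ∈ S, [(s, true), (s, false)].Sublist ℓ := by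
  rw [isDescending_iff]
  constructor
  · rintro ⟨h₀, ℓ', hℓ', hs⟩
    obtain rfl := h.unique hℓ'
    exact ⟨h₀, hs⟩
  · rintro ⟨h₀, hs⟩
    exact ⟨h₀, ℓ, h, hs⟩

/-- A state of the diagram with the crossings in `E` erased, as a state of the whole diagram. -/
abbrev inclState {C : Type} {E : Set C} (S : Set {c : C // c ∉ E}) : Set C := Subtype.val '' S

/-- Smoothing `I` first and then `S` is the same as smoothing both at once, and erasing crossings
does not change the order of the others. The crossings of `I` are smoothed but carry no descending
condition; for `I = ∅` this describes deletion, and for `I = E = {c}` the smoothing of `c`. -/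
theorem eraseWith_isDescending_iff (T : TangleDiagram) {E I : Set T.Crossing} (hI : I ⊆ E)
    (S : Set {c : T.Crossing // c ∉ E}) :
    (T.eraseWith (T.smoothedNext I) E).IsDescending S ↔
      T.circles = 0 ∧ ∃ ℓ, Trav (T.smoothedNext (inclState S ∪ I)) ℓ ∧
        ∀ s ∈ inclState S, [(s, true), (s, false)].Sublist ℓ := by
  have hdisj : Disjoint (inclState S) I := by
    rw [Set.disjoint_left]
    rintro _ ⟨c, -, rfl⟩ hc
    exact c.2 (hI hc)
  set T' := T.eraseWith (T.smoothedNext I) E with hT'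
  have he : IsErase (T.smoothedNext (inclState S ∪ I)) (T'.smoothedNext S)
      (Option.map (inclPassage E)) := by
    have h := (T.eraseWith_isErase (T.smoothedNext I) E).mul
      (u := Equiv.optionCongr (flipAt (inclState S))) (u' := Equiv.optionCongr (flipAt S)) ?_ ?_
    · have e : T.smoothedNext (inclState S ∪ I) =
          T.smoothedNext I * Equiv.optionCongr (flipAt (inclState S)) := by
        rw [smoothedNext, flipAt_union hdisj, optionCongr_mul, ← mul_assoc]
        rfl
      rw [e]
      exact h
    · rintro (_ | q)
      · rfl
      · by_cases hq : q.1 ∈ S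
        · simp only [Option.map_some, Equiv.optionCongr_apply]
          rw [flipAt_of_mem hq,
            flipAt_of_mem (S := inclState S) (q := inclPassage E q) ⟨q.1, hq, rfl⟩]
          rfl
        · simp only [Option.map_some, Equiv.optionCongr_apply]
          rw [flipAt_of_notMem hq, flipAt_of_notMem]
          rintro ⟨c, hc, e⟩
          exact hq (by convert hc; exact Subtype.ext e.symm)
    · rintro (_ | q) hq
      · rfl
      · simp only [Equiv.optionCongr_apply, Option.map_some]
        rw [flipAt_of_notMem]
        rintro ⟨c, hc, e⟩
        apply hq
        refine ⟨some (c, q.2), ?_⟩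
        simp only [Option.map_some, inclPassage, e]
  have hj := inclPassage_injective E
  -- Circles created by the erasure are cycles all of whose crossings are erased. Smoothing `S`
  -- involves only kept crossings and cannot change whether such cycles exist.
  have hcirc : T'.circles = 0 ↔ T.circles = 0 ∧
      ∀ a, ∃ b : Option (Passage T'.Crossing),
        (T.smoothedNext (inclState S ∪ I)).SameCycle (b.map (inclPassage E)) a := by
    have e : T'.circles = T.circles +
      numCyclesAvoiding (T.smoothedNext I) (fun o => ∀ q ∈ o, q.1 ∉ E) := rfl
    rw [e, Nat.add_eq_zero_iff, numCyclesAvoiding_eq_zero_iff]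
    have e' : T.smoothedNext (inclState S ∪ I) =
        T.smoothedNext I * Equiv.optionCongr (flipAt (inclState S)) := by
      rw [smoothedNext, flipAt_union hdisj, optionCongr_mul, ← mul_assoc]
      rfl
    rw [e', ← forall_exists_sameCycle_mul_iff (u := Equiv.optionCongr (flipAt (inclState S)))]
    · refine and_congr_right fun _ => forall_congr' fun a => ?_
      constructor
      · rintro ⟨b, hb, h⟩
        cases b with
        | none => exact ⟨none, h⟩
        | some q => exact ⟨some (⟨q.1, hb q rfl⟩, q.2), h⟩
      · rintro ⟨b, h⟩
        refine ⟨_, ?_, h⟩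
        cases b with
        | none => simp
        | some q => simpa [inclPassage] using q.1.2
    · rintro (_ | q) hq
      · rfl
      · simp only [Equiv.optionCongr_apply, Option.map_some]
        rw [flipAt_of_notMem]
        rintro ⟨c, hc, e⟩
        apply hq
        simp only [Option.mem_def, Option.some.injEq, forall_eq']
        exact e ▸ c.2
  rw [isDescending_iff, hcirc]
  constructor
  · rintro ⟨⟨h₀, hc⟩, ℓ', hℓ', hs⟩
    obtain ⟨ℓ, hℓ⟩ := (he.exists_trav_iff hj).2 ⟨⟨ℓ', hℓ'⟩, hc⟩
    refine ⟨h₀, ℓ, hℓ, ?_⟩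
    rintro _ ⟨c, hc, rfl⟩
    exact (hℓ.pair_erase he hj hℓ').1 (hs c hc)
  · rintro ⟨h₀, ℓ, hℓ, hs⟩
    obtain ⟨⟨ℓ', hℓ'⟩, hc⟩ := (he.exists_trav_iff hj).1 ⟨ℓ, hℓ⟩
    refine ⟨⟨h₀, hc⟩, ℓ', hℓ', ?_⟩
    intro c hc
    exact (hℓ.pair_erase he hj hℓ').2 (hs _ ⟨c, hc, rfl⟩)

theorem smoothedNext_empty (T : TangleDiagram) : T.smoothedNext ∅ = T.next := by
  ext1 x
  cases x with
  | none => rfl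
  | some q => rw [smoothedNext_some, flipAt_of_notMem (by simp)]

theorem delete_isDescending_iff (T : TangleDiagram) {E : Set T.Crossing}
    (S : Set {c : T.Crossing // c ∉ E}) :
    (T.delete E).IsDescending S ↔ T.IsDescending (inclState S) := by
  have h := T.eraseWith_isDescending_iff (Set.empty_subset E) S
  rw [Set.union_empty, ← isDescending_iff, smoothedNext_empty] at h
  exact h

theorem smooth_isDescending_iff (T : TangleDiagram) {c : T.Crossing}
    (S : Set {x : T.Crossing // x ∉ ({c} : Set T.Crossing)}) :
    (T.smooth c).IsDescending S ↔ T.circles = 0 ∧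
      ∃ ℓ, Trav (T.smoothedNext (inclState S ∪ {c})) ℓ ∧
        ∀ s ∈ inclState S, [(s, true), (s, false)].Sublist ℓ :=
  T.eraseWith_isDescending_iff subset_rfl S

/-! ### The polynomial as a sum over states -/

/-- The contribution of a smoothed crossing. -/
def wt (T : TangleDiagram) (s : T.Crossing) : ℤ[X] := C (T.sign s : ℤ) * X

-- The grading by the number of smoothed crossings is absorbed into the weights, so that products
-- over states can be split.
open Classical in
theorem nabla_eq_sum (T : TangleDiagram) :
    T.nabla = ∑ S : Finset T.Crossing,
      if T.IsDescending (S : Set T.Crossing) then ∏ s ∈ S, T.wt s else 0 := by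
  have h : ∀ S : Finset T.Crossing, ∏ s ∈ S, T.wt s =
      C (∏ s ∈ S, (T.sign s : ℤ)) * X ^ S.card := by
    intro S
    simp only [wt, Finset.prod_mul_distrib, Finset.prod_const, map_prod]
  simp only [nabla, coeff, h, map_sum, Finset.sum_mul, Finset.sum_filter]
  rw [Finset.sum_comm]
  refine Finset.sum_congr rfl fun S _ => ?_
  rw [Finset.sum_eq_single_of_mem S.card]
  · simp
  · rw [Finset.mem_range, Nat.card_eq_fintype_card]
    exact Nat.lt_succ_of_le (Finset.card_le_univ S)
  · intro n _ hn
    rw [if_neg (fun h => hn h.1.symm)]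
    simp

end TangleDiagram

/-! ### Splitting the state sum along a set of crossings -/

section Split
variable {C : Type} [Fintype C]

/-- Sum over the states of a diagram by first choosing the part outside of `E`. -/
theorem sum_finset_split [DecidableEq C] {E : Set C} [Fintype {c // c ∉ E}] (E' : Finset C)
    (hE : ∀ c, c ∈ E' ↔ c ∈ E) {M : Type*} [AddCommMonoid M] (F : Finset C → M) :
    ∑ S, F S = ∑ S : Finset {c // c ∉ E}, ∑ I ∈ E'.powerset,
      F (S.map (Function.Embedding.subtype _) ∪ I) := by
  classical
  rw [← Finset.sum_product']
  refine Finset.sum_bij' (fun S _ => (S.subtype _, S ∩ E'))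
    (fun P _ => P.1.map (Function.Embedding.subtype _) ∪ P.2) ?_ ?_ ?_ ?_ ?_
  · intro S _
    simp
  · simp
  · intro S _
    ext c
    simp only [Finset.mem_union, Finset.mem_map, Finset.mem_subtype, Finset.mem_inter, hE]
    by_cases h : c ∈ E <;> simp [h]
  · rintro ⟨S, I⟩ hI
    simp only [Finset.mem_product, Finset.mem_univ, Finset.mem_powerset, true_and] at hI
    ext c
    · have : c.1 ∉ I := fun h => c.2 ((hE _).1 (hI h))
      simpa [this] using fun _ => c.2
    · simp only [Finset.mem_inter, Finset.mem_union, Finset.mem_map]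
      constructor
      · rintro ⟨h | h, hc⟩
        · obtain ⟨d, -, rfl⟩ := h
          exact absurd ((hE _).1 hc) d.2
        · exact h
      · exact fun h => ⟨Or.inr h, hI h⟩
  · intro S _
    congr 1
    ext c
    simp only [Finset.mem_union, Finset.mem_map, Finset.mem_subtype, Finset.mem_inter, hE]
    by_cases h : c ∈ E <;> simp [h]

end Split

namespace TangleDiagram

-- Used with `E` the set of crossings involved in a local change: the outer sum is common to both
-- diagrams, and only the inner sums have to be compared.
open Classical in
theorem nabla_eq_sum_split (T : TangleDiagram) {E : Set T.Crossing}
    [Fintype {c // c ∉ E}] (E' : Finset T.Crossing)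
    (hE : ∀ c, c ∈ E' ↔ c ∈ E) :
    T.nabla = ∑ S : Finset {c // c ∉ E}, (∏ s ∈ S, T.wt s.1) * ∑ I ∈ E'.powerset,
      if T.IsDescending (inclState (S : Set {c // c ∉ E}) ∪ I) then ∏ s ∈ I, T.wt s else 0 := by
  rw [nabla_eq_sum, sum_finset_split E' hE]
  refine Finset.sum_congr rfl fun S _ => ?_
  rw [Finset.mul_sum]
  refine Finset.sum_congr rfl fun I hI => ?_
  rw [Finset.mem_powerset] at hI
  have h : ((S.map (Function.Embedding.subtype _) ∪ I : Finset T.Crossing) : Set T.Crossing) =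
      inclState (S : Set {c // c ∉ E}) ∪ I := by
    simp
  rw [h]
  split_ifs
  · rw [Finset.prod_union, Finset.prod_map]
    · rfl
    · rw [Finset.disjoint_left]
      intro c hc hcI
      obtain ⟨d, -, rfl⟩ := Finset.mem_map.1 hc
      exact d.2 ((hE _).1 (hI hcI))
  · simp

open Classical in
theorem delete_nabla (T : TangleDiagram) {E : Set T.Crossing} [Fintype {c // c ∉ E}] :
    (T.delete E).nabla = ∑ S : Finset {c // c ∉ E}, (∏ s ∈ S, T.wt s.1) *
      if T.IsDescending (inclState (S : Set {c // c ∉ E})) then 1 else 0 := by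
  rw [nabla_eq_sum]
  refine Finset.sum_equiv (Equiv.refl _) (by simp) ?_
  intro S _
  rw [if_congr (T.delete_isDescending_iff _) rfl rfl, mul_ite, mul_one, mul_zero]
  rfl

open Classical in
theorem smooth_nabla (T : TangleDiagram) {c : T.Crossing}
    [Fintype {x // x ∉ ({c} : Set T.Crossing)}] :
    (T.smooth c).nabla = ∑ S : Finset {x // x ∉ ({c} : Set T.Crossing)},
      (∏ s ∈ S, T.wt s.1) * if (T.smooth c).IsDescending (S : Set (T.smooth c).Crossing)
        then 1 else 0 := by
  rw [nabla_eq_sum]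
  refine Finset.sum_equiv (Equiv.refl _) (by simp) ?_
  intro S _
  rw [mul_ite, mul_one, mul_zero]
  rfl

end TangleDiagram

/-! ### Relabelling and rotating traversals -/

section Trav
variable {X Y A B : Type}

theorem Path.map {f : X → X} {f' : Y → Y} {m : X → Y} (hm : ∀ x, f' (m x) = m (f x))
    {x y : X} {l : List X} (h : Path f x l y) : Path f' (m x) (l.map m) (m y) := by
  induction l generalizing x with
  | nil => exact (hm x).trans (congrArg m h)
  | cons a l ih => exact ⟨(hm x).trans (congrArg m h.1), ih h.2⟩

theorem Trav.map {f : Equiv.Perm (Option A)} {f' : Equiv.Perm (Option B)} (e : A ≃ B)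
    (he : ∀ x, f' (Option.map e x) = Option.map e (f x)) {ℓ : List A} (h : Trav f ℓ) :
    Trav f' (ℓ.map e) := by
  refine ⟨?_, fun b => List.mem_map.2 ⟨e.symm b, h.2 _, by simp⟩⟩
  have := Path.map he h.1
  simpa [Function.comp_def] using this

theorem pair_sublist_or {a b : A} {ℓ : List A} (ha : a ∈ ℓ) (hb : b ∈ ℓ) (hab : a ≠ b) :
    [a, b].Sublist ℓ ∨ [b, a].Sublist ℓ := by
  obtain ⟨s, t, rfl⟩ := List.append_of_mem ha
  simp only [List.mem_append, List.mem_cons, hab.symm, false_or] at hb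
  rcases hb with hb | hb
  · obtain ⟨u, v, rfl⟩ := List.append_of_mem hb
    exact Or.inr (pair_sublist_iff.2 ⟨u, v, t, by simp⟩)
  · obtain ⟨u, v, rfl⟩ := List.append_of_mem hb
    exact Or.inl (pair_sublist_iff.2 ⟨s, u, v, rfl⟩)

theorem pair_sublist_asymm {a b : A} {ℓ : List A} (hℓ : ℓ.Nodup) (h : [a, b].Sublist ℓ) :
    ¬ [b, a].Sublist ℓ := by
  intro h'
  obtain ⟨l₁, l₂, l₃, rfl⟩ := pair_sublist_iff.1 h
  have hd := List.disjoint_of_nodup_append hℓ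
  have ha : a ∉ l₁ := fun h => hd h (by simp)
  have hb : b ∉ l₁ := fun h => hd h (by simp)
  have h₁ := (List.nodup_append.1 hℓ).2.1
  obtain ⟨k₁, k₂, k₃, e⟩ := pair_sublist_iff.1 h'
  have hn := List.nodup_cons.1 h₁
  have hb' : b ∉ l₂ := fun h => (List.disjoint_of_nodup_append hn.2) h (by simp)
  have hab : a ≠ b := fun e => hn.1 (by simp [e])
  have e' : (l₁ ++ a :: l₂) ++ b :: l₃ = k₁ ++ b :: (k₂ ++ a :: k₃) := by simpa using e
  have hk : b ∉ k₁ := by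
    intro h
    rw [e] at hℓ
    exact (List.disjoint_of_nodup_append hℓ) h (by simp)
  have hx : b ∉ l₁ ++ a :: l₂ := by simp [hb, hb', hab.symm]
  have := (List.append_eq_append_iff.1 e')
  rcases this with ⟨w, hw, hw'⟩ | ⟨w, hw, hw'⟩
  · cases w with
    | nil =>
      have hk₁ : a ∈ k₁ := by rw [hw]; simp
      rw [e] at hℓ
      exact (List.disjoint_of_nodup_append hℓ) hk₁ (by simp)
    | cons c w =>
      obtain rfl : b = c := by simpa using congrArg List.head? hw'
      exact hk (by rw [hw]; simp)
  · cases w with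
    | nil =>
      have hk₁ : a ∈ k₁ := by rw [List.append_nil] at hw; rw [← hw]; simp
      rw [e] at hℓ
      exact (List.disjoint_of_nodup_append hℓ) hk₁ (by simp)
    | cons c w =>
      obtain rfl : b = c := by simpa using congrArg List.head? hw'
      exact hx (by rw [hw]; simp)

theorem Trav.eq_cons {f : Equiv.Perm (Option A)} {ℓ : List A} (h : Trav f ℓ) {q : A}
    (hq : f none = some q) : ∃ ℓ₁, ℓ = q :: ℓ₁ ∧ Path f (some q) (ℓ₁.map some) none := by
  cases ℓ with
  | nil =>
    have : f none = none := h.1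
    simp [this] at hq
  | cons a ℓ =>
    have h₁ : f none = some a := h.1.1
    obtain rfl : a = q := Option.some_injective _ (h₁.symm.trans hq)
    exact ⟨ℓ, rfl, h.1.2⟩

theorem Trav.eq_concat {f : Equiv.Perm (Option A)} {ℓ : List A} (h : Trav f ℓ) {q : A}
    (hq : f (some q) = none) : ∃ ℓ₁, ℓ = ℓ₁ ++ [q] := by
  obtain ⟨s, t, rfl⟩ := List.append_of_mem (h.2 q)
  have h₁ := h.1
  rw [List.map_append, List.map_cons, path_append_cons] at h₁
  have : t = [] := path_none_unique h₁.2 (ℓ' := []) hq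
  exact ⟨s, by rw [this]⟩

/-- Conjugation by the transposition moves the starting point past `q`, so `q` goes from the front
of the traversal to its end. -/
theorem Trav.rotate [DecidableEq (Option A)] {f : Equiv.Perm (Option A)} {q : A} (hq : f none = some q) {ℓ : List A}
    (h : Trav f ℓ) : ∃ ℓ₁, ℓ = q :: ℓ₁ ∧
      Trav (Equiv.swap none (some q) * f * Equiv.swap none (some q)) (ℓ₁ ++ [q]) := by
  obtain ⟨ℓ₁, rfl, hp⟩ := h.eq_cons hq
  have hnd := List.nodup_cons.1 h.nodup
  refine ⟨ℓ₁, rfl, ?_, fun a => by simpa [or_comm] using h.2 a⟩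
  have h₁ := hp.map (m := Equiv.swap none (some q))
    (f' := (Equiv.swap none (some q) * f * Equiv.swap none (some q) : Equiv.Perm (Option A)))
    (fun x => by simp)
  have h₂ : (ℓ₁.map some).map (Equiv.swap none (some q)) = ℓ₁.map some := by
    rw [List.map_map, List.map_inj_left]
    intro a ha
    refine Equiv.swap_apply_of_ne_of_ne (by simp) ?_
    rintro e
    exact hnd.1 (Option.some_injective _ e ▸ ha)
  rw [h₂, Equiv.swap_apply_right, Equiv.swap_apply_left] at h₁
  rw [List.map_append, List.map_singleton, path_append_cons]
  refine ⟨h₁, ?_⟩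
  change (Equiv.swap none (some q) * f * Equiv.swap none (some q) : Equiv.Perm (Option A))
    (some q) = none
  simp [hq]

theorem exists_trav_rotate [Finite A] [DecidableEq (Option A)] {f : Equiv.Perm (Option A)} {q : A}
    (h : ∃ ℓ, Trav (Equiv.swap none (some q) * f * Equiv.swap none (some q)) ℓ) :
    ∃ ℓ, Trav f ℓ := by
  rw [exists_trav_iff] at h ⊢
  have h' : ∀ x, f.SameCycle (some q) x := by
    intro x
    have := h (Equiv.swap none (some q) x)
    have e : (Equiv.swap none (some q) * f * Equiv.swap none (some q) : Equiv.Perm (Option A)) =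
      Equiv.swap none (some q) * f * (Equiv.swap none (some q))⁻¹ := by simp
    rw [e, Equiv.Perm.sameCycle_conj] at this
    simpa using this
  exact fun a => (h' none).symm.trans (h' a)

end Trav

theorem sum_powerset_singleton {C M : Type*} [DecidableEq C] [AddCommMonoid M] (c : C)
    (F : Finset C → M) : ∑ I ∈ ({c} : Finset C).powerset, F I = F ∅ + F {c} := by
  rw [← insert_empty_eq, Finset.sum_powerset_insert (Finset.notMem_empty c)]
  simp

namespace TangleDiagram

/-! ### The skein relation -/

theorem changeCrossing_smoothedNext (T : TangleDiagram) (c : T.Crossing) (S : Set T.Crossing) :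
    (T.changeCrossing c).smoothedNext S = Equiv.optionCongr (flipAt {c}) * T.smoothedNext S *
      Equiv.optionCongr (flipAt {c}) := by
  simp only [smoothedNext, changeCrossing, mul_assoc]
  rw [← optionCongr_mul, ← optionCongr_mul, flipAt_comm]

theorem changeCrossing_trav {T : TangleDiagram} {c : T.Crossing} {S : Set T.Crossing}
    {ℓ : List (Passage T.Crossing)} (h : Trav (T.smoothedNext S) ℓ) :
    Trav ((T.changeCrossing c).smoothedNext S) (ℓ.map (flipAt {c})) := by
  refine h.map (flipAt {c}) fun x => ?_
  rw [changeCrossing_smoothedNext, Equiv.Perm.mul_apply, Equiv.Perm.mul_apply]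
  have : Equiv.optionCongr (flipAt {c}) (Option.map (flipAt {c}) x) = x := by
    have := congrArg (fun e : Equiv.Perm _ => Option.map e x) (flipAt_mul_self {c})
    rw [Equiv.optionCongr_apply, Option.map_map]
    rcases x with _ | q
    · rfl
    · exact congrArg some (Equiv.congr_fun (flipAt_mul_self {c}) q)
  rw [this]
  rfl

theorem changeCrossing_exists_trav {T : TangleDiagram} {c : T.Crossing} {S : Set T.Crossing} :
    (∃ ℓ, Trav ((T.changeCrossing c).smoothedNext S) ℓ) ↔ ∃ ℓ, Trav (T.smoothedNext S) ℓ := by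
  constructor
  · intro h
    rw [exists_trav_iff] at h ⊢
    rw [changeCrossing_smoothedNext] at h
    have e : (Equiv.optionCongr (flipAt {c}) : Equiv.Perm (Option (Passage T.Crossing))) =
        (Equiv.optionCongr (flipAt {c}) : Equiv.Perm (Option (Passage T.Crossing)))⁻¹ := by
      rw [eq_inv_iff_mul_eq_one, ← optionCongr_mul, flipAt_mul_self]
      ext1 x; cases x <;> rfl
    intro a
    have := h (Equiv.optionCongr (flipAt {c}) a)
    nth_rw 2 [e] at this
    rw [Equiv.Perm.sameCycle_conj] at this
    have e' : (Equiv.optionCongr (flipAt {c}) : Equiv.Perm (Option (Passage T.Crossing)))⁻¹ none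
        = none := by
      rw [Equiv.Perm.inv_eq_iff_eq]; rfl
    have e'' : (Equiv.optionCongr (flipAt {c}) : Equiv.Perm (Option (Passage T.Crossing)))⁻¹
        (Equiv.optionCongr (flipAt {c}) a) = a := by
      rw [Equiv.Perm.inv_eq_iff_eq]
    rwa [e', e''] at this
  · rintro ⟨ℓ, h⟩
    exact ⟨_, changeCrossing_trav h⟩

theorem pair_map_flipAt_of_ne {C : Type} {c s : C} (h : s ≠ c) {ℓ : List (Passage C)} :
    [(s, true), (s, false)].Sublist (ℓ.map (flipAt {c})) ↔
      [(s, true), (s, false)].Sublist ℓ := by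
  rw [← sublist_map_iff_of_injective (flipAt {c}).injective (l := [(s, true), (s, false)]) (l' := ℓ)]
  simp [flipAt_of_notMem, h]

theorem pair_map_flipAt_self {C : Type} {c : C} {ℓ : List (Passage C)} :
    [(c, true), (c, false)].Sublist (ℓ.map (flipAt {c})) ↔
      [(c, false), (c, true)].Sublist ℓ := by
  rw [← sublist_map_iff_of_injective (flipAt {c}).injective (l := [(c, false), (c, true)]) (l' := ℓ)]
  simp [flipAt_of_mem]

/-- States not containing `c` contribute equally to both diagrams. A coherent state containing `c`
enters it along one of the two passages first, and so satisfies the condition at `c` in exactly one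
of the diagrams. As the sign of `c` is opposite in the two diagrams, the difference counts both
kinds with weight `T.wt c`; dropping the condition at `c` gives the states of the smoothing. -/
theorem skein (T : TangleDiagram) (c : T.Crossing) :
    T.nabla - (T.changeCrossing c).nabla = T.wt c * (T.smooth c).nabla := by
  classical
  have : Fintype {x // x ∉ ({c} : Set T.Crossing)} := Fintype.ofFinite _
  rw [T.nabla_eq_sum_split (E := {c}) {c} (by simp),
    (T.changeCrossing c).nabla_eq_sum_split (E := {c}) {c} (by simp), smooth_nabla,
    ← Finset.sum_sub_distrib, Finset.mul_sum]
  refine Finset.sum_congr rfl fun S _ => ?_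
  set S' := inclState (S : Set {x // x ∉ ({c} : Set T.Crossing)}) with hS'
  have hc : ∀ s ∈ S', s ≠ c := by
    rintro _ ⟨d, -, rfl⟩
    exact d.2
  have hw : ∏ s ∈ S, (T.changeCrossing c).wt s.1 = ∏ s ∈ S, T.wt s.1 := by
    refine Finset.prod_congr rfl fun s _ => ?_
    have : s.1 ≠ c := s.2
    simp [wt, Function.update_of_ne this]
  have hwc : (T.changeCrossing c).wt c = - T.wt c := by
    simp [wt]
  have h₀ : (T.changeCrossing c).IsDescending S' ↔ T.IsDescending S' := by
    by_cases hex : ∃ ℓ, Trav (T.smoothedNext S') ℓ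
    · obtain ⟨ℓ, hℓ⟩ := hex
      rw [isDescending_iff_of_trav hℓ, isDescending_iff_of_trav (changeCrossing_trav hℓ)]
      exact and_congr_right fun _ => forall₂_congr fun s hs => pair_map_flipAt_of_ne (hc s hs)
    · constructor
      · exact fun h => absurd (changeCrossing_exists_trav.1 h.exists_trav) hex
      · exact fun h => absurd h.exists_trav hex
  have h₁ : ((if T.IsDescending (S' ∪ {c}) then 1 else 0 : ℤ[X]) +
      if (T.changeCrossing c).IsDescending (S' ∪ {c}) then 1 else 0) =
      if (T.smooth c).IsDescending (S : Set (T.smooth c).Crossing) then 1 else 0 := by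
    have hsm := T.smooth_isDescending_iff (S : Set {x // x ∉ ({c} : Set T.Crossing)})
    rw [if_congr hsm rfl rfl]
    by_cases hex : ∃ ℓ, Trav (T.smoothedNext (S' ∪ {c})) ℓ
    · obtain ⟨ℓ, hℓ⟩ := hex
      have e : (∃ ℓ, Trav (T.smoothedNext (S' ∪ {c})) ℓ ∧
          ∀ s ∈ S', [(s, true), (s, false)].Sublist ℓ) ↔
          ∀ s ∈ S', [(s, true), (s, false)].Sublist ℓ :=
        ⟨fun ⟨ℓ', h, h'⟩ => hℓ.unique h ▸ h', fun h => ⟨ℓ, hℓ, h⟩⟩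
      have hor := pair_sublist_or (hℓ.2 (c, true)) (hℓ.2 (c, false)) (by simp)
      have hnot := pair_sublist_asymm (a := (c, true)) (b := (c, false)) hℓ.nodup
      have e₂ : (∀ s ∈ S', [(s, true), (s, false)].Sublist (ℓ.map (flipAt {c}))) ↔
          ∀ s ∈ S', [(s, true), (s, false)].Sublist ℓ :=
        forall₂_congr fun s hs => pair_map_flipAt_of_ne (hc s hs)
      have k₁ : T.IsDescending (S' ∪ {c}) ↔ T.circles = 0 ∧
          (∀ s ∈ S', [(s, true), (s, false)].Sublist ℓ) ∧ [(c, true), (c, false)].Sublist ℓ := by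
        rw [isDescending_iff_of_trav hℓ, Set.union_singleton, Set.forall_mem_insert,
          and_comm (a := List.Sublist _ _)]
      have k₂ : (T.changeCrossing c).IsDescending (S' ∪ {c}) ↔ T.circles = 0 ∧
          (∀ s ∈ S', [(s, true), (s, false)].Sublist ℓ) ∧ [(c, false), (c, true)].Sublist ℓ := by
        rw [isDescending_iff_of_trav (changeCrossing_trav (c := c) hℓ), Set.union_singleton,
          Set.forall_mem_insert, pair_map_flipAt_self, e₂, and_comm (a := List.Sublist _ _)]
      rw [if_congr k₁ rfl rfl, if_congr k₂ rfl rfl, if_congr (and_congr_right fun _ => e) rfl rfl]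
      by_cases h₂ : T.circles = 0 <;>
        by_cases h₃ : ∀ s ∈ S', [(s, true), (s, false)].Sublist ℓ <;>
        by_cases h₄ : [(c, true), (c, false)].Sublist ℓ
      · simp [h₂, h₄, hnot h₄]
      · simp [h₂, h₄, hor.resolve_left h₄]
      all_goals simp [h₂, h₃]
    · rw [if_neg (fun h => hex h.exists_trav),
        if_neg (fun h => hex (changeCrossing_exists_trav.1 h.exists_trav)),
        if_neg (fun h => hex (let ⟨_, ℓ, h, _⟩ := h; ⟨ℓ, h⟩)), add_zero]
  rw [sum_powerset_singleton, sum_powerset_singleton, hw, ← h₁]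
  simp only [Finset.coe_empty, Set.union_empty, Finset.coe_singleton, Finset.prod_empty,
    Finset.prod_singleton, if_congr h₀ rfl rfl, hwc]
  split_ifs <;> ring

/-! ### Renaming the crossings -/

theorem nabla_relabel {T T' : TangleDiagram} (e : T.Crossing ≃ T'.Crossing)
    (hnext : ∀ x, T'.next (Option.map (Prod.map e id) x) = Option.map (Prod.map e id) (T.next x))
    (hsign : ∀ c, T'.sign (e c) = T.sign c) (hcircles : T'.circles = T.circles) :
    T'.nabla = T.nabla := by
  classical
  let e₂ : Passage T.Crossing ≃ Passage T'.Crossing := e.prodCongr (Equiv.refl _)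
  have key : ∀ S : Set T.Crossing, ∀ x, T'.smoothedNext (e '' S) (Option.map e₂ x) =
      Option.map e₂ (T.smoothedNext S x) := by
    rintro S (_ | q)
    · exact hnext none
    · have : flipAt (e '' S) (e₂ q) = e₂ (flipAt S q) := by
        by_cases h : q.1 ∈ S
        · rw [flipAt_of_mem h, flipAt_of_mem (⟨_, h, rfl⟩ : (e₂ q).1 ∈ e '' S)]
          rfl
        · rw [flipAt_of_notMem h, flipAt_of_notMem]
          rintro ⟨d, hd, h'⟩
          exact h (e.injective h' ▸ hd)
      change T'.next (some (flipAt (e '' S) (e₂ q))) = _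
      rw [this]
      exact hnext (some (flipAt S q))
  have h₁ : ∀ S : Set T.Crossing, T.IsDescending S ↔ T'.IsDescending (e '' S) := by
    intro S
    rw [isDescending_iff, isDescending_iff, hcircles]
    refine and_congr_right fun _ => ?_
    constructor
    · rintro ⟨ℓ, hℓ, hs⟩
      refine ⟨_, hℓ.map e₂ (key S), ?_⟩
      rintro _ ⟨s, hS, rfl⟩
      exact (hs s hS).map e₂
    · rintro ⟨ℓ, hℓ, hs⟩
      refine ⟨_, hℓ.map e₂.symm fun x => ?_, ?_⟩
      · apply Option.map_injective e₂.injective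
        rw [← key]
        simp
      · intro s hS
        have := (hs (e s) ⟨s, hS, rfl⟩).map e₂.symm
        simpa [e₂] using this
  rw [nabla_eq_sum, nabla_eq_sum]
  symm
  refine Finset.sum_equiv e.finsetCongr (by simp) fun S _ => ?_
  have h₂ : ((e.finsetCongr S : Finset T'.Crossing) : Set T'.Crossing) = e '' S := by simp
  have h₃ : ∏ s ∈ e.finsetCongr S, T'.wt s = ∏ s ∈ S, T.wt s := by
    simp [wt, hsign]
  rw [h₂, if_congr (h₁ S) rfl rfl, h₃]

/-! ### Removing a kink -/

/-- Smoothing a kink splits off a closed component, so no coherent state contains `c`. -/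
theorem nabla_delete_kink (T : TangleDiagram) {c : T.Crossing} {b : Bool}
    (h : T.next (some (c, b)) = some (c, !b)) : (T.delete {c}).nabla = T.nabla := by
  classical
  have : Fintype {x // x ∉ ({c} : Set T.Crossing)} := Fintype.ofFinite _
  rw [delete_nabla, T.nabla_eq_sum_split (E := {c}) {c} (by simp)]
  refine Finset.sum_congr rfl fun S _ => ?_
  have hn : ∀ S' : Set T.Crossing, c ∈ S' → ¬ T.IsDescending S' := by
    intro S' hc hS'
    have h₁ := exists_trav_iff.1 hS'.exists_trav (some (c, !b))
    -- Entering along `(c, !b)`, one leaves along `(c, b)` and returns at once.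
    have h₂ : T.smoothedNext S' (some (c, !b)) = some (c, !b) := by
      rw [smoothedNext_some, flipAt_of_mem hc, Bool.not_not, h]
    obtain ⟨n, -, hn⟩ := h₁.symm.exists_pow_eq'
    have : ∀ k : ℕ, (T.smoothedNext S' ^ k) (some (c, !b)) = some (c, !b) := by
      intro k
      induction k with
      | zero => rfl
      | succ k ih => rw [pow_succ, Equiv.Perm.mul_apply, h₂, ih]
    rw [this] at hn
    simp at hn
  rw [sum_powerset_singleton,
    if_neg (hn (inclState (S : Set {x // x ∉ ({c} : Set T.Crossing)}) ∪ ({c} : Finset T.Crossing))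
      (by simp))]
  simp

end TangleDiagram

/-! ### Moving the cut past a crossing -/

namespace LinkDiagram

variable (L : LinkDiagram)

open Classical in
theorem cutAfter_next_conj (r : Passage L.Crossing) :
    (L.cutAfter (L.next r)).next = Equiv.swap none (some (L.next r)) * (L.cutAfter r).next *
      Equiv.swap none (some (L.next r)) := by
  have h : Equiv.swap none (some (L.next r)) * Equiv.optionCongr L.next =
      Equiv.optionCongr L.next * Equiv.swap none (some r) := by
    rw [Equiv.mul_swap_eq_swap_mul]
    rfl
  simp only [cutAfter]
  rw [← mul_assoc, h, mul_assoc (Equiv.optionCongr L.next), Equiv.swap_mul_self, mul_one]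

/-- The passage skipped by the cut moves from the beginning of the traversal to its end. It does not
belong to a crossing of `S`, so the order conditions are unaffected. -/
theorem cutAfter_isDescending_next {r : Passage L.Crossing} {S : Set L.Crossing}
    (hS : (L.next r).1 ∉ S) :
    (L.cutAfter (L.next r)).IsDescending S ↔ (L.cutAfter r).IsDescending S := by
  classical
  set q := L.next r with hq
  have hf : (L.cutAfter q).smoothedNext S = Equiv.swap none (some q) *
      (L.cutAfter r).smoothedNext S * Equiv.swap none (some q) := by
    have hsw : Equiv.swap none (some q) * Equiv.optionCongr (flipAt S) =
        Equiv.optionCongr (flipAt S) * Equiv.swap none (some q) := by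
      rw [Equiv.mul_swap_eq_swap_mul]
      simp only [Equiv.optionCongr_apply, Option.map_none, Option.map_some, flipAt_of_notMem hS]
    have h := congrArg (fun g => g * Equiv.optionCongr (flipAt S)) (L.cutAfter_next_conj r)
    simp only [mul_assoc] at h
    rw [← hq, hsw] at h
    simp only [TangleDiagram.smoothedNext, mul_assoc]
    rw [hsw]
    exact h
  have hn : (L.cutAfter r).smoothedNext S none = some q := L.cutAfter_next_none r
  by_cases hex : ∃ ℓ, Trav ((L.cutAfter r).smoothedNext S) ℓ
  · obtain ⟨ℓ, hℓ⟩ := hex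
    obtain ⟨ℓ₁, rfl, h₁⟩ := hℓ.rotate hn
    rw [← hf] at h₁
    rw [TangleDiagram.isDescending_iff_of_trav hℓ, TangleDiagram.isDescending_iff_of_trav h₁]
    refine and_congr_right fun _ => forall₂_congr fun s hs => ?_
    have hne : ∀ b, (s, b) ≠ q := by
      rintro b hb
      exact hS (hb ▸ hs)
    constructor
    · intro h
      have := h.filter (· ≠ q)
      rw [List.filter_append] at this
      simp only [ne_eq, decide_not, List.filter_cons, hne, decide_false, Bool.not_false,
        if_true, List.filter_nil, decide_true, Bool.not_true, Bool.false_eq_true, if_false,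
        List.append_nil] at this
      exact (this.trans List.filter_sublist).cons q
    · intro h
      rcases List.sublist_cons_iff.1 h with h | ⟨r, hr, -⟩
      · exact h.trans (List.sublist_append_left _ _)
      · exact absurd (List.cons.inj hr).1 (hne true)
  · constructor
    · intro h
      obtain ⟨ℓ, hℓ⟩ := h.exists_trav
      rw [hf] at hℓ
      exact absurd (exists_trav_rotate ⟨ℓ, hℓ⟩) hex
    · exact fun h => absurd h.exists_trav hex

/-- A state containing the crossing next to the cut is not descending if the cut is followed by
the underpass, nor if it is preceded by the overpass. -/
theorem cutAfter_not_isDescending {r : Passage L.Crossing} {S : Set L.Crossing}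
    (hr : r.1 ∈ S) (h : r.2 = false) : ¬ (L.cutAfter r).IsDescending S := by
  intro hd
  obtain ⟨-, ℓ, hℓ, hs⟩ := ((L.cutAfter r).isDescending_iff S).1 hd
  -- The smoothed string ends by entering along the overpass and leaving along the underpass `r`;
  -- hence the underpass has been entered before.
  have hn : (L.cutAfter r).smoothedNext S (some (r.1, true)) = none := by
    rw [TangleDiagram.smoothedNext_some, flipAt_of_mem (q := (r.1, true)) hr]
    have : ((r.1, true).1, !(r.1, true).2) = r := Prod.ext rfl h.symm
    rw [this]
    exact L.cutAfter_next_self r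
  obtain ⟨ℓ₁, rfl⟩ := hℓ.eq_concat hn
  have h₁ := hs r.1 hr
  have hnd := hℓ.nodup
  have : [(r.1, false), (r.1, true)].Sublist (ℓ₁ ++ [(r.1, true)]) := by
    have hm : (r.1, false) ∈ ℓ₁ := by simpa using hℓ.2 (r.1, false)
    exact (List.singleton_sublist.2 hm).append (List.Sublist.refl [(r.1, true)])
  exact pair_sublist_asymm hnd h₁ this

/-- The string starts by entering a crossing of `S` along its underpass, which violates the
condition there. -/
theorem cutAfter_not_isDescending_next {r : Passage L.Crossing} {S : Set L.Crossing}
    (hr : (L.next r).1 ∈ S) (h : (L.next r).2 = false) : ¬ (L.cutAfter r).IsDescending S := by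
  intro hd
  obtain ⟨-, ℓ, hℓ, hs⟩ := ((L.cutAfter r).isDescending_iff S).1 hd
  have hn : (L.cutAfter r).smoothedNext S none = some ((L.next r).1, false) := by
    rw [← h]
    exact L.cutAfter_next_none r
  obtain ⟨ℓ₁, rfl, -⟩ := hℓ.eq_cons hn
  have h₁ := hs _ hr
  have hnd := hℓ.nodup
  have : [((L.next r).1, false), ((L.next r).1, true)].Sublist
      (((L.next r).1, false) :: ℓ₁) := by
    have hm : ((L.next r).1, true) ∈ ℓ₁ := by simpa using hℓ.2 ((L.next r).1, true)
    exact (List.singleton_sublist.2 hm).cons_cons _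
  exact pair_sublist_asymm hnd h₁ this

/-- With the overpass next to the cut, the condition at `c` is automatic. If the cut precedes the
overpass, the string enters it first; if the cut follows the overpass, the smoothed string leaves
through it at the very end, after entering along the underpass. -/
theorem cutAfter_isDescending_union_iff {r : Passage L.Crossing} {c : L.Crossing}
    (hr : (r.1 = c ∧ r.2 = true) ∨ ((L.next r).1 = c ∧ (L.next r).2 = true))
    (S : Set {x : L.Crossing // x ∉ ({c} : Set L.Crossing)}) :
    (L.cutAfter r).IsDescending (TangleDiagram.inclState S ∪ {c}) ↔
      ((L.cutAfter r).smooth c).IsDescending S := by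
  rw [TangleDiagram.smooth_isDescending_iff, TangleDiagram.isDescending_iff]
  refine and_congr_right fun _ => exists_congr fun ℓ => and_congr_right fun hℓ => ?_
  rw [Set.union_singleton, Set.forall_mem_insert, and_iff_right]
  have hc : c ∈ TangleDiagram.inclState S ∪ {c} := by simp
  rcases hr with ⟨h₁, h₂⟩ | ⟨h₁, h₂⟩
  · have hn : (L.cutAfter r).smoothedNext (TangleDiagram.inclState S ∪ {c}) (some (c, false))
        = none := by
      rw [TangleDiagram.smoothedNext_some, flipAt_of_mem (q := (c, false)) hc]
      have : ((c, false).1, !(c, false).2) = r := Prod.ext h₁.symm h₂.symm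
      rw [this]
      exact L.cutAfter_next_self r
    obtain ⟨ℓ₁, rfl⟩ := hℓ.eq_concat hn
    have hm : (c, true) ∈ ℓ₁ := by simpa using hℓ.2 (c, true)
    exact (List.singleton_sublist.2 hm).append (List.Sublist.refl [(c, false)])
  · have hn : (L.cutAfter r).smoothedNext (TangleDiagram.inclState S ∪ {c}) none
        = some (c, true) := by
      have : L.next r = (c, true) := Prod.ext h₁ h₂
      rw [← this]
      exact L.cutAfter_next_none r
    obtain ⟨ℓ₁, rfl, -⟩ := hℓ.eq_cons hn
    have hm : (c, false) ∈ ℓ₁ := by simpa using hℓ.2 (c, false)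
    exact (List.singleton_sublist.2 hm).cons_cons _

/-- The hypothesis concerns one smoothed diagram cut at two places, and will come from induction on
the number of crossings. -/
theorem cutAfter_nabla_next (r : Passage L.Crossing)
    (h : ∀ c : L.Crossing, ((L.cutAfter r).smooth c).nabla =
      ((L.cutAfter (L.next r)).smooth c).nabla) :
    (L.cutAfter (L.next r)).nabla = (L.cutAfter r).nabla := by
  classical
  set c := (L.next r).1 with hc
  have : Fintype {x // x ∉ ({c} : Set L.Crossing)} := Fintype.ofFinite _
  rw [(L.cutAfter r).nabla_eq_sum_split (E := {c}) {c} (by simp),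
    (L.cutAfter (L.next r)).nabla_eq_sum_split (E := {c}) {c} (by simp)]
  have h₀ : ∀ S : Finset {x // x ∉ ({c} : Set L.Crossing)},
      (L.cutAfter (L.next r)).IsDescending
        (TangleDiagram.inclState (S : Set {x // x ∉ ({c} : Set L.Crossing)})) ↔
      (L.cutAfter r).IsDescending
        (TangleDiagram.inclState (S : Set {x // x ∉ ({c} : Set L.Crossing)})) := by
    intro S
    apply cutAfter_isDescending_next
    rintro ⟨x, -, hx⟩
    exact x.2 hx
  simp only [sum_powerset_singleton, Finset.coe_empty, Set.union_empty, Finset.coe_singleton,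
    Finset.prod_empty, Finset.prod_singleton, mul_add, Finset.sum_add_distrib]
  congr 1
  · exact Finset.sum_congr rfl fun S _ => by rw [if_congr (h₀ S) rfl rfl]; rfl
  -- States containing the skipped crossing: along the underpass there are none for either cut.
  -- Along the overpass both sums are the weight times the polynomial of the smoothing.
  · cases hb : (L.next r).2 with
    | false =>
      refine Finset.sum_congr rfl fun S _ => ?_
      rw [if_neg (L.cutAfter_not_isDescending (by simp [hc]) hb),
        if_neg (L.cutAfter_not_isDescending_next (by simp [hc]) hb)]
      rfl
    | true =>
      have e : ∀ r' : Passage L.Crossing,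
          ((r'.1 = c ∧ r'.2 = true) ∨ ((L.next r').1 = c ∧ (L.next r').2 = true)) →
          (∑ S : Finset {x // x ∉ ({c} : Set L.Crossing)}, (∏ s ∈ S, (L.cutAfter r').wt s.1) *
            if (L.cutAfter r').IsDescending (TangleDiagram.inclState
              (S : Set {x // x ∉ ({c} : Set L.Crossing)}) ∪ {c}) then (L.cutAfter r').wt c else 0) =
          (L.cutAfter r').wt c * ((L.cutAfter r').smooth c).nabla := by
        intro r' hr'
        rw [TangleDiagram.smooth_nabla, Finset.mul_sum]
        refine Finset.sum_congr rfl fun S _ => ?_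
        rw [if_congr (L.cutAfter_isDescending_union_iff hr' _) rfl rfl]
        split_ifs <;> ring
      rw [e _ (Or.inl ⟨rfl, hb⟩), e _ (Or.inr ⟨rfl, hb⟩), h c]
      rfl

end LinkDiagram

/-! ### Local pictures -/

section Local
variable {A B : Type}

/-- The list of points visited by `g` between `x` and `none`, if this takes at most `n` steps. -/
def walk (g : Option B → Option B) : ℕ → Option B → Option (List B)
  | 0, _ => none
  | n + 1, x => match g x with
    | none => some []
    | some b => (walk g n (some b)).map (b :: ·)

/-- `walk` makes traversals of the local picture computable; the bound on the number of steps only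
serves termination. -/
theorem path_none_iff_walk {g : Option B → Option B} {n : ℕ} {x : Option B} {ℓ : List B}
    (hn : ℓ.length < n) : Path g x (ℓ.map some) none ↔ walk g n x = some ℓ := by
  induction n generalizing x ℓ with
  | zero => simp at hn
  | succ n ih =>
    rw [walk]
    rcases hg : g x with _ | b
    · cases ℓ with
      | nil => simpa [Path] using hg
      | cons c ℓ => simp [Path, hg]
    · cases ℓ with
      | nil => simp [Path, hg]
      | cons c ℓ =>
        simp only [List.map_cons, Path, hg, Option.some.injEq, Option.map_eq_some_iff,
          List.cons.injEq]
        constructor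
        · rintro ⟨rfl, h⟩
          exact ⟨ℓ, (ih (by simpa using hn)).1 h, rfl, rfl⟩
        · rintro ⟨ℓ', h, rfl, rfl⟩
          exact ⟨rfl, (ih (by simpa using hn)).2 h⟩

theorem trav_iff_walk [Fintype B] {g : Equiv.Perm (Option B)} {ℓ : List B} :
    Trav g ℓ ↔ walk g (Fintype.card B + 1) none = some ℓ ∧ ℓ.length = Fintype.card B := by
  classical
  constructor
  · intro h
    have hl : ℓ.length = Fintype.card B := by
      rw [← List.toFinset_card_of_nodup h.nodup, ← Finset.card_univ]
      congr 1
      ext b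
      simpa using h.2 b
    exact ⟨(path_none_iff_walk (by omega)).1 h.1, hl⟩
  · rintro ⟨h, hl⟩
    have hp := (path_none_iff_walk (by omega)).2 h
    refine ⟨hp, fun b => ?_⟩
    have hnd := path_none_nodup hp
    have : ℓ.toFinset = Finset.univ := by
      rw [← Finset.card_eq_iff_eq_univ, List.toFinset_card_of_nodup hnd, hl]
    have hb : b ∈ ℓ.toFinset := this ▸ Finset.mem_univ b
    simpa using hb

/-- The order in which the string leaves the local picture, provided that it passes through the
whole picture and meets the given pairs of points in the given order. -/
def localRes [Fintype B] [DecidableEq B] (g : Option B → Option B) (u : B → B)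
    (pairs : List (B × B)) (isExit : B → Bool) : Option (List B) :=
  match walk (fun x => g (x.map u)) (Fintype.card B + 1) none with
  | none => none
  | some ℓ => if ℓ.length = Fintype.card B ∧ ∀ p ∈ pairs, [p.1, p.2].Sublist ℓ then
      some ((ℓ.map u).filter isExit) else none

theorem localRes_eq_some_iff [Fintype B] [DecidableEq B] {g u' : Equiv.Perm (Option B)}
    {u : B → B} (hu : ∀ x, u' x = x.map u)
    {pairs : List (B × B)} {isExit : B → Bool} {o : List B} :
    localRes g u pairs isExit = some o ↔ ∃ ℓ, Trav (g * u') ℓ ∧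
      (∀ p ∈ pairs, [p.1, p.2].Sublist ℓ) ∧ (ℓ.map u).filter isExit = o := by
  have e : (fun x => g (x.map u)) = (g * u' : Equiv.Perm (Option B)) := by
    ext1 x
    rw [Equiv.Perm.mul_apply, hu]
  simp only [trav_iff_walk, localRes, e]
  rcases walk (⇑(g * u')) (Fintype.card B + 1) none with _ | ℓ
  · simp
  · simp only [Option.some.injEq, Option.ite_none_right_eq_some]
    constructor
    · rintro ⟨⟨h₁, h₂⟩, h₃⟩
      exact ⟨ℓ, ⟨rfl, h₁⟩, h₂, h₃⟩
    · rintro ⟨ℓ', ⟨rfl, h₁⟩, h₂, h₃⟩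
      exact ⟨⟨h₁, h₂⟩, h₃⟩

/-- Each step of the local picture unfolds to the outer arc that realizes it. The inner smoothing
`U` is invisible along that arc. -/
theorem path_expand {N U : Equiv.Perm (Option A)} {n u : Equiv.Perm (Option B)} {ι : B → A}
    {arc : Option B → List A}
    (harc : ∀ x, Path N (x.map ι) ((arc x).map some) ((n x).map ι))
    (hoff : ∀ x, ∀ a ∈ arc x, a ∉ Set.range ι)
    (hU : ∀ x : Option B, U (x.map ι) = (u x).map ι) (hU' : ∀ a, a ∉ Set.range ι → U (some a) = a)
    (x : Option B) (ℓ : List B) (h : Path (n * u : Equiv.Perm (Option B)) x (ℓ.map some) none) :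
    Path (N * U : Equiv.Perm (Option A)) (x.map ι)
      ((arc (u x) ++ ℓ.flatMap fun b => ι b :: arc (u (some b))).map some) none := by
  have step : ∀ x : Option B, Path (N * U : Equiv.Perm (Option A)) (x.map ι)
      ((arc (u x)).map some) ((n (u x)).map ι) := by
    intro x
    have h₁ := harc (u x)
    have h₂ := hoff (u x)
    cases hl : arc (u x) with
    | nil =>
      rw [hl] at h₁
      change N (U (x.map ι)) = _
      rw [hU]; exact h₁
    | cons a l =>
      rw [hl] at h₁ h₂
      refine ⟨?_, h₁.2.congr ?_ ?_⟩
      · change N (U (x.map ι)) = _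
        rw [hU]; exact h₁.1
      · exact congrArg N (hU' a (h₂ a (by simp)))
      · intro b hb
        obtain ⟨c, hc, rfl⟩ := List.mem_map.1 hb
        exact congrArg N (hU' c (h₂ c (by simp [hc])))
  induction ℓ generalizing x with
  | nil =>
    have := step x
    have h' : n (u x) = none := h
    rw [h'] at this
    simpa using this
  | cons b ℓ ih =>
    have h₁ := step x
    have h' : n (u x) = some b := h.1
    rw [h'] at h₁
    have h₂ := ih (some b) h.2
    have e : (arc (u x) ++ (b :: ℓ).flatMap fun b => ι b :: arc (u (some b))).map some =
        (arc (u x)).map some ++ some (ι b) ::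
          (arc (u (some b)) ++ ℓ.flatMap fun b => ι b :: arc (u (some b))).map some := by
      simp
    rw [e, path_append_cons]
    exact ⟨h₁, h₂⟩

/-- A traversal is determined by its restriction to a local picture. -/
theorem exists_trav_local_iff [Finite A] [Fintype B] [DecidableEq B] {N U : Equiv.Perm (Option A)}
    {n u' : Equiv.Perm (Option B)} {u : B → B} (hu : ∀ x, u' x = x.map u)
    {ι : B → A} (hι : Function.Injective ι)
    {arc : Option B → List A}
    (harc : ∀ x, Path N (x.map ι) ((arc x).map some) ((n x).map ι))
    (hoff : ∀ x, ∀ a ∈ arc x, a ∉ Set.range ι)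
    (hU : ∀ x : Option B, U (x.map ι) = (u' x).map ι)
    (hU' : ∀ a, a ∉ Set.range ι → U (some a) = a)
    {isExit : B → Bool} (hexit : ∀ b, isExit b = false → arc (some b) = [])
    (P : Set (A × A)) (hP : ∀ p ∈ P, p.1 ∉ Set.range ι ∧ p.2 ∉ Set.range ι)
    (pairs : List (B × B)) :
    (∃ ℓ, Trav (N * U) ℓ ∧ (∀ p ∈ P, [p.1, p.2].Sublist ℓ) ∧
      ∀ p ∈ pairs, [ι p.1, ι p.2].Sublist ℓ) ↔
    (∀ a, ∃ b : Option B, N.SameCycle (b.map ι) a) ∧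
      ∃ o, localRes n u pairs isExit = some o ∧ ∀ p ∈ P, [p.1, p.2].Sublist
        (arc none ++ o.flatMap fun b => arc (some b)) := by
  classical
  have he : IsErase N n (Option.map ι) := IsErase.of_list fun y => ⟨arc y, harc y, hoff y⟩
  have heU : IsErase (N * U) (n * u') (Option.map ι) := by
    refine he.mul hU ?_
    rintro (_ | a) ha
    · exact absurd ⟨none, rfl⟩ ha
    · exact hU' a fun ⟨b, hb⟩ => ha ⟨some b, congrArg some hb⟩
  have hcov : (∀ a, ∃ b : Option B, (N * U).SameCycle (b.map ι) a) ↔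
      ∀ a, ∃ b : Option B, N.SameCycle (b.map ι) a := by
    have := forall_exists_sameCycle_mul_iff (f := N) (u := U)
      (p := fun x => ∃ b : Option B, b.map ι = x) (by
        rintro (_ | a) ha
        · exact absurd ⟨none, rfl⟩ ha
        · exact hU' a fun ⟨b, hb⟩ => ha ⟨some b, congrArg some hb⟩)
    simpa using this
  -- The outer points are visited arc by arc, in the order in which the string leaves the picture.
  -- Passages that are not exits lead to empty arcs and can be dropped.
  have hfilter : ∀ ℓB : List B,
      (arc (u' none) ++ ℓB.flatMap fun b => ι b :: arc (u' (some b))).filter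
        (fun a => decide (a ∉ Set.range ι)) =
      arc none ++ ((ℓB.map u).filter isExit).flatMap fun b => arc (some b) := by
    intro ℓB
    have harcf : ∀ x, (arc x).filter (fun a => decide (a ∉ Set.range ι)) = arc x := by
      intro x
      rw [List.filter_eq_self]
      intro a ha
      simpa using hoff x a ha
    rw [List.filter_append, hu none, Option.map_none, harcf]
    congr 1
    induction ℓB with
    | nil => simp
    | cons b ℓB ih =>
      rw [List.flatMap_cons, List.filter_append, ih, List.filter_cons_of_neg (by simp), harcf,
        hu (some b), Option.map_some, List.map_cons]
      cases hb : isExit (u b) with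
      | true => rw [List.filter_cons_of_pos hb, List.flatMap_cons]
      | false => rw [List.filter_cons_of_neg (by simp [hb]), hexit _ hb, List.nil_append]
  have hpair : ∀ (ℓ : List A) (p : A × A), p ∈ P → ([p.1, p.2].Sublist ℓ ↔
      [p.1, p.2].Sublist (ℓ.filter fun a => decide (a ∉ Set.range ι))) := by
    intro ℓ p hp
    constructor
    · intro h
      have := h.filter fun a => decide (a ∉ Set.range ι)
      have h₁ := (hP p hp).1
      have h₂ := (hP p hp).2
      simpa only [List.filter_cons, h₁, h₂, not_false_eq_true, decide_true, if_true,
        List.filter_nil] using this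
    · exact fun h => h.trans List.filter_sublist
  constructor
  · rintro ⟨ℓ, hℓ, h₁, h₂⟩
    refine ⟨hcov.1 ((heU.exists_trav_iff hι).1 ⟨ℓ, hℓ⟩).2, ?_⟩
    obtain ⟨ℓB, hB, -⟩ := hℓ.erase heU hι
    refine ⟨_, (localRes_eq_some_iff hu).2 ⟨ℓB, hB, fun p hp => ?_, rfl⟩, fun p hp => ?_⟩
    · exact (hℓ.pair_erase heU hι hB).2 (h₂ p hp)
    · have hx := path_expand harc hoff hU hU' none ℓB hB.1
      rw [← hfilter, ← path_none_unique hℓ.1 hx, ← hpair ℓ p hp]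
      exact h₁ p hp
  · rintro ⟨hc, o, ho, hout⟩
    obtain ⟨ℓB, hB, h₂, rfl⟩ := (localRes_eq_some_iff hu).1 ho
    obtain ⟨ℓ, hℓ⟩ := (heU.exists_trav_iff hι).2 ⟨⟨ℓB, hB⟩, hcov.2 hc⟩
    refine ⟨ℓ, hℓ, fun p hp => ?_, fun p hp => (hℓ.pair_erase heU hι hB).1 (h₂ p hp)⟩
    have hx := path_expand harc hoff hU hU' none ℓB hB.1
    rw [hpair ℓ p hp, path_none_unique hℓ.1 hx, hfilter]
    exact hout p hp

end Local

/-- Relabel the points of the string by `σ`. -/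
abbrev TangleDiagram.conjNext (T : TangleDiagram) (σ : Equiv.Perm (Passage T.Crossing)) :
    TangleDiagram where
  Crossing := T.Crossing
  finite := T.finite
  next := Equiv.optionCongr σ * T.next * Equiv.optionCongr σ.symm
  sign := T.sign
  circles := T.circles

/-- The local smoothing at the crossings `k` with `I k = true`. -/
def localFlip {K : Type} (I : K → Bool) (q : K × Bool) : K × Bool :=
  if I q.1 then (q.1, !q.2) else q

/-- The descending states of a diagram in terms of a local picture around the crossings in the
image of `κ`; the passages of the local picture may be relabelled by `s`. -/
theorem TangleDiagram.conjNext_isDescending_iff (T : TangleDiagram) {K : Type} [Fintype K]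
    [DecidableEq K] {κ : K → T.Crossing} (hκ : Function.Injective κ)
    {E : Set T.Crossing} (hE : ∀ c, c ∈ E ↔ c ∈ Set.range κ)
    {σ : Equiv.Perm (Passage T.Crossing)} {s : Equiv.Perm (K × Bool)}
    (hs : ∀ q, σ (κ q.1, q.2) = (κ (s q).1, (s q).2)) (hσ : ∀ q, q.1 ∉ E → σ q = q)
    (S : Set {c // c ∉ E}) {n : Equiv.Perm (Option (K × Bool))}
    {arc : Option (K × Bool) → List (Passage T.Crossing)}
    (harc : ∀ x, Path (T.smoothedNext (inclState S)) (x.map (Prod.map κ id)) ((arc x).map some)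
      ((n x).map (Prod.map κ id)))
    (hoff : ∀ x, ∀ a ∈ arc x, a ∉ Set.range (Prod.map κ (id : Bool → Bool)))
    {isExit : K × Bool → Bool} (hexit : ∀ b, isExit b = false → arc (some b) = [])
    (I : K → Bool) (ks : List K) (hks : ∀ k, k ∈ ks ↔ I k = true) :
    (T.conjNext σ).IsDescending (inclState S ∪ {c | ∃ k, I k = true ∧ κ k = c}) ↔
      (T.circles = 0 ∧ ∀ a, ∃ b : Option (K × Bool),
        (T.smoothedNext (inclState S)).SameCycle (b.map (Prod.map κ id)) a) ∧
      ∃ o, localRes n (fun q => s.symm (localFlip I (s q)))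
        (ks.map fun k => (s.symm (k, true), s.symm (k, false))) isExit = some o ∧
        ∀ c ∈ inclState S, [(c, true), (c, false)].Sublist
          (arc none ++ o.flatMap fun b => arc (some b)) := by
  set ι : K × Bool → Passage T.Crossing := Prod.map κ id with hιdef
  have hι : Function.Injective ι := hκ.prodMap Function.injective_id
  have hmem : ∀ q : Passage T.Crossing, q.1 ∈ E ↔ q ∈ Set.range ι := by
    intro q
    rw [hE]
    constructor
    · rintro ⟨k, hk⟩
      exact ⟨(k, q.2), by rw [hιdef]; exact Prod.ext hk rfl⟩
    · rintro ⟨k, rfl⟩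
      exact ⟨k.1, rfl⟩
  have hs' : ∀ q, σ (ι q) = ι (s q) := hs
  have hs'' : ∀ q, σ.symm (ι q) = ι (s.symm q) := by
    intro q
    rw [Equiv.symm_apply_eq, hs', Equiv.apply_symm_apply]
  have hσ' : ∀ q, q ∉ Set.range ι → σ q = q := fun q hq => hσ q (fun h => hq ((hmem q).1 h))
  have hσ'' : ∀ q, q ∉ Set.range ι → σ.symm q = q := by
    intro q hq
    rw [Equiv.symm_apply_eq, hσ' q hq]
  set J : Set T.Crossing := {c | ∃ k, I k = true ∧ κ k = c} with hJ
  have hJι : ∀ q, flipAt J (ι q) = ι (localFlip I q) := by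
    intro q
    unfold localFlip
    by_cases h : I q.1 = true
    · rw [if_pos h, flipAt_of_mem (S := J) (q := ι q) ⟨q.1, h, rfl⟩]
      rfl
    · rw [if_neg h, flipAt_of_notMem]
      rintro ⟨k, hk, hk'⟩
      exact h (hκ hk' ▸ hk)
  have hJoff : ∀ q, q ∉ Set.range ι → flipAt J q = q := by
    intro q hq
    apply flipAt_of_notMem
    rintro ⟨k, -, hk⟩
    exact hq ((hmem q).1 ((hE _).2 ⟨k, hk⟩))
  have hSι : ∀ q, flipAt (inclState S) (ι q) = ι q := by
    intro q
    apply flipAt_of_notMem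
    rintro ⟨c, -, hc⟩
    exact c.2 ((hE _).2 ⟨q.1, hc.symm⟩)
  have hdisj : Disjoint (inclState S) J := by
    rw [Set.disjoint_left]
    rintro _ ⟨c, -, rfl⟩ ⟨k, -, hk⟩
    exact c.2 ((hE _).2 ⟨k, hk⟩)
  have hSoff : ∀ q, q ∉ Set.range ι → flipAt (inclState S) q ∉ Set.range ι := by
    intro q hq h
    apply hq
    rw [← hmem] at h ⊢
    rwa [flipAt_fst] at h
  set N := T.smoothedNext (inclState S) with hN
  set U : Equiv.Perm (Option (Passage T.Crossing)) :=
    Equiv.optionCongr (σ.symm * flipAt J * σ : Equiv.Perm (Passage T.Crossing)) with hUdef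
  set u' : Equiv.Perm (Option (K × Bool)) := Equiv.ofBijective
    (Option.map (fun q => s.symm (localFlip I (s q)))) (by
      refine Finite.injective_iff_bijective.1 (Option.map_injective ?_)
      intro a b hab
      have h₁ : localFlip I (s a) = localFlip I (s b) := s.symm.injective hab
      have h₂ : ∀ q, localFlip I (localFlip I q) = q := by
        intro q
        by_cases h : I q.1 = true <;> simp [localFlip, h]
      exact s.injective (by rw [← h₂ (s a), h₁, h₂])) with hu'
  -- Conjugating back by `σ` expresses the relabelled diagram with the unchanged outer permutation
  -- `N`. The relabelling is then visible only in the local smoothing `U`.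
  have hf : (T.conjNext σ).smoothedNext (inclState S ∪ J) =
      Equiv.optionCongr σ * (N * U) * Equiv.optionCongr σ.symm := by
    ext1 x
    rcases x with _ | q
    · rfl
    · change Option.map σ (T.next (some (σ.symm (flipAt (inclState S ∪ J) q)))) =
        Option.map σ (T.next (some (flipAt (inclState S)
          (σ.symm (flipAt J (σ (σ.symm q)))))))
      rw [flipAt_union hdisj, Equiv.Perm.mul_apply, Equiv.apply_symm_apply]
      by_cases hq : q ∈ Set.range ι
      · obtain ⟨b, rfl⟩ := hq
        rw [hSι, hJι, hs'', hSι]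
      · rw [hJoff _ (hSoff q hq), hσ'' _ (hSoff q hq), hJoff q hq, hσ'' q hq]
  have hmap : ∀ {ℓ}, Trav (N * U) ℓ →
      Trav ((T.conjNext σ).smoothedNext (inclState S ∪ J)) (ℓ.map σ) := by
    intro ℓ hℓ
    refine hℓ.map σ fun x => ?_
    rw [hf]
    simp only [Equiv.Perm.mul_apply, Equiv.optionCongr_apply, Option.map_map]
    congr 2
    cases x <;> simp
  have hmap' : ∀ {ℓ}, Trav ((T.conjNext σ).smoothedNext (inclState S ∪ J)) ℓ →
      Trav (N * U) (ℓ.map σ.symm) := by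
    intro ℓ hℓ
    refine hℓ.map σ.symm fun x => ?_
    rw [hf]
    simp only [Equiv.Perm.mul_apply, Equiv.optionCongr_apply, Option.map_map]
    simp [Function.comp_def]
  have hsub : ∀ {ℓ : List (Passage T.Crossing)} {a b}, [a, b].Sublist (ℓ.map σ) ↔
      [σ.symm a, σ.symm b].Sublist ℓ := by
    intro ℓ a b
    rw [← sublist_map_iff_of_injective σ.injective (l := [σ.symm a, σ.symm b])]
    simp
  have key := exists_trav_local_iff (u := fun q => s.symm (localFlip I (s q))) (u' := u')
    (fun x => rfl) hι harc hoff (U := U) ?_ ?_ hexit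
    ((fun c => ((c, true), (c, false))) '' inclState S) ?_
    (ks.map fun k => (s.symm (k, true), s.symm (k, false)))
  · rw [isDescending_iff, and_assoc]
    refine and_congr_right fun _ => ?_
    simp only [Set.forall_mem_image] at key
    refine Iff.trans ?_ (key.trans (by simp only [Set.forall_mem_image]))
    have e : ∀ ℓ, (∀ c ∈ inclState S ∪ J, [(c, true), (c, false)].Sublist (ℓ.map σ)) ↔
        (∀ c ∈ inclState S, [(c, true), (c, false)].Sublist ℓ) ∧
        ∀ p ∈ ks.map (fun k => (s.symm (k, true), s.symm (k, false))),
          [ι p.1, ι p.2].Sublist ℓ := by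
      intro ℓ
      constructor
      · intro h
        refine ⟨fun c hc => ?_, ?_⟩
        · have := h c (Or.inl hc)
          have hcE : c ∉ E := by obtain ⟨d, -, rfl⟩ := hc; exact d.2
          rw [hsub, hσ'' _ (fun h => hcE ((hmem _).2 h)), hσ'' _ (fun h => hcE ((hmem _).2 h))]
            at this
          exact this
        · rintro p hp
          obtain ⟨k, hk, rfl⟩ := List.mem_map.1 hp
          have := h (κ k) (Or.inr ⟨k, (hks k).1 hk, rfl⟩)
          rw [hsub] at this
          have h₁ := hs'' (k, true)
          have h₂ := hs'' (k, false)
          rw [← h₁, ← h₂]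
          exact this
      · rintro ⟨h₁, h₂⟩ c (hc | ⟨k, hk, rfl⟩)
        · have := h₁ c hc
          have hcE : c ∉ E := by obtain ⟨d, -, rfl⟩ := hc; exact d.2
          rw [hsub, hσ'' _ (fun h => hcE ((hmem _).2 h)), hσ'' _ (fun h => hcE ((hmem _).2 h))]
          exact this
        · have := h₂ _ (List.mem_map_of_mem ((hks k).2 hk))
          rw [hsub]
          have h₁ := hs'' (k, true)
          have h₂ := hs'' (k, false)
          rw [← h₁, ← h₂] at this
          exact this
    constructor
    · rintro ⟨ℓ, hℓ, h⟩
      have h₁ := (e (ℓ.map σ.symm)).1 (by simpa using h)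
      exact ⟨_, hmap' hℓ, fun x hx => h₁.1 _ (Set.mem_image_of_mem _ hx), h₁.2⟩
    · rintro ⟨ℓ, hℓ, h₁, h₂⟩
      exact ⟨_, hmap hℓ, (e ℓ).2 ⟨Set.forall_mem_image.2 h₁, h₂⟩⟩
  · rintro (_ | q)
    · rfl
    · change some (σ.symm (flipAt J (σ (ι q)))) = some (ι (s.symm (localFlip I (s q))))
      rw [hs', hJι, hs'']
  · intro a ha
    change some (σ.symm (flipAt J (σ a))) = some a
    rw [hσ' a ha, hJoff a ha, hσ'' a ha]
  · rintro _ ⟨c, hc, rfl⟩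
    have hcE : c ∉ E := by obtain ⟨d, -, rfl⟩ := hc; exact d.2
    exact ⟨fun h => hcE ((hmem _).2 h), fun h => hcE ((hmem _).2 h)⟩

/-! ### Comparing local pictures -/

section Balanced
variable {κ R : Type*}

/-- The coefficient of `k` in a formal sum. -/
def formalCoeff [DecidableEq κ] (l : List (κ × ℤ)) (k : κ) : ℤ :=
  (l.map fun e => if e.1 = k then e.2 else 0).sum

/-- Two formal sums have the same coefficients. -/
def balanced [DecidableEq κ] (l₁ l₂ : List (κ × ℤ)) : Bool :=
  (l₁ ++ l₂).all fun e => formalCoeff l₁ e.1 == formalCoeff l₂ e.1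

theorem formalSum_eq [DecidableEq κ] [CommRing R] (φ : κ → R) (K : Finset κ) (l : List (κ × ℤ))
    (h : ∀ e ∈ l, e.1 ∈ K) :
    (l.map fun e => φ e.1 * (e.2 : R)).sum = ∑ k ∈ K, φ k * (formalCoeff l k : R) := by
  induction l with
  | nil => simp [formalCoeff]
  | cons e l ih =>
    have hs : ∑ k ∈ K, φ k * ((if e.1 = k then e.2 else 0 : ℤ) : R) = φ e.1 * (e.2 : R) := by
      rw [Finset.sum_eq_single e.1]
      · simp
      · intro k _ hk
        simp [Ne.symm hk]
      · intro hk
        exact absurd (h e (by simp)) hk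
    rw [List.map_cons, List.sum_cons, ih fun e' he' => h e' (by simp [he']), ← hs,
      ← Finset.sum_add_distrib]
    refine Finset.sum_congr rfl fun k _ => ?_
    simp only [formalCoeff, List.map_cons, List.sum_cons, Int.cast_add]
    ring

/-- Coefficients need to be compared only at keys that occur in one of the lists; equality then
holds for every evaluation `φ`. -/
theorem balanced_sum_eq [DecidableEq κ] [CommRing R] {l₁ l₂ : List (κ × ℤ)}
    (h : balanced l₁ l₂ = true) (φ : κ → R) :
    (l₁.map fun e => φ e.1 * (e.2 : R)).sum = (l₂.map fun e => φ e.1 * (e.2 : R)).sum := by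
  rw [formalSum_eq φ ((l₁ ++ l₂).map Prod.fst).toFinset l₁ ?_,
    formalSum_eq φ ((l₁ ++ l₂).map Prod.fst).toFinset l₂ ?_]
  · refine Finset.sum_congr rfl fun k hk => ?_
    obtain ⟨e, he, rfl⟩ := List.mem_map.1 (List.mem_toFinset.1 hk)
    have := List.all_eq_true.1 h e he
    rw [beq_iff_eq] at this
    rw [this]
  all_goals
    intro e he
    rw [List.mem_toFinset]
    exact List.mem_map_of_mem (by simp [he])

end Balanced

section
variable {K : Type} [Fintype K] [DecidableEq K]

/-- The contribution of a local smoothing. -/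
def localTerm (g : Option (K × Bool) → Option (K × Bool)) (s s' : K × Bool → K × Bool)
    (ks : List K) (isExit : K × Bool → Bool) (I : K → Bool) : Option (List (K × Bool)) :=
  localRes g (fun q => s' (localFlip I (s q)))
    ((ks.filter I).map fun k => (s' (k, true), s' (k, false))) isExit

/-- The contributions of local smoothings as a formal sum. -/
def localEntries (g : Option (K × Bool) → Option (K × Bool)) (s s' : K × Bool → K × Bool)
    (ks : List K) (isExit : K × Bool → Bool) (rel : K → ℤ) (Is : List (K → Bool)) :
    List ((List (K × Bool) × ℕ) × ℤ) :=
  Is.filterMap fun I => (localTerm g s s' ks isExit I).map fun o =>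
    ((o, (ks.filter I).length), ((ks.filter I).map rel).prod)

/-- The entries are the local state sum before anything is known about the outside: a key consists
of an exit order and the number of smoothed crossings, and its evaluation supplies the outer
condition `F` and a power of `z`. -/
theorem localEntries_sum {R : Type*} [CommRing R] (g : Option (K × Bool) → Option (K × Bool))
    (s s' : K × Bool → K × Bool)
    {ks : List K} (isExit : K × Bool → Bool) (rel : K → ℤ) (Is : List (K → Bool)) (z : R)
    (F : List (K × Bool) → R) :
    ((localEntries g s s' ks isExit rel Is).map
      fun e => (F e.1.1 * z ^ e.1.2) * (e.2 : R)).sum =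
    (Is.map fun I => (localTerm g s s' ks isExit I).elim 0 F *
      ((ks.filter I).map fun k => (rel k : R) * z).prod).sum := by
  induction Is with
  | nil => rfl
  | cons I Is ih =>
    have hp : ∀ l : List K, (l.map fun k => (rel k : R) * z).prod =
        z ^ l.length * ((l.map rel).prod : ℤ) := by
      intro l
      induction l with
      | nil => simp
      | cons a l ih =>
        simp only [List.map_cons, List.prod_cons, ih, List.length_cons, Int.cast_mul]
        ring
    rw [List.map_cons, List.sum_cons, ← ih, localEntries, List.filterMap_cons]
    rcases localTerm g s s' ks isExit I with _ | o
    · simp [localEntries]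
    · simp [localEntries, hp, mul_assoc]

end

theorem ite_elim_ite_mul {β R : Type*} [Semiring R] (A : Prop) [Decidable A] (x : Option β)
    (B : β → Prop) [DecidablePred B] [Decidable (A ∧ ∃ o, x = some o ∧ B o)] (p : R) :
    (if A then (x.elim 0 fun o => if B o then 1 else 0) * p else 0) =
      if A ∧ ∃ o, x = some o ∧ B o then p else 0 := by
  rcases x with _ | o
  · simp
  · by_cases hA : A <;> by_cases hB : B o <;> simp [hA, hB]

namespace TangleDiagram

variable (T : TangleDiagram) {K : Type} {κ : K → T.Crossing}

/-- `n` records how the outside connects the passages of the picture, and `arc` what is met on the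
way. Both depend only on the outer part `S` of a state, so they serve all local smoothings and both
sides of a move. -/
theorem exists_localData (hκ : Function.Injective κ) {isExit : K × Bool → Bool}
    (hexit : ∀ b, isExit b = false → ∃ b', T.next (some (Prod.map κ id b)) =
      some (Prod.map κ id b')) (S : Set {c // c ∉ Set.range κ}) :
    ∃ (n : Equiv.Perm (Option (K × Bool)))
      (arc : Option (K × Bool) → List (Passage T.Crossing)),
      (∀ x, Path (T.smoothedNext (inclState S)) (x.map (Prod.map κ id)) ((arc x).map some)
        ((n x).map (Prod.map κ id))) ∧
      (∀ x, ∀ a ∈ arc x, a ∉ Set.range (Prod.map κ (id : Bool → Bool))) ∧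
      (∀ b, isExit b = false → arc (some b) = []) ∧
      ∀ b b', T.next (some (Prod.map κ id b)) = some (Prod.map κ id b') →
        n (some b) = some b' := by
  have hι : Function.Injective (Prod.map κ (id : Bool → Bool)) :=
    hκ.prodMap Function.injective_id
  obtain ⟨n, hn⟩ := exists_isErase (T.smoothedNext (inclState S)) (Option.map_injective hι)
  choose arc h₁ h₂ using hn.exists_list
  have hN : ∀ b, T.smoothedNext (inclState S) (some (Prod.map κ id b)) =
      T.next (some (Prod.map κ id b)) := by
    intro b
    rw [smoothedNext_some, flipAt_of_notMem]
    rintro ⟨c, -, hc⟩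
    exact c.2 ⟨b.1, hc.symm⟩
  have hnil : ∀ b b', T.next (some (Prod.map κ id b)) = some (Prod.map κ id b') →
      arc (some b) = [] := by
    intro b b' h
    cases ha : arc (some b) with
    | nil => rfl
    | cons a l =>
      have h₃ := h₁ (some b)
      have h₄ := h₂ (some b) a (by simp [ha])
      rw [ha] at h₃
      have h₅ : T.smoothedNext (inclState S) (some (Prod.map κ id b)) = some a := h₃.1
      rw [hN, h] at h₅
      exact absurd ⟨b', Option.some_injective _ h₅⟩ h₄
  refine ⟨n, arc, h₁, h₂, ?_, ?_⟩
  · intro b hb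
    obtain ⟨b', h⟩ := hexit b hb
    exact hnil b b' h
  · intro b b' h
    have h₃ := h₁ (some b)
    rw [hnil b b' h] at h₃
    have h₄ : T.smoothedNext (inclState S) (some (Prod.map κ id b)) =
      (n (some b)).map (Prod.map κ id) := h₃
    rw [hN, h] at h₄
    exact (Option.map_injective hι (a₁ := some b') h₄).symm

open Classical in
/-- Summing over the local smoothings. -/
theorem conjNext_local_sum [Fintype K] [DecidableEq K] (hκ : Function.Injective κ)
    {σ : Equiv.Perm (Passage T.Crossing)} {s : Equiv.Perm (K × Bool)}
    (hs : ∀ q, σ (κ q.1, q.2) = (κ (s q).1, (s q).2)) (hσ : ∀ q, q.1 ∉ Set.range κ → σ q = q)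
    (S : Set {c // c ∉ Set.range κ}) {n : Equiv.Perm (Option (K × Bool))}
    {arc : Option (K × Bool) → List (Passage T.Crossing)}
    (harc : ∀ x, Path (T.smoothedNext (inclState S)) (x.map (Prod.map κ id)) ((arc x).map some)
      ((n x).map (Prod.map κ id)))
    (hoff : ∀ x, ∀ a ∈ arc x, a ∉ Set.range (Prod.map κ (id : Bool → Bool)))
    {isExit : K × Bool → Bool} (hexit : ∀ b, isExit b = false → arc (some b) = [])
    {ks : List K} (hks : ∀ k, k ∈ ks) (hnd : ks.Nodup) {Is : List (K → Bool)}
    (hIs : ∀ I, I ∈ Is) (hIs' : Is.Nodup) {rel : K → ℤ} {z : ℤ[X]}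
    (hwt : ∀ k, T.wt (κ k) = (rel k : ℤ[X]) * z) :
    (∑ I ∈ (Finset.univ.map ⟨κ, hκ⟩).powerset,
      if (T.conjNext σ).IsDescending (inclState S ∪ I) then ∏ c ∈ I, T.wt c else 0) =
    if (T.circles = 0 ∧ ∀ a, ∃ b : Option (K × Bool),
        (T.smoothedNext (inclState S)).SameCycle (b.map (Prod.map κ id)) a) then
      (Is.map fun I => (localTerm n s s.symm ks isExit I).elim 0 (fun o =>
        if ∀ c ∈ inclState S, [(c, true), (c, false)].Sublist
          (arc none ++ o.flatMap fun b => arc (some b)) then 1 else 0) *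
        ((ks.filter I).map fun k => (rel k : ℤ[X]) * z).prod).sum
    else 0 := by
  have hsum : ∀ G : (K → Bool) → ℤ[X], (Is.map G).sum = ∑ I : K → Bool, G I := by
    intro G
    rw [← List.sum_toFinset G hIs']
    congr 1
    ext I
    simp [hIs]
  rw [hsum]
  have hrhs : ∀ (A : Prop) [Decidable A] (G : (K → Bool) → ℤ[X]), (if A then ∑ I, G I else 0) =
      ∑ I, if A then G I else 0 := by
    intro A _ G
    split_ifs <;> simp
  rw [hrhs]
  symm
  -- Boolean functions on the local picture correspond to subsets of the crossings in the image of
  -- `κ`.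
  refine Finset.sum_bij (fun I _ => (Finset.univ.filter (fun k => I k = true)).map ⟨κ, hκ⟩)
    ?_ ?_ ?_ ?_
  · intro I _
    rw [Finset.mem_powerset]
    exact Finset.map_subset_map.2 (Finset.filter_subset _ _)
  · intro I _ I' _ h
    have := Finset.map_injective _ h
    funext k
    have hk := Finset.ext_iff.1 this k
    simp only [Finset.mem_filter, Finset.mem_univ, true_and] at hk
    exact Bool.eq_iff_iff.2 hk
  · intro J hJ
    rw [Finset.mem_powerset] at hJ
    refine ⟨fun k => decide (κ k ∈ J), Finset.mem_univ _, ?_⟩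
    ext c
    simp only [decide_eq_true_eq, Finset.mem_map, Finset.mem_filter, Finset.mem_univ, true_and,
      Function.Embedding.coeFn_mk]
    constructor
    · rintro ⟨k, hk, rfl⟩
      exact hk
    · intro hc
      obtain ⟨k, -, rfl⟩ := Finset.mem_map.1 (hJ hc)
      exact ⟨k, hc, rfl⟩
  · intro I _
    have key := T.conjNext_isDescending_iff hκ (E := Set.range κ) (fun c => Iff.rfl) hs hσ S harc
      hoff hexit I (ks.filter I) (by simp [hks])
    have e : (((Finset.univ.filter (fun k => I k = true)).map ⟨κ, hκ⟩ : Finset T.Crossing) :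
        Set T.Crossing) = {c | ∃ k, I k = true ∧ κ k = c} := by
      ext c
      simp
    rw [e]
    have hprod : ∏ c ∈ (Finset.univ.filter (fun k => I k = true)).map ⟨κ, hκ⟩, T.wt c =
        ((ks.filter I).map fun k => (rel k : ℤ[X]) * z).prod := by
      rw [Finset.prod_map, ← List.prod_toFinset _ (hnd.filter _)]
      refine Finset.prod_congr ?_ fun k _ => hwt k
      ext k
      simp [hks]
    rw [hprod]
    rw [ite_elim_ite_mul]
    exact if_congr key.symm rfl rfl

end TangleDiagram

/-! ### Invariance under the second and third Reidemeister moves -/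

namespace TangleDiagram

variable (T : TangleDiagram)

theorem conjNext_one_next : (T.conjNext 1).next = T.next := by
  ext1 x
  change Option.map id (T.next (Option.map id x)) = T.next x
  simp

theorem conjNext_one : T.conjNext 1 = T := TangleDiagram.mk_congr T.conjNext_one_next rfl rfl

variable {K : Type} [Fintype K] [DecidableEq K] {κ : K → T.Crossing}

/-- For a fixed outer part of the state, the outside tests a local smoothing only through its exit
order. Equality of the formal sums, for every outer connection compatible with the inner edges,
therefore gives equality of the inner state sums. -/
theorem nabla_conjNext_eq_of_balanced (hκ : Function.Injective κ)
    {σ₁ σ₂ : Equiv.Perm (Passage T.Crossing)} {s₁ s₂ : Equiv.Perm (K × Bool)}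
    (hs₁ : ∀ q, σ₁ (κ q.1, q.2) = (κ (s₁ q).1, (s₁ q).2))
    (hσ₁ : ∀ q, q.1 ∉ Set.range κ → σ₁ q = q)
    (hs₂ : ∀ q, σ₂ (κ q.1, q.2) = (κ (s₂ q).1, (s₂ q).2))
    (hσ₂ : ∀ q, q.1 ∉ Set.range κ → σ₂ q = q)
    {isExit : K × Bool → Bool}
    (hexit : ∀ b, isExit b = false → ∃ b', T.next (some (Prod.map κ id b)) =
      some (Prod.map κ id b'))
    {ks : List K} (hks : ∀ k, k ∈ ks) (hnd : ks.Nodup) {Is : List (K → Bool)}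
    (hIs : ∀ I, I ∈ Is) (hIs' : Is.Nodup) {rel : K → ℤ} {z : ℤ[X]}
    (hwt : ∀ k, T.wt (κ k) = (rel k : ℤ[X]) * z)
    (hbal : ∀ n : Equiv.Perm (Option (K × Bool)),
      (∀ b b', T.next (some (Prod.map κ id b)) = some (Prod.map κ id b') →
        n (some b) = some b') →
      balanced (localEntries n s₁ s₁.symm ks isExit rel Is)
        (localEntries n s₂ s₂.symm ks isExit rel Is) = true) :
    (T.conjNext σ₁).nabla = (T.conjNext σ₂).nabla := by
  classical
  have : Fintype {c // c ∉ Set.range κ} := Fintype.ofFinite _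
  rw [nabla_eq_sum_split (T.conjNext σ₁) (E := Set.range κ) (Finset.univ.map ⟨κ, hκ⟩) (by simp),
    nabla_eq_sum_split (T.conjNext σ₂) (E := Set.range κ) (Finset.univ.map ⟨κ, hκ⟩) (by simp)]
  refine Finset.sum_congr rfl fun S _ => ?_
  congr 1
  obtain ⟨n, arc, h₁, h₂, h₃, h₄⟩ := T.exists_localData hκ hexit (S : Set _)
  have e₁ := T.conjNext_local_sum hκ hs₁ hσ₁ (S : Set {c // c ∉ Set.range κ}) h₁ h₂ h₃ hks hnd
    hIs hIs' (rel := rel) (z := z) hwt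
  have e₂ := T.conjNext_local_sum hκ hs₂ hσ₂ (S : Set {c // c ∉ Set.range κ}) h₁ h₂ h₃ hks hnd
    hIs hIs' (rel := rel) (z := z) hwt
  refine e₁.trans (Eq.trans ?_ e₂.symm)
  rw [← localEntries_sum, ← localEntries_sum]
  refine if_congr Iff.rfl ?_ rfl
  exact balanced_sum_eq (R := ℤ[X]) (hbal n h₄) fun k => (if ∀ c ∈ inclState (S : Set {c // c ∉ Set.range κ}),
    [(c, true), (c, false)].Sublist (arc none ++ k.1.flatMap fun b => arc (some b)) then 1
      else 0) * z ^ k.2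

/-- Deleting the crossings of the picture leaves the empty local smoothing, so the contributions of
all the others must cancel. -/
theorem nabla_delete_eq_of_balanced (hκ : Function.Injective κ)
    {isExit : K × Bool → Bool}
    (hexit : ∀ b, isExit b = false → ∃ b', T.next (some (Prod.map κ id b)) =
      some (Prod.map κ id b'))
    {ks : List K} (hks : ∀ k, k ∈ ks) (hnd : ks.Nodup) {Is : List (K → Bool)}
    (hIs : ∀ I, I ∈ (fun _ => false) :: Is) (hIs' : ((fun _ => false) :: Is).Nodup)
    {rel : K → ℤ} {z : ℤ[X]} (hwt : ∀ k, T.wt (κ k) = (rel k : ℤ[X]) * z)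
    (hbal : ∀ n : Equiv.Perm (Option (K × Bool)),
      (∀ b b', T.next (some (Prod.map κ id b)) = some (Prod.map κ id b') →
        n (some b) = some b') →
      balanced (localEntries n id id ks isExit rel Is) [] = true) :
    (T.delete (Set.range κ)).nabla = T.nabla := by
  classical
  have : Fintype {c // c ∉ Set.range κ} := Fintype.ofFinite _
  rw [delete_nabla, nabla_eq_sum_split T (E := Set.range κ) (Finset.univ.map ⟨κ, hκ⟩) (by simp)]
  refine Finset.sum_congr rfl fun S _ => ?_
  congr 1
  obtain ⟨n, arc, h₁, h₂, h₃, h₄⟩ := T.exists_localData hκ hexit (S : Set _)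
  have key := T.conjNext_local_sum hκ (σ := 1) (s := 1) (fun q => rfl) (fun _ _ => rfl)
    (S : Set {c // c ∉ Set.range κ}) h₁ h₂ h₃ hks hnd hIs hIs' (rel := rel) (z := z) hwt
  have key' := T.conjNext_isDescending_iff hκ (E := Set.range κ) (σ := 1) (s := 1)
    (fun c => Iff.rfl) (fun q => rfl) (fun _ _ => rfl) (S : Set {c // c ∉ Set.range κ}) h₁ h₂ h₃
    (fun _ => false) [] (by simp)
  have e0 : (T.conjNext 1).IsDescending = T.IsDescending := by
    funext X
    unfold IsDescending IsCoherent smoothedNext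
    rw [conjNext_one_next]
  have eU : inclState (S : Set {c // c ∉ Set.range κ}) ∪
      {c | ∃ k, (fun _ : K => false) k = true ∧ κ k = c} =
      inclState (S : Set {c // c ∉ Set.range κ}) := by
    simp
  rw [e0, eU] at key'
  rw [if_congr key' rfl rfl]
  have e : (∑ I ∈ (Finset.univ.map ⟨κ, hκ⟩).powerset, if T.IsDescending
      (inclState (S : Set {c // c ∉ Set.range κ}) ∪ I) then ∏ c ∈ I, T.wt c else 0) =
      ∑ I ∈ (Finset.univ.map ⟨κ, hκ⟩).powerset, if (T.conjNext 1).IsDescending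
      (inclState (S : Set {c // c ∉ Set.range κ}) ∪ I) then ∏ c ∈ I, T.wt c else 0 := by
    rw [e0]
  refine Eq.trans ?_ (e.trans key).symm
  -- The head of the list of states is the empty smoothing; the tail is a balanced, hence vanishing,
  -- sum.
  rw [List.map_cons, List.sum_cons, ← localEntries_sum, ← ite_elim_ite_mul _ _ _ (1 : ℤ[X])]
  refine if_congr Iff.rfl ?_ rfl
  have hz := balanced_sum_eq (R := ℤ[X]) (hbal n h₄) fun k =>
    (if ∀ c ∈ inclState (S : Set {c // c ∉ Set.range κ}),
      [(c, true), (c, false)].Sublist (arc none ++ k.1.flatMap fun b => arc (some b)) then 1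
      else 0) * z ^ k.2
  refine Eq.trans ?_ (congrArg (_ + ·) hz.symm)
  simp [localTerm]

end TangleDiagram

/-! ### The finite verification for bigons and triangles -/

section Strands
variable {B : Type} [DecidableEq B] {m : ℕ}

/-- The local picture consisting of the strands from `p k` to `q k`; the strands are connected
outside of the picture by `v`. -/
def strandNext (p q : Fin m → B) (v : Option (Fin m) → Option (Fin m)) : Option B → Option B
  | none => (v none).map p
  | some b => match (List.finRange m).find? (fun k => p k == b) with
    | some k => some (q k)
    | none => match (List.finRange m).find? (fun k => q k == b) with
      | some k => (v (some k)).map p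
      | none => none

/-- The edges inside of the picture prescribe `n` at the starts `p k`. At `none` and at the ends `q
k` it can reach only `none` or a start, so finitely many `v` describe all outer connections. -/
theorem exists_eq_strandNext {p q : Fin m → B} (hp : Function.Injective p)
    (hq : Function.Injective q) (hpq : ∀ j k, p j ≠ q k) (hcov : ∀ b, ∃ k, b = p k ∨ b = q k)
    {n : Equiv.Perm (Option B)} (hn : ∀ k, n (some (p k)) = some (q k)) :
    ∃ v : Option (Fin m) → Option (Fin m), Function.Injective v ∧ ⇑n = strandNext p q v := by
  have h₁ : ∀ x : Option (Fin m), ∃ y : Option (Fin m), n (x.map q) = y.map p := by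
    intro x
    rcases h : n (x.map q) with _ | b
    · exact ⟨none, rfl⟩
    · obtain ⟨k, rfl | rfl⟩ := hcov b
      · exact ⟨some k, rfl⟩
      · rw [← hn k] at h
        rcases x with _ | j
        · exact absurd (n.injective h) (by simp)
        · exact absurd (Option.some_injective _ (n.injective h)) (hpq k j).symm
  choose v hv using h₁
  refine ⟨v, fun x y hxy => ?_, ?_⟩
  · apply Option.map_injective hq
    apply n.injective
    rw [hv, hv, hxy]
  · have hfind : ∀ {f : Fin m → B}, Function.Injective f → ∀ k,
        (List.finRange m).find? (fun j => f j == f k) = some k := by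
      intro f hf k
      rcases h : (List.finRange m).find? (fun j => f j == f k) with _ | j
      · rw [List.find?_eq_none] at h
        exact absurd (beq_self_eq_true (f k)) (h k (List.mem_finRange k))
      · have := List.find?_some h
        rw [beq_iff_eq] at this
        rw [hf this]
    have hfind' : ∀ k, (List.finRange m).find? (fun j => p j == q k) = none := by
      intro k
      rw [List.find?_eq_none]
      intro j _
      simpa using hpq j k
    funext x
    rcases x with _ | b
    · exact hv none
    · obtain ⟨k, rfl | rfl⟩ := hcov b
      · simp only [strandNext]
        rw [hfind hp, hn]
      · simp only [strandNext]
        rw [hfind', hfind hq]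
        exact hv (some k)

end Strands

/-- Select one of two values. -/
def pick {α : Type*} (t : Bool) (a b : α) : α := if t then a else b

def sgn (t : Bool) : ℤ := if t then 1 else -1

/-- The indices `0, 1, 2` stand for the crossings `x, y, w` of the third move, and the three sides
lie on the top, middle and bottom strands. Each Boolean is the direction in which a side is
traversed. -/
def triangleStart (t m b : Bool) : Fin 3 → Fin 3 × Bool :=
  ![pick t (0, true) (1, true), pick m (0, false) (2, true), pick b (1, false) (2, false)]

def triangleEnd (t m b : Bool) : Fin 3 → Fin 3 × Bool := triangleStart (!t) (!m) (!b)

def triangleSwap : Equiv.Perm (Fin 3 × Bool) :=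
  Equiv.swap (0, true) (1, true) * Equiv.swap (0, false) (2, true) *
    Equiv.swap (1, false) (2, false)

def allStates3 : List (Fin 3 → Bool) :=
  [![false, false, false], ![false, false, true], ![false, true, false], ![false, true, true],
    ![true, false, false], ![true, false, true], ![true, true, false], ![true, true, true]]

def isEndOf {B : Type} [DecidableEq B] {m : ℕ} (q : Fin m → B) (b : B) : Bool :=
  (List.finRange m).any fun k => q k == b

def outer3 (a₀ a₁ a₂ a₃ : Option (Fin 3)) : Option (Fin 3) → Option (Fin 3)
  | none => a₀
  | some 0 => a₁
  | some 1 => a₂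
  | some 2 => a₃

/-- The signs are taken relative to that of `y`; the equations between signs in the third move
determine the other two from the directions of the sides. -/
def triangleEntries (t m b : Bool) (v : Option (Fin 3) → Option (Fin 3))
    (s s' : Fin 3 × Bool → Fin 3 × Bool) : List ((List (Fin 3 × Bool) × ℕ) × ℤ) :=
  localEntries (strandNext (triangleStart t m b) (triangleEnd t m b) v) s s' [0, 1, 2]
    (isEndOf (triangleEnd t m b)) ![sgn m * sgn b, 1, sgn m * sgn t] allStates3

/-- There are 24 outer connections and 8 choices of directions. Individual states need not
correspond under the move: only the sums with a given exit order and number of smoothed crossings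
agree. -/
theorem triangle_balanced : ∀ a₀ a₁ a₂ a₃ : Option (Fin 3),
    a₀ ≠ a₁ → a₀ ≠ a₂ → a₁ ≠ a₂ → a₀ ≠ a₃ → a₁ ≠ a₃ → a₂ ≠ a₃ → ∀ t m b : Bool,
    balanced (triangleEntries t m b (outer3 a₀ a₁ a₂ a₃) ⇑(1 : Equiv.Perm (Fin 3 × Bool))
        ⇑(1 : Equiv.Perm (Fin 3 × Bool)).symm)
      (triangleEntries t m b (outer3 a₀ a₁ a₂ a₃) triangleSwap triangleSwap.symm) = true := by
  decide +kernel

def bigonStart (t m : Bool) : Fin 2 → Fin 2 × Bool :=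
  ![pick t (0, true) (1, true), pick m (0, false) (1, false)]

def bigonEnd (t m : Bool) : Fin 2 → Fin 2 × Bool := bigonStart (!t) (!m)

def outer2 (a₀ a₁ a₂ : Option (Fin 2)) : Option (Fin 2) → Option (Fin 2)
  | none => a₀
  | some 0 => a₁
  | some 1 => a₂

/-- There are 6 outer connections and 4 choices of directions. The nonempty local states cancel
because the two crossings have opposite signs. -/
theorem bigon_balanced : ∀ a₀ a₁ a₂ : Option (Fin 2), a₀ ≠ a₁ → a₀ ≠ a₂ → a₁ ≠ a₂ →
    ∀ t m : Bool,
    balanced (localEntries (strandNext (bigonStart t m) (bigonEnd t m) (outer2 a₀ a₁ a₂)) id id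
      [0, 1] (isEndOf (bigonEnd t m)) ![1, -1]
      [![false, true], ![true, false], ![true, true]]) [] = true := by
  decide +kernel

theorem outer3_eq (v : Option (Fin 3) → Option (Fin 3)) :
    v = outer3 (v none) (v (some 0)) (v (some 1)) (v (some 2)) := by
  funext x
  rcases x with _ | k
  · rfl
  · fin_cases k <;> rfl

theorem outer2_eq (v : Option (Fin 2) → Option (Fin 2)) :
    v = outer2 (v none) (v (some 0)) (v (some 1)) := by
  funext x
  rcases x with _ | k
  · rfl
  · fin_cases k <;> rfl

namespace TangleDiagram

variable (T : TangleDiagram)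

theorem isEndOf_self {B : Type} [DecidableEq B] {m : ℕ} (q : Fin m → B) (k : Fin m) :
    isEndOf q (q k) = true :=
  List.any_eq_true.2 ⟨k, List.mem_finRange k, beq_self_eq_true _⟩

theorem nabla_triangle {x y w : T.Crossing} (hxy : x ≠ y) (hxw : x ≠ w) (hyw : y ≠ w)
    {σ : Equiv.Perm (Passage T.Crossing)}
    (hσ : ∀ q, q.1 ≠ x → q.1 ≠ y → q.1 ≠ w → σ q = q)
    (hσ' : ∀ q, σ (![x, y, w] q.1, q.2) =
      (![x, y, w] (triangleSwap q).1, (triangleSwap q).2))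
    (t m b : Bool)
    (htop : T.next (some (pick t (x, true) (y, true))) = some (pick (!t) (x, true) (y, true)))
    (hmiddle : T.next (some (pick m (x, false) (w, true))) =
      some (pick (!m) (x, false) (w, true)))
    (hbottom : T.next (some (pick b (y, false) (w, false))) =
      some (pick (!b) (y, false) (w, false)))
    (h₁ : (T.sign x : ℤ) = sgn m * sgn b * T.sign y)
    (h₂ : (T.sign w : ℤ) = sgn m * sgn t * T.sign y) :
    (T.conjNext σ).nabla = T.nabla := by
  have hκ : Function.Injective ![x, y, w] := by
    intro i j
    fin_cases i <;> fin_cases j <;> simp [hxy, hxw, hyw, hxy.symm, hxw.symm, hyw.symm]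
  have hstart : ∀ k, T.next (some (Prod.map ![x, y, w] id (triangleStart t m b k))) =
      some (Prod.map ![x, y, w] id (triangleEnd t m b k)) := by
    intro k
    fin_cases k
    · cases t <;> exact htop
    · cases m <;> exact hmiddle
    · cases b <;> exact hbottom
  have hcov : ∀ q, ∃ k, q = triangleStart t m b k ∨ q = triangleEnd t m b k := by
    clear * -
    revert t m b
    decide
  have hoff : ∀ q : Passage T.Crossing, q.1 ∉ Set.range ![x, y, w] → σ q = q := by
    intro q hq
    exact hσ q (fun h => hq ⟨0, h.symm⟩) (fun h => hq ⟨1, h.symm⟩) (fun h => hq ⟨2, h.symm⟩)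
  have := T.nabla_conjNext_eq_of_balanced hκ (σ₁ := 1) (s₁ := 1) (fun q => rfl)
    (fun _ _ => rfl) hσ' hoff (isExit := isEndOf (triangleEnd t m b)) (ks := [0, 1, 2])
    (Is := allStates3) (rel := ![sgn m * sgn b, 1, sgn m * sgn t]) (z := T.wt y) ?_
    (by decide) (by decide) (by decide) (by decide) ?_ ?_
  · rw [← this]
    exact congrArg TangleDiagram.nabla T.conjNext_one
  · intro q hq
    obtain ⟨k, rfl | rfl⟩ := hcov q
    · exact ⟨_, hstart k⟩
    · rw [isEndOf_self] at hq
      exact absurd hq (by simp)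
  · intro k
    fin_cases k
    · simp only [wt, Fin.zero_eta, Matrix.cons_val_zero, h₁, eq_intCast]
      push_cast
      ring
    · simp [wt]
    · change C (T.sign w : ℤ) * X = ((sgn m * sgn t : ℤ) : ℤ[X]) * (C (T.sign y : ℤ) * X)
      rw [h₂]
      simp only [eq_intCast]
      push_cast
      ring
  · intro n hn
    obtain ⟨v, hv, hv'⟩ := exists_eq_strandNext (p := triangleStart t m b)
      (q := triangleEnd t m b) (by clear * -; revert t m b; decide) (by clear * -; revert t m b; decide)
      (by clear * -; revert t m b; decide) hcov (fun k => hn _ _ (hstart k))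
    rw [hv', outer3_eq v]
    exact triangle_balanced _ _ _ _ (hv.ne (by decide)) (hv.ne (by decide)) (hv.ne (by decide))
      (hv.ne (by decide)) (hv.ne (by decide)) (hv.ne (by decide)) t m b

theorem nabla_bigon {a b : T.Crossing} (hab : a ≠ b) (hsign : T.sign a = -T.sign b)
    (t m : Bool)
    (hover : T.next (some (pick t (a, true) (b, true))) = some (pick (!t) (a, true) (b, true)))
    (hunder : T.next (some (pick m (a, false) (b, false))) =
      some (pick (!m) (a, false) (b, false))) :
    (T.delete {a, b}).nabla = T.nabla := by
  have hκ : Function.Injective ![a, b] := by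
    intro i j
    fin_cases i <;> fin_cases j <;> simp [hab, hab.symm]
  have hstart : ∀ k, T.next (some (Prod.map ![a, b] id (bigonStart t m k))) =
      some (Prod.map ![a, b] id (bigonEnd t m k)) := by
    intro k
    fin_cases k
    · cases t <;> exact hover
    · cases m <;> exact hunder
  have hcov : ∀ q, ∃ k, q = bigonStart t m k ∨ q = bigonEnd t m k := by
    clear hover hunder hstart
    revert t m
    decide
  have hrange : Set.range ![a, b] = {a, b} := by
    ext c
    simp [eq_comm, or_comm]
  rw [← hrange]
  refine T.nabla_delete_eq_of_balanced hκ (isExit := isEndOf (bigonEnd t m)) (ks := [0, 1])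
    (Is := [![false, true], ![true, false], ![true, true]]) (rel := ![1, -1]) (z := T.wt a) ?_
    (by decide) (by decide) (by decide) (by decide) ?_ ?_
  · intro q hq
    obtain ⟨k, rfl | rfl⟩ := hcov q
    · exact ⟨_, hstart k⟩
    · rw [isEndOf_self] at hq
      exact absurd hq (by simp)
  · intro k
    fin_cases k
    · simp [wt]
    · simp [wt, hsign]
  · intro n hn
    obtain ⟨v, hv, hv'⟩ := exists_eq_strandNext (p := bigonStart t m)
      (q := bigonEnd t m) (by clear * -; revert t m; decide) (by clear * -; revert t m; decide)
      (by clear * -; revert t m; decide) hcov (fun k => hn _ _ (hstart k))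
    rw [hv', outer2_eq v]
    exact bigon_balanced _ _ _ (hv.ne (by decide)) (hv.ne (by decide)) (hv.ne (by decide)) t m

end TangleDiagram

/-! ### Planarity and potentials -/

section Potentials
variable {H : Type}

/-- Every flow modulo `2` on the edges of the surface described by `α` and `ρ` is the difference
of a function on the faces. -/
def Exact (α ρ : Equiv.Perm H) : Prop :=
  ∀ ω : H → ZMod 2, (∀ h, ω (α h) = ω h) →
    (∀ h, ω h + ω (ρ h) + ω (ρ (ρ h)) + ω (ρ (ρ (ρ h))) = 0) →
    ∃ d : H → ZMod 2, (∀ h, d (ρ (α h)) = d h) ∧ ∀ h, d h + d (ρ h) = ω h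

/-- The functions which are constant on the classes of `r`. -/
def classFunctions (r : Setoid H) : Submodule (ZMod 2) (H → ZMod 2) where
  carrier := {d | ∀ a b, r a b → d a = d b}
  add_mem' := by
    intro d e hd he a b hab
    rw [Pi.add_apply, Pi.add_apply, hd a b hab, he a b hab]
  zero_mem' := fun _ _ _ => rfl
  smul_mem' := by
    intro c d hd a b hab
    rw [Pi.smul_apply, Pi.smul_apply, hd a b hab]

theorem finrank_classFunctions [Finite H] (r : Setoid H) :
    Module.finrank (ZMod 2) (classFunctions r) = Nat.card (Quotient r) := by
  have : Fintype (Quotient r) := Fintype.ofFinite _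
  have e : (Quotient r → ZMod 2) ≃ₗ[ZMod 2] classFunctions r :=
    { toFun := fun d => ⟨fun h => d (Quotient.mk r h),
        fun a b hab => congrArg d (Quotient.sound hab)⟩
      invFun := fun d q => Quotient.lift d.1 d.2 q
      map_add' := fun _ _ => rfl
      map_smul' := fun _ _ => rfl
      left_inv := by
        intro d
        funext q
        induction q using Quotient.inductionOn
        rfl
      right_inv := fun d => rfl }
  rw [← e.finrank_eq, Module.finrank_fintype_fun_eq_card, Nat.card_eq_fintype_card]

theorem mem_classFunctions_sameCycle {f : Equiv.Perm H} {d : H → ZMod 2} :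
    d ∈ classFunctions (Equiv.Perm.SameCycle.setoid f) ↔ ∀ h, d (f h) = d h := by
  constructor
  · intro hd h
    exact (hd h (f h) ⟨1, by simp⟩).symm
  · rintro hd a b ⟨k, rfl⟩
    have h₁ : ∀ n : ℕ, ∀ a, d ((f ^ n) a) = d a := by
      intro n
      induction n with
      | zero => simp
      | succ n ih =>
        intro a
        rw [pow_succ, Equiv.Perm.mul_apply, ih, hd]
    obtain ⟨n, rfl | rfl⟩ := k.eq_nat_or_neg
    · rw [zpow_natCast, h₁]
    · have := h₁ n ((f ^ (-(n : ℤ))) a)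
      rw [← this, zpow_neg, zpow_natCast]
      simp

theorem mem_classFunctions_orbit {α ρ : Equiv.Perm H} {d : H → ZMod 2} :
    d ∈ classFunctions (MulAction.orbitRel
      (Subgroup.closure ({ρ, α} : Set (Equiv.Perm H))) H) ↔
      (∀ h, d (α h) = d h) ∧ ∀ h, d (ρ h) = d h := by
  have key : ∀ f ∈ ({ρ, α} : Set (Equiv.Perm H)), d ∈ classFunctions (MulAction.orbitRel
      (Subgroup.closure ({ρ, α} : Set (Equiv.Perm H))) H) → ∀ h, d (f h) = d h := by
    intro f hf hd h
    exact hd (f h) h ⟨⟨f, Subgroup.subset_closure hf⟩, rfl⟩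
  constructor
  · exact fun hd => ⟨key α (by simp) hd, key ρ (by simp) hd⟩
  · rintro ⟨h₁, h₂⟩ a b ⟨⟨g, hg⟩, rfl⟩
    change d (g b) = d b
    induction hg using Subgroup.closure_induction generalizing b with
    | mem f hf =>
      rcases hf with rfl | rfl
      · exact h₂ b
      · exact h₁ b
    | one => rfl
    | mul f g _ _ hf hg => rw [Equiv.Perm.mul_apply, hf, hg]
    | inv f _ hf =>
      have := hf (f⁻¹ b)
      rw [← Equiv.Perm.mul_apply, mul_inv_cancel] at this
      exact this.symm

/-- Flows form the orthogonal complement of the sum of the functions constant on edges and those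
constant on vertices; these two spaces meet in the functions constant on pieces. Differences of face
functions are flows, and the kernel of the difference map again consists of the functions constant
on pieces. All flows are differences exactly when the dimensions agree, which is Euler's formula. -/
theorem exact_iff [Fintype H] {α ρ : Equiv.Perm H} (hα : ∀ h, α (α h) = h) (hα' : ∀ h, α h ≠ h)
    (hρ : ∀ h, ρ (ρ (ρ (ρ h))) = h) 
    (hsum : ∀ f : H → ZMod 2, (∀ h, f h + f (ρ h) + f (ρ (ρ h)) + f (ρ (ρ (ρ h))) = 0) →
      ∑ h, f h = 0) :
    Exact α ρ ↔ numCycles (ρ * α) + numCycles α + numCycles ρ = Nat.card H +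
      2 * Nat.card (MulAction.orbitRel.Quotient
        (Subgroup.closure ({ρ, α} : Set (Equiv.Perm H))) H) := by
  classical
  set Wα := classFunctions (Equiv.Perm.SameCycle.setoid α) with hWα
  set Wρ := classFunctions (Equiv.Perm.SameCycle.setoid ρ) with hWρ
  set Wφ := classFunctions (Equiv.Perm.SameCycle.setoid (ρ * α)) with hWφ
  set Wo := classFunctions (MulAction.orbitRel
      (Subgroup.closure ({ρ, α} : Set (Equiv.Perm H))) H) with hWo
  have h2 : ∀ a b : ZMod 2, a + b = 0 ↔ b = a := by decide
  have hinf : Wα ⊓ Wρ = Wo := by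
    ext d
    rw [Submodule.mem_inf, mem_classFunctions_sameCycle, mem_classFunctions_sameCycle,
      mem_classFunctions_orbit]
  have hcα : Module.finrank (ZMod 2) Wα = numCycles α := finrank_classFunctions _
  have hcρ : Module.finrank (ZMod 2) Wρ = numCycles ρ := finrank_classFunctions _
  have hcφ : Module.finrank (ZMod 2) Wφ = numCycles (ρ * α) := finrank_classFunctions _
  have hco : Module.finrank (ZMod 2) Wo = _ := finrank_classFunctions _
  have hsup := Submodule.finrank_sup_add_finrank_inf_eq Wα Wρ
  rw [hinf] at hsup
  set B : LinearMap.BilinForm (ZMod 2) (H → ZMod 2) := Matrix.toBilin' 1 with hB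
  have hBapp : ∀ x y, B x y = ∑ h, x h * y h := by
    intro x y
    rw [hB, Matrix.toBilin'_apply', Matrix.one_mulVec]
    rfl
  have hnd : B.Nondegenerate :=
    LinearMap.BilinForm.nondegenerate_toBilin'_of_det_ne_zero' 1 (by simp)
  have horth := LinearMap.BilinForm.finrank_orthogonal hnd (Wα ⊔ Wρ)
  have hle : Module.finrank (ZMod 2) (Wα ⊔ Wρ : Submodule (ZMod 2) (H → ZMod 2)) ≤
      Module.finrank (ZMod 2) (H → ZMod 2) := Submodule.finrank_le _
  have hcard : Module.finrank (ZMod 2) (H → ZMod 2) = Nat.card H := by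
    rw [Module.finrank_fintype_fun_eq_card, Nat.card_eq_fintype_card]
  -- flows
  have hflow : ∀ ω, ω ∈ B.orthogonal (Wα ⊔ Wρ) ↔ (∀ h, ω (α h) = ω h) ∧
      ∀ h, ω h + ω (ρ h) + ω (ρ (ρ h)) + ω (ρ (ρ (ρ h))) = 0 := by
    intro ω
    rw [LinearMap.BilinForm.mem_orthogonal_iff]
    constructor
    · intro hω
      constructor
      · intro h
        have hm : (Pi.single h 1 + Pi.single (α h) 1 : H → ZMod 2) ∈ Wα := by
          rw [mem_classFunctions_sameCycle]
          intro k
          have e₁ : (α k = h) = (k = α h) := by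
            refine propext ⟨fun e => by rw [← e, hα], fun e => by rw [e, hα]⟩
          have e₂ : (α k = α h) = (k = h) := propext α.injective.eq_iff
          simp only [Pi.add_apply, Pi.single_apply, e₁, e₂]
          ring
        have := hω _ (Submodule.mem_sup_left hm)
        rw [hBapp] at this
        simp only [Pi.add_apply, add_mul, Finset.sum_add_distrib, Pi.single_apply, ite_mul,
          one_mul, zero_mul, Finset.sum_ite_eq', Finset.mem_univ, if_true] at this
        exact (h2 _ _).1 this
      · intro h
        have hm : (Pi.single h 1 + Pi.single (ρ h) 1 + Pi.single (ρ (ρ h)) 1 +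
            Pi.single (ρ (ρ (ρ h))) 1 : H → ZMod 2) ∈ Wρ := by
          rw [mem_classFunctions_sameCycle]
          intro k
          have e₁ : (ρ k = h) = (k = ρ (ρ (ρ h))) :=
            propext ⟨fun e => by rw [← e, hρ], fun e => by rw [e, hρ]⟩
          have e₂ : ∀ l, (ρ k = ρ l) = (k = l) := fun l => propext ρ.injective.eq_iff
          simp only [Pi.add_apply, Pi.single_apply, e₁, e₂]
          ring
        have := hω _ (Submodule.mem_sup_right hm)
        rw [hBapp] at this
        simpa only [Pi.add_apply, add_mul, Finset.sum_add_distrib, Pi.single_apply, ite_mul,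
          one_mul, zero_mul, Finset.sum_ite_eq', Finset.mem_univ, if_true] using this
    · rintro ⟨hω₁, hω₂⟩ x hx
      obtain ⟨y, hy, z, hz, rfl⟩ := Submodule.mem_sup.1 hx
      rw [mem_classFunctions_sameCycle] at hy hz
      rw [map_add, LinearMap.add_apply, hBapp, hBapp]
      have h₁ : ∑ h, y h * ω h = 0 := by
        refine Finset.sum_involution (fun h _ => α h) ?_ (fun h _ _ => hα' h)
          (fun h _ => Finset.mem_univ _) (fun h _ => hα h)
        intro h _
        rw [hy, hω₁, ← two_mul]
        exact (by decide : ∀ a : ZMod 2, 2 * a = 0) _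
      have h₂ : ∑ h, z h * ω h = 0 := by
        refine hsum _ fun h => ?_
        rw [hz (ρ (ρ h)), hz (ρ h), hz h, ← mul_add, ← mul_add, ← mul_add, hω₂, mul_zero]
      rw [h₁, h₂, add_zero]
  -- coboundaries
  set δ : (H → ZMod 2) →ₗ[ZMod 2] (H → ZMod 2) := LinearMap.id + LinearMap.funLeft _ _ ρ with hδ
  have hδapp : ∀ d h, δ d h = d h + d (ρ h) := fun d h => rfl
  have hWφ' : ∀ d, d ∈ Wφ ↔ ∀ h, d (ρ (α h)) = d h := fun d => mem_classFunctions_sameCycle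
  -- A face function with vanishing differences is constant around vertices, and then, by face
  -- invariance, also along edges.
  have hker : Module.finrank (ZMod 2) (δ.domRestrict Wφ).ker = Module.finrank (ZMod 2) Wo := by
    rw [LinearMap.ker_domRestrict, ← Submodule.finrank_map_subtype_eq]
    have hm : Submodule.map Wφ.subtype (Submodule.comap Wφ.subtype δ.ker) = Wo := by
      rw [Submodule.map_comap_subtype]
      ext d
      rw [Submodule.mem_inf, hWφ', mem_classFunctions_orbit, LinearMap.mem_ker]
      have h₀ : δ d = 0 ↔ ∀ h, d (ρ h) = d h :=
        ⟨fun e h => (h2 _ _).1 (congrFun e h), fun e => funext fun h => (h2 _ _).2 (e h)⟩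
      rw [h₀]
      refine and_congr_left fun e => forall_congr' fun h => ?_
      rw [e]
    rw [hm]
  have hrange : (δ.domRestrict Wφ).range ≤ B.orthogonal (Wα ⊔ Wρ) := by
    rintro _ ⟨⟨d, hd⟩, rfl⟩
    rw [hWφ'] at hd
    rw [hflow]
    have hd' : ∀ h, d (α h) = d (ρ h) := fun h => by rw [← hd (α h), hα]
    refine ⟨fun h => ?_, fun h => ?_⟩
    · change d (α h) + d (ρ (α h)) = d h + d (ρ h)
      rw [hd, hd', add_comm]
    · change d h + d (ρ h) + (d (ρ h) + d (ρ (ρ h))) + (d (ρ (ρ h)) + d (ρ (ρ (ρ h)))) +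
        (d (ρ (ρ (ρ h))) + d (ρ (ρ (ρ (ρ h))))) = 0
      rw [hρ]
      exact (by decide : ∀ a b c e : ZMod 2, a + b + (b + c) + (c + e) + (e + a) = 0) _ _ _ _
  have hex : Exact α ρ ↔ (δ.domRestrict Wφ).range = B.orthogonal (Wα ⊔ Wρ) := by
    constructor
    · intro h
      refine le_antisymm hrange fun ω hω => ?_
      obtain ⟨h₁, h₂⟩ := (hflow ω).1 hω
      obtain ⟨d, hd, hd'⟩ := h ω h₁ h₂
      exact ⟨⟨d, (hWφ' d).2 hd⟩, funext hd'⟩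
    · intro h ω h₁ h₂
      have hω := (hflow ω).2 ⟨h₁, h₂⟩
      rw [← h] at hω
      obtain ⟨⟨d, hd⟩, rfl⟩ := hω
      exact ⟨d, (hWφ' d).1 hd, fun _ => rfl⟩
  have hrk := LinearMap.finrank_range_add_finrank_ker (δ.domRestrict Wφ)
  have hrle := Submodule.finrank_mono hrange
  rw [hex]
  have hiff : (δ.domRestrict Wφ).range = B.orthogonal (Wα ⊔ Wρ) ↔
      Module.finrank (ZMod 2) (δ.domRestrict Wφ).range =
        Module.finrank (ZMod 2) (B.orthogonal (Wα ⊔ Wρ)) :=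
    ⟨fun h => by rw [h], fun h => Submodule.eq_of_le_of_finrank_eq hrange h⟩
  rw [hiff]
  have hco' : Module.finrank (ZMod 2) Wo = Nat.card (MulAction.orbitRel.Quotient
        (Subgroup.closure ({ρ, α} : Set (Equiv.Perm H))) H) := hco
  omega

end Potentials

namespace LinkDiagram

variable (L : LinkDiagram)

theorem acrossEdge_true (q : Passage L.Crossing) :
    L.acrossEdge (q, true) = (L.next q, false) := rfl

theorem acrossEdge_false (q : Passage L.Crossing) :
    L.acrossEdge (q, false) = (L.next.symm q, true) := rfl

theorem acrossEdge_acrossEdge (h : L.HalfEdge) : L.acrossEdge (L.acrossEdge h) = h := by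
  obtain ⟨q, _ | _⟩ := h
  · rw [acrossEdge_false, acrossEdge_true, Equiv.apply_symm_apply]
  · rw [acrossEdge_true, acrossEdge_false, Equiv.symm_apply_apply]

theorem acrossEdge_ne (h : L.HalfEdge) : L.acrossEdge h ≠ h := by
  obtain ⟨q, _ | _⟩ := h
  · exact fun e => Bool.noConfusion (congrArg Prod.snd e)
  · exact fun e => Bool.noConfusion (congrArg Prod.snd e)

theorem rotate_apply (c : L.Crossing) (b o : Bool) : L.rotate ((c, b), o) =
    ((c, !b), if L.sign c = 1 then xor o (!b) else xor o b) := rfl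

theorem rotate_pow_two (h : L.HalfEdge) : L.rotate (L.rotate h) = (h.1, !h.2) := by
  obtain ⟨⟨c, b⟩, o⟩ := h
  simp only [rotate_apply, Bool.not_not]
  by_cases h : L.sign c = 1 <;> cases b <;> cases o <;> simp [h]

theorem rotate_pow_four (h : L.HalfEdge) :
    L.rotate (L.rotate (L.rotate (L.rotate h))) = h := by
  rw [rotate_pow_two, rotate_pow_two, Bool.not_not]

theorem numCycles_eq_card {X Y : Type} {f : Equiv.Perm X} (g : X → Y)
    (hg : Function.Surjective g) (h₁ : ∀ x, g (f x) = g x)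
    (h₂ : ∀ x y, g x = g y → f.SameCycle x y) : numCycles f = Nat.card Y := by
  refine Nat.card_congr (Equiv.ofBijective (Quotient.lift g ?_) ⟨?_, ?_⟩)
  · rintro a b ⟨k, rfl⟩
    have h : ∀ n : ℕ, ∀ x, g ((f ^ n) x) = g x := by
      intro n
      induction n with
      | zero => simp
      | succ n ih =>
        intro x
        rw [pow_succ, Equiv.Perm.mul_apply, ih, h₁]
    obtain ⟨n, rfl | rfl⟩ := k.eq_nat_or_neg
    · rw [zpow_natCast, h]
    · have := h n ((f ^ (-(n : ℤ))) a)
      rw [← this, zpow_neg, zpow_natCast]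
      simp
  · intro a b
    induction a, b using Quotient.inductionOn₂ with
    | h a b => exact fun h => Quotient.sound (h₂ a b h)
  · intro y
    obtain ⟨x, rfl⟩ := hg y
    exact ⟨Quotient.mk _ x, rfl⟩

theorem numCycles_rotate : numCycles L.rotate = Nat.card L.Crossing := by
  refine numCycles_eq_card (fun h => h.1.1) (fun c => ⟨((c, true), true), rfl⟩) (fun _ => rfl) ?_
  rintro ⟨⟨c, b⟩, o⟩ ⟨⟨c', b'⟩, o'⟩ (rfl : c = c')
  have key : ∀ h : L.HalfEdge, L.rotate.SameCycle h (L.rotate h) := fun h => ⟨1, by simp⟩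
  have key₂ : ∀ h : L.HalfEdge, L.rotate.SameCycle h (h.1, !h.2) := fun h => by
    rw [← rotate_pow_two]
    exact (key h).trans (key _)
  have key₃ : ∀ h : L.HalfEdge, ∀ o, L.rotate.SameCycle h (h.1, o) := by
    rintro ⟨q, o⟩ o'
    by_cases e : o' = o
    · rw [e]
    · have := key₂ (q, o)
      rwa [show (!o) = o' by cases o <;> cases o' <;> simp_all] at this
  have key₄ : ∀ b', L.rotate.SameCycle ((c, b), o) ((c, b'), o') := by
    intro b'
    by_cases e : b' = b
    · rw [e]
      exact key₃ ((c, b), o) o'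
    · have h₁ := (key ((c, b), o)).trans (key₃ _ o')
      rwa [rotate_apply, show (!b) = b' by cases b <;> cases b' <;> simp_all] at h₁
  exact key₄ b'

theorem numCycles_acrossEdge : numCycles L.acrossEdge = Nat.card (Passage L.Crossing) := by
  refine numCycles_eq_card (fun h => if h.2 then h.1 else L.next.symm h.1)
    (fun q => ⟨(q, true), rfl⟩) ?_ ?_
  · rintro ⟨q, _ | _⟩
    · rfl
    · exact L.next.symm_apply_apply q
  · have key : ∀ h : L.HalfEdge, L.acrossEdge.SameCycle h (L.acrossEdge h) :=
      fun h => ⟨1, by simp⟩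
    rintro ⟨q, _ | _⟩ ⟨q', _ | _⟩ h
    · rw [show q = q' from L.next.symm.injective h]
    · have h' : L.next.symm q = q' := h
      rw [← h']
      exact key (q, false)
    · have h' : q = L.next.symm q' := h
      rw [h']
      exact (key (q', false)).symm
    · have h' : q = q' := h
      rw [h']

theorem sum_halfEdge_eq_zero [Fintype L.HalfEdge] (f : L.HalfEdge → ZMod 2)
    (hf : ∀ h, f h + f (L.rotate h) + f (L.rotate (L.rotate h)) +
      f (L.rotate (L.rotate (L.rotate h))) = 0) : ∑ h, f h = 0 := by
  classical
  have : Fintype L.Crossing := Fintype.ofFinite _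
  have e : ∑ h, f h = ∑ c : L.Crossing, ∑ b : Bool, ∑ o : Bool, f ((c, b), o) := by
    rw [← Fintype.sum_prod_type', ← Fintype.sum_prod_type']
    convert rfl
  rw [e]
  refine Finset.sum_eq_zero fun c _ => ?_
  have := hf ((c, true), true)
  simp only [rotate_apply] at this
  simp only [Fintype.sum_bool]
  by_cases h : L.sign c = 1
  · simp only [h, if_true, Bool.not_true, Bool.not_false, Bool.xor_false, Bool.xor_true] at this
    linear_combination this
  · simp only [h, if_false, Bool.not_true, Bool.xor_true, Bool.not_false, Bool.xor_false] at this
    linear_combination this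

/-- With `V` crossings there are `4V` half-edges, `2V` edges and `V` vertices, which turns the count
of `exact_iff` into the definition of planarity. -/
theorem isPlanar_iff_exact : L.IsPlanar ↔ Exact L.acrossEdge L.rotate := by
  have : Fintype L.HalfEdge := Fintype.ofFinite _
  rw [exact_iff L.acrossEdge_acrossEdge L.acrossEdge_ne L.rotate_pow_four L.sum_halfEdge_eq_zero,
    numCycles_rotate, numCycles_acrossEdge, IsPlanar, numFaces, numPieces]
  simp only [Nat.card_prod, Nat.card_eq_fintype_card (α := Bool), Fintype.card_bool]
  omega

end LinkDiagram

/-! ### Smoothing and deleting crossings of planar diagrams -/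

section Extend
variable {X Y A : Type}

theorem IsErase.apply_symm_eq {f : Equiv.Perm X} {g : Equiv.Perm Y} {j : Y → X}
    (h : IsErase f g j) {G : X → A} (hG : ∀ x, x ∉ Set.range j → G x = G (f.symm x)) (y : Y) :
    G (f.symm (j y)) = G (j (g.symm y)) := by
  have key : ∀ (l : List X) (x w : X), Path f x l w → (∀ a ∈ l, a ∉ Set.range j) →
      G (f.symm w) = G x := by
    intro l
    induction l with
    | nil =>
      intro x w (hw : f x = w) _
      rw [← hw, Equiv.symm_apply_apply]
    | cons a l ih =>
      intro x w hw hl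
      have hx : f x = a := hw.1
      rw [ih a w hw.2 fun b hb => hl b (by simp [hb]), hG a (hl a (by simp)), ← hx,
        Equiv.symm_apply_apply]
  obtain ⟨l, hl, hl'⟩ := h (g.symm y)
  rw [Equiv.apply_symm_apply] at hl
  exact key l _ _ hl hl'

/-- Each point receives the value at the last kept point before it. Cycles without kept points
receive the default value; there the choice is free, because only constancy along the cycle is
required. -/
theorem exists_extend [Inhabited A] (f : Equiv.Perm X) {j : Y → X} (hj : Function.Injective j)
    (g : Y → A) :
    ∃ G : X → A, (∀ y, G (j y) = g y) ∧ ∀ x, x ∉ Set.range j → G x = G (f.symm x) := by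
  classical
  let p : X → Prop := fun x => ∃ k : ℕ, f.symm^[k] x ∈ Set.range j
  let G : X → A := fun x => if h : p x then g (Nat.find_spec h).choose else default
  refine ⟨G, fun y => ?_, fun x hx => ?_⟩
  · have h : p (j y) := ⟨0, y, rfl⟩
    have h₀ : Nat.find h = 0 := (Nat.find_eq_zero h).2 ⟨y, rfl⟩
    change (if h : p (j y) then _ else _) = _
    rw [dif_pos h]
    congr 1
    apply hj
    have := (Nat.find_spec h).choose_spec
    rw [this, h₀]
    rfl
  · have hiff : p x ↔ p (f.symm x) := by
      constructor
      · rintro ⟨_ | k, hk⟩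
        · exact absurd hk hx
        · exact ⟨k, hk⟩
      · rintro ⟨k, hk⟩
        exact ⟨k + 1, hk⟩
    by_cases h : p x
    · have h' := hiff.1 h
      have e : Nat.find h = Nat.find h' + 1 := Nat.find_comp_succ h h' hx
      change (if h : p x then _ else _) = (if h : p (f.symm x) then _ else _)
      rw [dif_pos h, dif_pos h']
      congr 1
      apply hj
      rw [(Nat.find_spec h).choose_spec, (Nat.find_spec h').choose_spec, e]
      rfl
    · change (if h : p x then _ else _) = (if h : p (f.symm x) then _ else _)
      rw [dif_neg h, dif_neg fun h' => h (hiff.2 h')]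

end Extend

namespace LinkDiagram

variable (L : LinkDiagram)

/-- Delete the crossings in `S`; the strands are followed by means of `N`. -/
abbrev eraseWith (N : Equiv.Perm (Passage L.Crossing)) (S : Set L.Crossing) (k : ℕ) :
    LinkDiagram where
  Crossing := {c : L.Crossing // c ∉ S}
  finite := inferInstance
  next := erasePassages N S
  sign c := L.sign c.1
  circles := k

theorem sum_crossing_eq_zero_iff (ω : L.HalfEdge → ZMod 2) (h : L.HalfEdge) :
    ω h + ω (L.rotate h) + ω (L.rotate (L.rotate h)) + ω (L.rotate (L.rotate (L.rotate h))) = 0 ↔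
      ω ((h.1.1, true), true) + ω ((h.1.1, true), false) + ω ((h.1.1, false), true) +
        ω ((h.1.1, false), false) = 0 := by
  obtain ⟨⟨c, b⟩, o⟩ := h
  simp only [rotate_apply]
  refine Eq.congr ?_ rfl
  by_cases h : L.sign c = 1 <;> cases b <;> cases o <;> simp [h] <;> ring

/-- The labels on the two sides of the edge leaving the passage `q`. -/
def sides (d : L.HalfEdge → ZMod 2) (q : Passage L.Crossing) : ZMod 2 × ZMod 2 :=
  (d (q, true), d (L.rotate (q, true)))

theorem sides_symm {d : L.HalfEdge → ZMod 2} (hd : ∀ h, d (L.rotate (L.acrossEdge h)) = d h)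
    (q : Passage L.Crossing) :
    L.sides d (L.next.symm q) = (d (L.rotate (q, false)), d (q, false)) := by
  refine Prod.ext ?_ ?_
  · change d (L.next.symm q, true) = _
    rw [← hd, acrossEdge_true, Equiv.apply_symm_apply]
  · change d (L.rotate (L.next.symm q, true)) = _
    rw [← acrossEdge_false, hd]

/-- A flow on the smaller diagram is extended along the erased strands to a flow on `L`, where it
has a potential `d`. For `d` to descend to the faces of the smaller diagram, the labels on both
sides of a new edge must agree at its two ends. `D` supplies a way of propagating these pairs of
labels along the erased strands. -/
theorem exact_eraseWith (hL : Exact L.acrossEdge L.rotate)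
    {u : Equiv.Perm (Passage L.Crossing)} {S : Set L.Crossing} (k : ℕ)
    (hu : ∀ q, q.1 ∉ S → u q = q) (hu' : ∀ q, (u q).1 = q.1)
    (hD : ∀ ω d : L.HalfEdge → ZMod 2, (∀ h, ω (L.acrossEdge h) = ω h) →
      (∀ h, d (L.rotate (L.acrossEdge h)) = d h) → (∀ h, d h + d (L.rotate h) = ω h) →
      (∀ q, q.1 ∈ S → ω (q, false) = ω (u q, true)) →
      ∃ D : Passage L.Crossing → ZMod 2 × ZMod 2,
        (∀ q, q.1 ∉ S → D q = L.sides d q ∧ D (L.next.symm q) = L.sides d (L.next.symm q)) ∧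
        ∀ q, q.1 ∈ S → D (u q) = D (L.next.symm q)) :
    Exact (L.eraseWith (L.next * u) S k).acrossEdge (L.eraseWith (L.next * u) S k).rotate := by
  classical
  set L' := L.eraseWith (L.next * u) S k with hL'
  intro ω' h₁ h₂
  set j : Passage {c // c ∉ S} → Passage L.Crossing := inclPassage S with hj
  have hjinj : Function.Injective j := inclPassage_injective S
  have hrange : ∀ q, q ∉ Set.range j ↔ q.1 ∈ S := by
    intro q
    rw [hj, mem_range_inclPassage, not_not]
  have her : IsErase (L.next * u) L'.next j := erasePassages_isErase _ _
  have hsymm : ∀ q, (L.next * u).symm q = u.symm (L.next.symm q) := fun q => rfl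
  -- The flow on an erased edge is its value at the last kept passage of the same strand.
  obtain ⟨g, hg, hg'⟩ := exists_extend (L.next * u) hjinj fun q => ω' (q, true)
  set ω : L.HalfEdge → ZMod 2 := fun h =>
    if h.2 then g (u.symm h.1) else g (u.symm (L.next.symm h.1)) with hω
  have hωt : ∀ q, ω (q, true) = g (u.symm q) := fun q => rfl
  have hωf : ∀ q, ω (q, false) = g (u.symm (L.next.symm q)) := fun q => rfl
  have hωα : ∀ h, ω (L.acrossEdge h) = ω h := by
    rintro ⟨q, _ | _⟩
    · rw [acrossEdge_false, hωt, hωf]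
    · rw [acrossEdge_true, hωt, hωf, Equiv.symm_apply_apply]
  have hus : ∀ q, q.1 ∉ S → u.symm q = q := fun q hq => by
    rw [Equiv.symm_apply_eq, hu q hq]
  have hωS : ∀ q, q.1 ∈ S → ω (q, false) = ω (u q, true) := by
    intro q hq
    rw [hωt, hωf, Equiv.symm_apply_apply, hg' q ((hrange q).2 hq), hsymm]
  have hωj : ∀ q o, ω (j q, o) = ω' (q, o) := by
    rintro q (_ | _)
    · rw [hωf, ← hsymm, her.apply_symm_eq hg', hg, ← L'.acrossEdge_false, h₁]
    · rw [hωt, hus _ q.1.2, hg]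
  have hωρ : ∀ h, ω h + ω (L.rotate h) + ω (L.rotate (L.rotate h)) +
      ω (L.rotate (L.rotate (L.rotate h))) = 0 := by
    rintro ⟨⟨c, b⟩, o⟩
    rw [sum_crossing_eq_zero_iff]
    by_cases hc : c ∈ S
    · change ω ((c, true), true) + ω ((c, true), false) + ω ((c, false), true) +
        ω ((c, false), false) = 0
      rw [hωS (c, true) hc, hωS (c, false) hc]
      have e : ∀ b, u (c, b) = (c, (u (c, b)).2) := fun b => Prod.ext (hu' _) rfl
      have hne : (u (c, true)).2 ≠ (u (c, false)).2 := by
        intro h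
        have : u (c, true) = u (c, false) := by rw [e true, e false, h]
        exact absurd (u.injective this) (by simp)
      rw [e true, e false]
      cases h₁ : (u (c, true)).2 <;> cases h₂ : (u (c, false)).2
      · exact absurd (h₁.trans h₂.symm) hne
      · exact (by decide : ∀ a b : ZMod 2, a + b + b + a = 0) _ _
      · exact (by decide : ∀ a b : ZMod 2, a + a + b + b = 0) _ _
      · exact absurd (h₁.trans h₂.symm) hne
    · have := (L'.sum_crossing_eq_zero_iff ω' (((⟨c, hc⟩, b), o))).1 (h₂ _)
      rw [← hωj, ← hωj, ← hωj, ← hωj] at this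
      exact this
  obtain ⟨d, hd, hd'⟩ := hL ω hωα hωρ
  obtain ⟨D, hD₁, hD₂⟩ := hD ω d hωα hd hd' hωS
  have hkey : ∀ q : Passage {c // c ∉ S},
      L.sides d (L.next.symm (j q)) = L.sides d (j (L'.next.symm q)) := by
    intro q
    have := her.apply_symm_eq (G := fun x => D (u x)) (fun x hx => by
      rw [hsymm, Equiv.apply_symm_apply]
      exact hD₂ x ((hrange x).1 hx)) q
    simp only [hsymm, Equiv.apply_symm_apply] at this
    rw [(hD₁ (j q) q.1.2).2, hu (j (L'.next.symm q)) (L'.next.symm q).1.2,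
      (hD₁ (j (L'.next.symm q)) (L'.next.symm q).1.2).1] at this
    exact this
  have hrot : ∀ h : L'.HalfEdge, L.rotate (j h.1, h.2) =
      (j (L'.rotate h).1, (L'.rotate h).2) := fun h => rfl
  refine ⟨fun h => d (j h.1, h.2), fun h => ?_, fun h => ?_⟩
  · change d (j (L'.rotate (L'.acrossEdge h)).1, (L'.rotate (L'.acrossEdge h)).2) = _
    rw [← hrot]
    obtain ⟨q, _ | _⟩ := h
    · have := hkey q
      rw [L.sides_symm hd] at this
      exact (congrArg Prod.snd this).symm
    · have := hkey (L'.next q)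
      rw [L.sides_symm hd, Equiv.symm_apply_apply] at this
      exact congrArg Prod.fst this
  · change _ + d (j (L'.rotate h).1, (L'.rotate h).2) = _
    rw [← hrot, hd', hωj]

/-- Going straight through a crossing means going across the other strand, so both side labels
change by the flow along that strand. -/
theorem sides_eq_add {ω d : L.HalfEdge → ZMod 2} 
    (hd : ∀ h, d (L.rotate (L.acrossEdge h)) = d h) (hd' : ∀ h, d h + d (L.rotate h) = ω h)
    {c : L.Crossing} (hω : ∀ b, ω ((c, b), false) = ω ((c, b), true)) (b : Bool) :
    L.sides d (c, b) = L.sides d (L.next.symm (c, b)) + (ω ((c, !b), true), ω ((c, !b), true)) := by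
  rw [L.sides_symm hd]
  have h₀ := hd' ((c, b), true)
  have h₁ := hd' ((c, b), false)
  have h₂ := hd' ((c, !b), true)
  have h₃ := hd' ((c, !b), false)
  rw [hω] at h₁ h₃
  simp only [rotate_apply, Bool.not_not] at h₀ h₁ h₂ h₃
  unfold sides
  simp only [rotate_apply]
  refine Prod.ext ?_ ?_
  all_goals
    simp only [Prod.fst_add, Prod.snd_add]
    by_cases h : L.sign c = 1 <;> cases b <;>
    simp only [h, if_true, if_false, Bool.not_true, Bool.not_false, Bool.xor_false,
      Bool.xor_true] at h₀ h₁ h₂ h₃ ⊢ <;>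
    generalize ω ((c, true), true) = x at * <;> generalize ω ((c, false), true) = y at * <;>
    grind

/-- The incoming and outgoing edges joined by the smoothing bound a common corner and carry the same
flow, so the labels agree on their other side too. -/
theorem isPlanar_smooth (hL : L.IsPlanar) (c : L.Crossing) : (L.smooth c).IsPlanar := by
  rw [isPlanar_iff_exact] at hL ⊢
  refine L.exact_eraseWith hL _ (fun q hq => flipAt_of_notMem hq) (fun q => flipAt_fst _ q) ?_
  intro ω d hω hd hd' hS
  refine ⟨L.sides d, fun q _ => ⟨rfl, rfl⟩, ?_⟩
  rintro ⟨c', b⟩ (rfl : c' = c)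
  rw [L.sides_symm hd, flipAt_of_mem (S := {c'}) (q := (c', b)) rfl]
  have h₀ := hd' ((c', b), true)
  have h₁ := hd' ((c', b), false)
  have h₂ := hd' ((c', !b), true)
  have h₃ := hd' ((c', !b), false)
  have h₄ := hS (c', b) rfl
  rw [flipAt_of_mem (S := {c'}) (q := (c', b)) rfl] at h₄
  change ω ((c', b), false) = ω ((c', !b), true) at h₄
  rw [h₄] at h₁
  change (d ((c', !b), true), d (L.rotate ((c', !b), true))) = _
  simp only [rotate_apply, Bool.not_not] at h₀ h₁ h₂ h₃ ⊢
  refine Prod.ext ?_ ?_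
  all_goals
    simp only
    by_cases h : L.sign c' = 1 <;> cases b <;>
    simp only [h, if_true, if_false, Bool.not_true, Bool.not_false, Bool.xor_false,
      Bool.xor_true] at h₀ h₁ h₂ h₃ ⊢ <;>
    grind

/-- `F` consists of the passages followed by an inner edge of the removed picture. A strand through
it goes straight through two crossings in succession, crossing strands with equal flow, and the two
changes of the side labels cancel modulo 2. -/
theorem exact_delete (hL : Exact L.acrossEdge L.rotate) {S : Set L.Crossing}
    (F : Set (Passage L.Crossing)) (hF : ∀ q ∈ F, L.next.symm q ∉ F)
    (hF' : ∀ q ∈ F, q.1 ∈ S ∧ (L.next q).1 ∈ S)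
    (hS : ∀ q : Passage L.Crossing, q.1 ∈ S → q ∈ F ∨ L.next.symm q ∈ F)
    (hD : ∀ ω : L.HalfEdge → ZMod 2, (∀ h, ω (L.acrossEdge h) = ω h) →
      (∀ q : Passage L.Crossing, q.1 ∈ S → ω (q, false) = ω (q, true)) → ∀ q ∈ F,
      ω ((q.1, !q.2), true) = ω (((L.next q).1, !(L.next q).2), true)) :
    Exact (L.delete S).acrossEdge (L.delete S).rotate := by
  classical
  refine L.exact_eraseWith hL (u := 1) _ (fun _ _ => rfl) (fun _ => rfl) ?_
  intro ω d hω hd hd' hS'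
  refine ⟨fun q => if q ∈ F then L.sides d (L.next.symm q) else L.sides d q, fun q hq => ⟨?_, ?_⟩,
    fun q hq => ?_⟩
  · exact if_neg fun h => hq (hF' q h).1
  · exact if_neg fun h => hq (by simpa using (hF' _ h).2)
  · change (if q ∈ F then L.sides d (L.next.symm q) else L.sides d q) =
      if L.next.symm q ∈ F then _ else _
    by_cases hqF : q ∈ F
    · rw [if_pos hqF, if_neg (hF q hqF)]
    · have hf := (hS q hq).resolve_left hqF
      rw [if_neg hqF, if_pos hf]
      have h₁ := L.sides_eq_add hd hd' (c := q.1) (fun b => hS' (q.1, b) hq) q.2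
      have h₂ := L.sides_eq_add hd hd' (c := (L.next.symm q).1)
        (fun b => hS' (_, b) (hF' _ hf).1) (L.next.symm q).2
      have h₃ := hD ω hω hS' _ hf
      rw [Equiv.apply_symm_apply] at h₃
      rw [h₃] at h₂
      change L.sides d q = L.sides d (L.next.symm q) + _ at h₁
      change L.sides d (L.next.symm q) = L.sides d (L.next.symm (L.next.symm q)) + _ at h₂
      rw [h₁, h₂]
      generalize ω ((q.1, !q.2), true) = x
      refine Prod.ext ?_ ?_
      · exact (by decide : ∀ a b : ZMod 2, a + b + b = a) _ _
      · exact (by decide : ∀ a b : ZMod 2, a + b + b = a) _ _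

theorem isPlanar_delete_kink (hL : L.IsPlanar) {c : L.Crossing} {b : Bool}
    (h : L.next (c, b) = (c, !b)) : (L.delete {c}).IsPlanar := by
  rw [isPlanar_iff_exact] at hL ⊢
  -- The only inner edge is the loop. At both crossings with itself the strand crosses an edge
  -- carrying the flow of the loop.
  refine L.exact_delete hL {(c, b)} ?_ ?_ ?_ ?_
  · rintro _ rfl h'
    have h' : L.next.symm (c, b) = (c, b) := h'
    rw [Equiv.symm_apply_eq, h] at h'
    simp at h'
  · rintro _ rfl
    rw [h]
    exact ⟨rfl, rfl⟩
  · rintro ⟨c', b'⟩ (rfl : c' = c)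
    by_cases e : b' = b
    · exact Or.inl (by rw [e]; rfl)
    · right
      change L.next.symm (c', b') = (c', b)
      rw [Equiv.symm_apply_eq, h]
      cases b <;> cases b' <;> simp_all
  · rintro ω hω hS _ rfl
    rw [h]
    have h₁ := hω ((c, b), true)
    rw [acrossEdge_true, h, hS (c, !b) rfl] at h₁
    simpa using h₁

theorem isPlanar_delete_bigon (hL : L.IsPlanar) {a b : L.Crossing} (hab : a ≠ b)
    (hover : L.next (a, true) = (b, true))
    (hunder : L.next (a, false) = (b, false) ∨ L.next (b, false) = (a, false)) :
    (L.delete {a, b}).IsPlanar := by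
  rw [isPlanar_iff_exact] at hL ⊢
  have key : ∀ x y : L.Crossing, x ≠ y → (L.next (x, false) = (y, false)) →
      (x = a ∨ x = b) → (y = a ∨ y = b) →
      Exact (L.delete {a, b}).acrossEdge (L.delete {a, b}).rotate := by
    intro x y hxy hun hx hy
    have hset : ∀ c, (c = a ∨ c = b) → c = x ∨ c = y := by
      rcases hx with rfl | rfl <;> rcases hy with rfl | rfl <;> simp_all [or_comm]
    refine L.exact_delete hL {(a, true), (x, false)} ?_ ?_ ?_ ?_
    · rintro _ (rfl | rfl) (h' | h')
      · rw [Equiv.symm_apply_eq, hover] at h'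
        exact hab (congrArg Prod.fst h')
      · have h' : L.next.symm (a, true) = (x, false) := h'
        rw [Equiv.symm_apply_eq, hun] at h'
        simp at h'
      · rw [Equiv.symm_apply_eq, hover] at h'
        simp at h'
      · have h' : L.next.symm (x, false) = (x, false) := h'
        rw [Equiv.symm_apply_eq, hun] at h'
        exact hxy (congrArg Prod.fst h')
    · rintro _ (rfl | rfl)
      · rw [hover]
        exact ⟨Or.inl rfl, Or.inr rfl⟩
      · rw [hun]
        exact ⟨hx, hy⟩
    · rintro ⟨c, _ | _⟩ hc
      · rcases hset c hc with rfl | rfl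
        · exact Or.inl (Or.inr rfl)
        · refine Or.inr (Or.inr ?_)
          change L.next.symm (c, false) = (x, false)
          rw [Equiv.symm_apply_eq, hun]
      · rcases hc with hc | hc
        · exact Or.inl (Or.inl (by rw [show c = a from hc]))
        · refine Or.inr (Or.inl ?_)
          rw [Equiv.symm_apply_eq, hover, show c = b from hc]
    · have hst : ∀ ω : L.HalfEdge → ZMod 2, (∀ h, ω (L.acrossEdge h) = ω h) →
          (∀ q : Passage L.Crossing, q.1 ∈ ({a, b} : Set L.Crossing) →
            ω (q, false) = ω (q, true)) →
          ω ((a, true), true) = ω ((b, true), true) ∧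
            ω ((x, false), true) = ω ((y, false), true) := by
        intro ω hω hS
        constructor
        · rw [← hω ((a, true), true), acrossEdge_true, hover, hS (b, true) (Or.inr rfl)]
        · rw [← hω ((x, false), true), acrossEdge_true, hun, hS (y, false) hy]
      rintro ω hω hS _ (rfl | rfl)
      · rw [hover]
        obtain ⟨-, h⟩ := hst ω hω hS
        change ω ((a, false), true) = ω ((b, false), true)
        rcases hset a (Or.inl rfl) with rfl | rfl <;> rcases hset b (Or.inr rfl) with rfl | rfl
        · rfl
        · exact h
        · exact h.symm
        · rfl
      · rw [hun]
        obtain ⟨h, -⟩ := hst ω hω hS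
        change ω ((x, true), true) = ω ((y, true), true)
        rcases hx with rfl | rfl <;> rcases hy with rfl | rfl
        · rfl
        · exact h
        · exact h.symm
        · rfl
  rcases hunder with h | h
  · exact key a b hab h (Or.inl rfl) (Or.inr rfl)
  · exact key b a hab.symm h (Or.inr rfl) (Or.inl rfl)

/-- The half-edges at the other passage of `c` are exchanged. -/
def flipHalfEdge (S : Set L.Crossing) : Equiv.Perm L.HalfEdge :=
  (flipAt S).prodCongr (Equiv.refl Bool)

theorem changeCrossing_acrossEdge (c : L.Crossing) (h : L.HalfEdge) :
    (L.changeCrossing c).acrossEdge (L.flipHalfEdge {c} h) =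
      L.flipHalfEdge {c} (L.acrossEdge h) := by
  have hff : ∀ q, flipAt {c} (flipAt {c} q) = q := fun q => by
    rw [← Equiv.Perm.mul_apply, flipAt_mul_self, Equiv.Perm.one_apply]
  obtain ⟨q, _ | _⟩ := h
  · change (((flipAt {c} * L.next * flipAt {c}).symm (flipAt {c} q), true) : L.HalfEdge) = _
    refine Prod.ext ?_ rfl
    rw [Equiv.symm_apply_eq]
    change _ = flipAt {c} (L.next (flipAt {c} (flipAt {c} (L.next.symm q))))
    rw [hff, Equiv.apply_symm_apply]
  · change ((flipAt {c} (L.next (flipAt {c} (flipAt {c} q))), false) : L.HalfEdge) = _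
    rw [hff]
    rfl

theorem changeCrossing_rotate (c : L.Crossing) (h : L.HalfEdge) :
    (L.changeCrossing c).rotate (L.flipHalfEdge {c} h) = L.flipHalfEdge {c} (L.rotate h) := by
  obtain ⟨⟨x, b⟩, o⟩ := h
  by_cases hx : x = c
  · subst hx
    have e : ∀ b o, L.flipHalfEdge {x} ((x, b), o) = ((x, !b), o) := by
      intro b o
      exact Prod.ext (flipAt_of_mem (S := {x}) (q := (x, b)) rfl) rfl
    rw [e, rotate_apply, e]
    refine Prod.ext rfl ?_
    have hs : (L.changeCrossing x).sign x = -L.sign x := by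
      simp [changeCrossing]
    change (if (L.changeCrossing x).sign x = 1 then _ else _) = _
    rw [hs]
    rcases Int.units_eq_one_or (L.sign x) with h | h <;> simp [h]
  · have e : ∀ b o, L.flipHalfEdge {c} ((x, b), o) = ((x, b), o) := by
      intro b o
      exact Prod.ext (flipAt_of_notMem (S := {c}) (q := (x, b)) hx) rfl
    rw [e, rotate_apply, e]
    refine Prod.ext rfl ?_
    have hs : (L.changeCrossing c).sign x = L.sign x := by
      classical
      exact Function.update_of_ne hx _ _
    change (if (L.changeCrossing c).sign x = 1 then _ else _) = _
    rw [hs]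

end LinkDiagram

theorem Exact.conj {H H' : Type} {α ρ : Equiv.Perm H} {α' ρ' : Equiv.Perm H'} (h : Exact α ρ)
    (e : H ≃ H') (hα : ∀ x, α' (e x) = e (α x)) (hρ : ∀ x, ρ' (e x) = e (ρ x)) :
    Exact α' ρ' := by
  intro ω h₁ h₂
  obtain ⟨d, hd, hd'⟩ := h (fun x => ω (e x)) (fun x => by rw [← hα, h₁])
    (fun x => by
    have := h₂ (e x)
    rwa [hρ, hρ, hρ] at this)
  have hρ' : ∀ y, e.symm (ρ' y) = ρ (e.symm y) := fun y => by
    rw [Equiv.symm_apply_eq, ← hρ, Equiv.apply_symm_apply]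
  have hα' : ∀ y, e.symm (α' y) = α (e.symm y) := fun y => by
    rw [Equiv.symm_apply_eq, ← hα, Equiv.apply_symm_apply]
  refine ⟨fun y => d (e.symm y), fun y => ?_, fun y => ?_⟩
  · change d (e.symm (ρ' (α' y))) = _
    rw [hρ', hα', hd]
  · change _ + d (e.symm (ρ' y)) = _
    rw [hρ', hd', Equiv.apply_symm_apply]

theorem LinkDiagram.isPlanar_changeCrossing {L : LinkDiagram} (hL : L.IsPlanar)
    (c : L.Crossing) : (L.changeCrossing c).IsPlanar := by
  rw [isPlanar_iff_exact] at hL ⊢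
  exact hL.conj (L.flipHalfEdge {c}) (L.changeCrossing_acrossEdge c) (L.changeCrossing_rotate c)

/-! ### Moving a strand across a triangle -/

/-- The surface described by `α'` and `ρ` arises from that described by `α` and `ρ` by moving one
side of a triangle across the opposite vertex; `P i r` are the half-edges at the vertices of the
triangle, with the triangle between `P i 3` and `P i 0`. -/
structure IsTriangleFlip {H : Type} (α ρ α' σ : Equiv.Perm H) (P : Fin 3 → Fin 4 → H) : Prop where
  inj : ∀ {i r j s}, P i r = P j s → i = j ∧ r = s
  rot : ∀ i r, ρ (P i r) = P i (r + 1)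
  invol : ∀ h, α (α h) = h
  edge : ∀ i, α (P i 0) = P (i + 1) 3
  swap_zero : ∀ i, σ (P i 0) = P (i + 1) 1
  swap_one : ∀ i, σ (P (i + 1) 1) = P i 0
  swap_two : ∀ i, σ (P i 2) = P (i + 1) 3
  swap_three : ∀ i, σ (P (i + 1) 3) = P i 2
  fix : ∀ h, (∀ i r, P i r ≠ h) → σ h = h
  conj : ∀ h, α' (σ h) = σ (α h)

theorem fin_three_add (i : Fin 3) : i + 2 + 1 = i := by
  revert i; decide

theorem fin_three_one_add_two (i : Fin 3) : i + 1 + 2 = i := by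
  revert i; decide

theorem fin_three_one_add_one (i : Fin 3) : i + 1 + 1 = i + 2 := by
  revert i; decide

namespace IsTriangleFlip

variable {H : Type} {α ρ α' σ : Equiv.Perm H} {P : Fin 3 → Fin 4 → H}

theorem cases_on (P : Fin 3 → Fin 4 → H) (h : H) :
    (∃ i, h = P i 0) ∨ (∃ i, h = P (i + 1) 1) ∨ (∃ i, h = P i 2) ∨ (∃ i, h = P (i + 1) 3) ∨
      ∀ i r, P i r ≠ h := by
  by_cases hh : ∃ i r, P i r = h
  · obtain ⟨i, r, rfl⟩ := hh
    fin_cases r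
    · exact Or.inl ⟨i, rfl⟩
    · exact Or.inr (Or.inl ⟨i + 2, by rw [fin_three_add]; rfl⟩)
    · exact Or.inr (Or.inr (Or.inl ⟨i, rfl⟩))
    · exact Or.inr (Or.inr (Or.inr (Or.inl ⟨i + 2, by rw [fin_three_add]; rfl⟩)))
  · push Not at hh
    exact Or.inr (Or.inr (Or.inr (Or.inr hh)))

variable (F : IsTriangleFlip α ρ α' σ P)
include F

theorem edge' (i : Fin 3) : α (P (i + 1) 3) = P i 0 := by
  rw [← F.edge, F.invol]

theorem swap_swap (h : H) : σ (σ h) = h := by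
  rcases cases_on P h with ⟨i, rfl⟩ | ⟨i, rfl⟩ | ⟨i, rfl⟩ | ⟨i, rfl⟩ | hh
  · rw [F.swap_zero, F.swap_one]
  · rw [F.swap_one, F.swap_zero]
  · rw [F.swap_two, F.swap_three]
  · rw [F.swap_three, F.swap_two]
  · rw [F.fix h hh, F.fix h hh]

/-- After the flip the triangle occupies the vertical angles at its three vertices, which shifts the
numbering of the half-edges by two. -/
theorem symm : IsTriangleFlip α' ρ α σ (fun i r => P i (r + 2)) where
  inj h := by
    obtain ⟨h₁, h₂⟩ := F.inj h
    exact ⟨h₁, by simpa using h₂⟩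
  rot i r := by rw [F.rot, add_right_comm]
  invol h := by
    rw [← F.swap_swap h, F.conj, F.conj, F.invol]
  edge i := by
    change α' (P i 2) = P (i + 1) 1
    rw [← F.swap_three, F.conj, F.edge', F.swap_zero]
  swap_zero i := F.swap_two i
  swap_one i := F.swap_three i
  swap_two i := F.swap_zero i
  swap_three i := F.swap_one i
  fix h hh := F.fix h fun i r e => hh i (r + 2) (by
    rw [← e]
    exact congrArg (P i) ((by decide : ∀ r : Fin 4, r + 2 + 2 = r) r))
  conj h := by
    have := F.conj (σ h)
    rw [F.swap_swap] at this
    rw [this, F.swap_swap]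

omit F in
/-- Transport a function on the faces; the new triangle is sent to `t`. -/
def flipped {A : Type} (P : Fin 3 → Fin 4 → H) (f : H → A) (t : A) : H → A :=
  Function.extend (fun p : Fin 3 × Fin 4 => P p.1 p.2)
    (fun p => ![f (P (p.1 + 1) 1), f (P (p.1 + 1) 2), t, f (P (p.1 + 2) 2)] p.2) f

variable {A : Type} {f : H → A} {t : A}

theorem flipped_P (i : Fin 3) (r : Fin 4) : flipped P f t (P i r) =
    ![f (P (i + 1) 1), f (P (i + 1) 2), t, f (P (i + 2) 2)] r := by
  have hinj : Function.Injective fun p : Fin 3 × Fin 4 => P p.1 p.2 := fun p q h =>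
    Prod.ext (F.inj h).1 (F.inj h).2
  exact hinj.extend_apply _ _ (i, r)

omit F in
theorem flipped_off {h : H} (hh : ∀ i r, P i r ≠ h) : flipped P f t h = f h :=
  Function.extend_apply' _ _ _ fun ⟨p, hp⟩ => hh p.1 p.2 hp

theorem rot_off {h : H} (hh : ∀ i r, P i r ≠ h) (i : Fin 3) (r : Fin 4) : P i r ≠ ρ h := by
  intro e
  refine hh i (r - 1) (ρ.injective ?_)
  rw [F.rot, sub_add_cancel, e]

theorem apply_three (hf : ∀ h, f (ρ (α h)) = f h) (i : Fin 3) : f (P (i + 1) 3) = f (P i 1) := by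
  rw [← hf, F.edge', F.rot]
  rfl

/-- Outside of the triangle, the faces on both sides of an edge do not change. -/
theorem flipped_swap (hf : ∀ h, f (ρ (α h)) = f h) {h : H} (h₀ : ∀ i, h ≠ P i 0)
    (h₃ : ∀ i, h ≠ P i 3) :
    flipped P f t (σ h) = f h ∧ flipped P f t (ρ (σ h)) = f (ρ h) := by
  rcases cases_on P h with ⟨i, rfl⟩ | ⟨i, rfl⟩ | ⟨i, rfl⟩ | ⟨i, rfl⟩ | hh
  · exact absurd rfl (h₀ i)
  · rw [F.swap_one, F.rot, F.rot, F.flipped_P, F.flipped_P]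
    exact ⟨rfl, rfl⟩
  · rw [F.swap_two, F.rot, F.rot, F.flipped_P, F.flipped_P]
    have e₁ : i + 1 + 2 = i := fin_three_one_add_two i
    have e₂ := F.apply_three hf (i + 2)
    rw [fin_three_add] at e₂
    rw [e₁, fin_three_one_add_one]
    exact ⟨rfl, e₂.symm⟩
  · exact absurd rfl (h₃ (i + 1))
  · rw [F.fix h hh]
    exact ⟨flipped_off hh, flipped_off (F.rot_off hh)⟩

theorem inner_iff (h : H) : ((∃ i, h = P i 0) ∨ ∃ i, h = P i 3) ↔
    ((∃ i, α h = P i 0) ∨ ∃ i, α h = P i 3) := by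
  have key : ∀ h, ((∃ i, h = P i 0) ∨ ∃ i, h = P i 3) →
      ((∃ i, α h = P i 0) ∨ ∃ i, α h = P i 3) := by
    rintro _ (⟨i, rfl⟩ | ⟨i, rfl⟩)
    · exact Or.inr ⟨i + 1, F.edge i⟩
    · refine Or.inl ⟨i + 2, ?_⟩
      rw [← F.edge', fin_three_add]
  refine ⟨key h, fun hh => ?_⟩
  have := key _ hh
  rwa [F.invol] at this

theorem flipped_face (hf : ∀ h, f (ρ (α h)) = f h) (h : H) :
    flipped P f t (ρ (α' h)) = flipped P f t h := by
  rw [← F.swap_swap h, F.conj]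
  generalize σ h = k
  by_cases hk : (∃ i, k = P i 0) ∨ ∃ i, k = P i 3
  · rcases hk with ⟨i, rfl⟩ | ⟨i, rfl⟩
    · rw [F.edge, F.swap_three, F.rot, F.swap_zero, F.flipped_P, F.flipped_P,
        fin_three_one_add_one]
      rfl
    · obtain ⟨j, rfl⟩ : ∃ j, i = j + 1 := ⟨i + 2, (fin_three_add i).symm⟩
      rw [F.edge', F.swap_zero, F.swap_three, F.rot, F.flipped_P, F.flipped_P]
      rfl
  · have hk' := hk
    rw [F.inner_iff] at hk'
    push Not at hk hk'
    rw [(F.flipped_swap hf hk.1 hk.2).1, (F.flipped_swap hf hk'.1 hk'.2).2, hf]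

/-- A function on the faces of the new surface arises from the old one. -/
theorem exists_eq_flipped {g : H → A} (hg : ∀ h, g (ρ (α' h)) = g h) :
    ∃ f, (∀ h, f (ρ (α h)) = f h) ∧ g = flipped P f (g (P 0 2)) := by
  have hg3 : ∀ i, g (P (i + 1) 1) = g (P i 3) := F.symm.apply_three hg
  have hg2 : ∀ i, g (P (i + 1) 2) = g (P i 2) := by
    intro i
    have := hg (P i 2)
    rw [show α' (P i 2) = P (i + 1) 1 from F.symm.edge i, F.rot] at this
    exact this
  refine ⟨flipped (fun i r => P i (r + 2)) g (g (P 0 2)), F.symm.flipped_face hg, funext fun h => ?_⟩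
  have hP : ∀ i r, flipped (fun i r => P i (r + 2)) g (g (P 0 2)) (P i (r + 2)) =
    ![g (P (i + 1) 3), g (P (i + 1) 0), g (P 0 2), g (P (i + 2) 0)] r := F.symm.flipped_P
  by_cases hh : ∃ i r, P i r = h
  · obtain ⟨i, r, rfl⟩ := hh
    rw [F.flipped_P]
    fin_cases r
    · refine Eq.trans ?_ (hP (i + 1) 3).symm
      change g (P i 0) = g (P (i + 1 + 2) 0)
      rw [fin_three_one_add_two]
    · refine Eq.trans ?_ (hP (i + 1) 0).symm
      change g (P i 1) = g (P (i + 1 + 1) 3)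
      rw [← hg3, (by decide : ∀ i : Fin 3, i + 1 + 1 + 1 = i) i]
    · change g (P i 2) = g (P 0 2)
      fin_cases i
      · rfl
      · exact hg2 0
      · exact (hg2 1).trans (hg2 0)
    · refine Eq.trans ?_ (hP (i + 2) 0).symm
      change g (P i 3) = g (P (i + 2 + 1) 3)
      rw [fin_three_add]
  · push Not at hh
    rw [flipped_off hh, flipped_off fun i r => hh i (r + 2)]

/-- A flow on the new surface is transferred to the old one, where it has a potential. That
potential is transported back, with a suitable value on the new triangle. -/
theorem exact (hL : Exact α ρ) : Exact α' ρ := by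
  intro ω' hω' hω'ρ
  -- Away from the sides of the triangle the flow is carried over by `σ`. The values `x` on the
  -- sides are chosen so that the flow is conserved at the three vertices.
  set x : Fin 3 → ZMod 2 := fun i => ω' (P i 2) + ω' (P i 0) + ω' (P (i + 1) 3) with hx
  set ω : H → ZMod 2 := Function.extend (fun p : Fin 3 × Fin 4 => P p.1 p.2)
    (fun p => ![x p.1, ω' (P (p.1 + 2) 0), ω' (P (p.1 + 1) 3), x (p.1 + 2)] p.2) ω' with hω
  have hP : ∀ i r, ω (P i r) = ![x i, ω' (P (i + 2) 0), ω' (P (i + 1) 3), x (i + 2)] r := by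
    intro i r
    have hinj : Function.Injective fun p : Fin 3 × Fin 4 => P p.1 p.2 := fun p q h =>
      Prod.ext (F.inj h).1 (F.inj h).2
    exact hinj.extend_apply _ _ (i, r)
  have hoff : ∀ h, (∀ i r, P i r ≠ h) → ω h = ω' h := fun h hh =>
    Function.extend_apply' _ _ _ fun ⟨p, hp⟩ => hh p.1 p.2 hp
  have hsw : ∀ h, (∀ i, h ≠ P i 0) → (∀ i, h ≠ P i 3) → ω h = ω' (σ h) := by
    intro h h₀ h₃
    rcases cases_on P h with ⟨i, rfl⟩ | ⟨i, rfl⟩ | ⟨i, rfl⟩ | ⟨i, rfl⟩ | hh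
    · exact absurd rfl (h₀ i)
    · rw [F.swap_one, hP]
      change ω' (P (i + 1 + 2) 0) = _
      rw [fin_three_one_add_two]
    · rw [F.swap_two, hP]
      rfl
    · exact absurd rfl (h₃ (i + 1))
    · rw [F.fix h hh, hoff h hh]
  have hy : ∀ i, ω' (P (i + 1) 1) = ω' (P i 2) := fun i => by
    rw [← hω' (P i 2), show α' (P i 2) = P (i + 1) 1 from F.symm.edge i]
  have hωα : ∀ h, ω (α h) = ω h := by
    intro h
    by_cases hk : (∃ i, h = P i 0) ∨ ∃ i, h = P i 3
    · rcases hk with ⟨i, rfl⟩ | ⟨i, rfl⟩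
      · rw [F.edge, hP, hP]
        change x (i + 1 + 2) = x i
        rw [fin_three_one_add_two]
      · obtain ⟨j, rfl⟩ : ∃ j, i = j + 1 := ⟨i + 2, (fin_three_add i).symm⟩
        rw [F.edge', hP, hP]
        change x j = x (j + 1 + 2)
        rw [fin_three_one_add_two]
    · have hk' := hk
      rw [F.inner_iff] at hk'
      push Not at hk hk'
      rw [hsw _ hk.1 hk.2, hsw _ hk'.1 hk'.2, ← F.conj, hω']
  have hfl : ∀ i, ω (P i 0) + ω (P i 1) + ω (P i 2) + ω (P i 3) = 0 := by
    intro i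
    rw [hP, hP, hP, hP]
    change x i + ω' (P (i + 2) 0) + ω' (P (i + 1) 3) + x (i + 2) = 0
    have h₀ := hω'ρ (P i 0)
    rw [F.rot, F.rot, F.rot] at h₀
    change ω' (P i 0) + ω' (P i 1) + ω' (P i 2) + ω' (P i 3) = 0 at h₀
    have h₁ := hy (i + 2)
    rw [fin_three_add] at h₁
    simp only [hx]
    rw [fin_three_add]
    rw [h₁] at h₀
    have h2 : (2 : ZMod 2) = 0 := rfl
    linear_combination h₀ + (ω' (P (i + 2) 0) + ω' (P (i + 1) 3)) * h2
  have hωρ : ∀ h, ω h + ω (ρ h) + ω (ρ (ρ h)) + ω (ρ (ρ (ρ h))) = 0 := by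
    intro h
    by_cases hh : ∃ i r, P i r = h
    · obtain ⟨i, r, rfl⟩ := hh
      rw [F.rot, F.rot, F.rot, ← hfl i]
      fin_cases r
      · rfl
      · change ω (P i 1) + ω (P i 2) + ω (P i 3) + ω (P i 0) = _
        ring
      · change ω (P i 2) + ω (P i 3) + ω (P i 0) + ω (P i 1) = _
        ring
      · change ω (P i 3) + ω (P i 0) + ω (P i 1) + ω (P i 2) = _
        ring
    · push Not at hh
      have h₁ := F.rot_off hh
      have h₂ := F.rot_off h₁
      have h₃ := F.rot_off h₂
      rw [hoff _ hh, hoff _ h₁, hoff _ h₂, hoff _ h₃, hω'ρ]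
  obtain ⟨d, hd, hd'⟩ := hL ω hωα hωρ
  have hN : ∀ i, d (P (i + 1) 3) = d (P i 1) := F.apply_three hd
  have hN' : ∀ i, d (P i 3) = d (P (i + 2) 1) := fun i => by
    have := hN (i + 2)
    rwa [fin_three_add] at this
  have hT : ∀ i, d (P (i + 1) 0) = d (P i 0) := by
    intro i
    have := hd (P i 0)
    rw [F.edge, F.rot] at this
    exact this
  have hT₀ : ∀ i, d (P i 0) = d (P 0 0) := by
    intro i
    fin_cases i
    · rfl
    · exact hT 0
    · exact (hT 1).trans (hT 0)
  -- The three sides of the new triangle each prescribe its label. The formula is symmetric under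
  -- rotation of the triangle, so all three conditions reduce to one computation.
  set t : ZMod 2 := d (P 0 0) + (d (P 0 1) + d (P 1 1) + d (P 2 1)) +
    (d (P 0 2) + d (P 1 2) + d (P 2 2)) with ht
  have hcyc : ∀ (a : Fin 3 → ZMod 2) (i : Fin 3), a i + a (i + 1) + a (i + 2) = a 0 + a 1 + a 2 := by
    intro a i
    fin_cases i
    · rfl
    · change a 1 + a 2 + a 0 = _
      ring
    · change a 2 + a 0 + a 1 = _
      ring
  have hty : ∀ i, t + d (P (i + 2) 2) = ω' (P i 2) := by
    intro i
    have h₀ := hd' (P i 0)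
    have h₁ := hd' (P (i + 1) 1)
    have h₂ := hd' (P i 2)
    rw [F.rot, hP] at h₀ h₁ h₂
    change d (P i 0) + d (P i 1) = x i at h₀
    change d (P (i + 1) 1) + d (P (i + 1) 2) = ω' (P (i + 1 + 2) 0) at h₁
    change d (P i 2) + d (P i 3) = ω' (P (i + 1) 3) at h₂
    rw [fin_three_one_add_two] at h₁
    rw [hN'] at h₂
    rw [hT₀] at h₀
    rw [ht, ← hcyc (fun i => d (P i 1)) i, ← hcyc (fun i => d (P i 2)) i]
    simp only [hx] at h₀
    rw [← h₁, ← h₂] at h₀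
    generalize ω' (P i 2) = a at *
    generalize d (P 0 0) = b at *
    generalize d (P i 1) = c at *
    generalize d (P (i + 1) 1) = c₁ at *
    generalize d (P (i + 2) 1) = c₂ at *
    generalize d (P i 2) = e at *
    generalize d (P (i + 1) 2) = e₁ at *
    generalize d (P (i + 2) 2) = e₂ at *
    clear * - h₀
    have h2 : (2 : ZMod 2) = 0 := rfl
    linear_combination h₀ + (c₁ + c₂ + e + e₁ + e₂ ) * h2
  refine ⟨flipped P d t, F.flipped_face hd, fun h => ?_⟩
  rw [← F.swap_swap h]
  generalize σ h = k
  by_cases hk : (∃ i, k = P i 0) ∨ ∃ i, k = P i 3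
  · rcases hk with ⟨i, rfl⟩ | ⟨i, rfl⟩
    · rw [F.swap_zero, F.rot, F.flipped_P, F.flipped_P, hy]
      change d (P (i + 1 + 1) 2) + t = _
      rw [fin_three_one_add_one, add_comm, hty]
    · obtain ⟨j, rfl⟩ : ∃ j, i = j + 1 := ⟨i + 2, (fin_three_add i).symm⟩
      rw [F.swap_three, F.rot, F.flipped_P, F.flipped_P]
      exact hty j
  · push Not at hk
    rw [(F.flipped_swap hd hk.1 hk.2).1, (F.flipped_swap hd hk.1 hk.2).2, hd', hsw k hk.1 hk.2]

end IsTriangleFlip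

/-! ### Labellings of the faces -/

section Pieces
variable {H : Type}

/-- The connected pieces of the surface described by `α` and `ρ`. -/
abbrev pieceOf (α ρ : Equiv.Perm H) (h : H) : MulAction.orbitRel.Quotient
    (Subgroup.closure ({ρ, α} : Set (Equiv.Perm H))) H :=
  Quotient.mk _ h

theorem pieceOf_eq {α ρ : Equiv.Perm H} {A : Type*} {f : H → A} (hα : ∀ h, f (α h) = f h)
    (hρ : ∀ h, f (ρ h) = f h) {h k : H} (e : pieceOf α ρ h = pieceOf α ρ k) : f h = f k := by
  obtain ⟨⟨g, hg⟩, rfl⟩ := Quotient.exact e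
  change f (g k) = f k
  clear e
  induction hg using Subgroup.closure_induction generalizing k with
  | mem g hg =>
    rcases hg with rfl | rfl
    · exact hρ k
    · exact hα k
  | one => rfl
  | mul g g' _ _ hg hg' => rw [Equiv.Perm.mul_apply, hg, hg']
  | inv g _ hg =>
    have := @hg (g⁻¹ k)
    rw [← Equiv.Perm.mul_apply, mul_inv_cancel] at this
    exact this.symm

theorem pieceOf_left (α ρ : Equiv.Perm H) (h : H) : pieceOf α ρ (α h) = pieceOf α ρ h :=
  Quotient.sound ⟨⟨α, Subgroup.subset_closure (by simp)⟩, rfl⟩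

theorem pieceOf_right (α ρ : Equiv.Perm H) (h : H) : pieceOf α ρ (ρ h) = pieceOf α ρ h :=
  Quotient.sound ⟨⟨ρ, Subgroup.subset_closure (by simp)⟩, rfl⟩

theorem sameCycle_eq {f : Equiv.Perm H} {A : Type*} {g : H → A} (hg : ∀ h, g (f h) = g h)
    {h k : H} (hk : f.SameCycle h k) : g h = g k := by
  obtain ⟨n, rfl⟩ := hk
  have h₁ : ∀ n : ℕ, ∀ a, g ((f ^ n) a) = g a := by
    intro n
    induction n with
    | zero => simp
    | succ n ih =>
      intro a
      rw [pow_succ, Equiv.Perm.mul_apply, ih, hg]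
  obtain ⟨n, rfl | rfl⟩ := n.eq_nat_or_neg
  · rw [zpow_natCast, h₁]
  · have := h₁ n ((f ^ (-(n : ℤ))) h)
    rw [← this, zpow_neg, zpow_natCast]
    simp

theorem sameCycle_apply (f : Equiv.Perm H) (h : H) : f.SameCycle h (f h) := ⟨1, by simp⟩

end Pieces

/-- A labelling of the faces: the labels of adjacent faces differ by one, every face with a nonzero
label has a neighbour with a smaller label, and every piece has at most one face labelled zero. -/
structure IsLabelling {H : Type} (α ρ : Equiv.Perm H) (d : H → ℕ) : Prop where
  face : ∀ h, d (ρ (α h)) = d h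
  step : ∀ h, d (ρ h) = d h + 1 ∨ d h = d (ρ h) + 1
  lower : ∀ h, d h ≠ 0 → ∃ k, (ρ * α).SameCycle h k ∧ d (ρ k) < d k
  zero : ∀ h k, d h = 0 → d k = 0 → pieceOf α ρ h = pieceOf α ρ k → (ρ * α).SameCycle h k

namespace IsTriangleFlip

variable {H : Type} {α ρ α' σ : Equiv.Perm H} {P : Fin 3 → Fin 4 → H}
  (F : IsTriangleFlip α ρ α' σ P)
include F

theorem pieceOf_zero (i : Fin 3) : pieceOf α ρ (P i 0) = pieceOf α ρ (P 0 0) := by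
  have key : ∀ i, pieceOf α ρ (P (i + 1) 0) = pieceOf α ρ (P i 0) := by
    intro i
    rw [← pieceOf_left α ρ (P i 0), F.edge, ← pieceOf_right α ρ (P (i + 1) 3), F.rot]
    rfl
  fin_cases i
  · rfl
  · exact key 0
  · exact (key 1).trans (key 0)

theorem pieceOf_P (i : Fin 3) (r : Fin 4) : pieceOf α ρ (P i r) = pieceOf α ρ (P 0 0) := by
  rw [← F.pieceOf_zero i]
  have key : ∀ r, pieceOf α ρ (P i (r + 1)) = pieceOf α ρ (P i r) := by
    intro r
    rw [← F.rot, pieceOf_right]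
  fin_cases r
  · rfl
  · exact key 0
  · exact (key 1).trans (key 0)
  · exact (key 2).trans ((key 1).trans (key 0))

theorem pieceOf_swap (h : H) : pieceOf α ρ (σ h) = pieceOf α ρ h := by
  rcases cases_on P h with ⟨i, rfl⟩ | ⟨i, rfl⟩ | ⟨i, rfl⟩ | ⟨i, rfl⟩ | hh
  · exact (congrArg _ (F.swap_zero _)).trans ((F.pieceOf_P _ _).trans (F.pieceOf_P _ _).symm)
  · exact (congrArg _ (F.swap_one _)).trans ((F.pieceOf_P _ _).trans (F.pieceOf_P _ _).symm)
  · exact (congrArg _ (F.swap_two _)).trans ((F.pieceOf_P _ _).trans (F.pieceOf_P _ _).symm)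
  · exact (congrArg _ (F.swap_three _)).trans ((F.pieceOf_P _ _).trans (F.pieceOf_P _ _).symm)
  · rw [F.fix h hh]

theorem pieceOf_of_flip {h k : H} (e : pieceOf α' ρ h = pieceOf α' ρ k) :
    pieceOf α ρ h = pieceOf α ρ k := by
  refine pieceOf_eq (f := pieceOf α ρ) (fun h => ?_) (pieceOf_right α ρ) e
  rw [← F.swap_swap h, F.conj, F.pieceOf_swap, F.pieceOf_swap, pieceOf_left]

/-- The map sending a half-edge to its new face is itself a face function, so by `exists_eq_flipped`
it is transported from the old surface. Equal old faces therefore give equal new faces. -/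
theorem sameCycle_transport {h k h' k' : H}
    (hh : ∀ (f : H → Cycles (ρ * α')) t, (∀ h, f (ρ (α h)) = f h) → flipped P f t h = f h')
    (hk : ∀ (f : H → Cycles (ρ * α')) t, (∀ h, f (ρ (α h)) = f h) → flipped P f t k = f k')
    (hc : (ρ * α).SameCycle h' k') : (ρ * α').SameCycle h k := by
  obtain ⟨f, hf, hg⟩ := F.exists_eq_flipped (g := cycleOf (ρ * α'))
    fun h => Quotient.sound (sameCycle_apply (ρ * α') h).symm
  have e : cycleOf (ρ * α') h = cycleOf (ρ * α') k := by
    rw [hg, hh f _ hf, hk f _ hf]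
    exact sameCycle_eq (f := ρ * α) hf hc
  exact Quotient.exact e

theorem exists_source (h : H) : (∃ i, h = P i 2) ∨ ∃ h', (∀ i, h' ≠ P i 0) ∧
    pieceOf α ρ h' = pieceOf α ρ h ∧ ∀ {A : Type} (f : H → A) t, flipped P f t h = f h' := by
  by_cases hh : ∃ i r, P i r = h
  · obtain ⟨i, r, rfl⟩ := hh
    have hne : ∀ {i j r}, r ≠ 0 → P i r ≠ P j 0 := fun hr e => hr (F.inj e).2
    fin_cases r
    · exact Or.inr ⟨P (i + 1) 1, fun j => hne (by decide), ((F.pieceOf_P _ _).trans (F.pieceOf_P _ _).symm),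
        fun f t => F.flipped_P i 0⟩
    · exact Or.inr ⟨P (i + 1) 2, fun j => hne (by decide), ((F.pieceOf_P _ _).trans (F.pieceOf_P _ _).symm),
        fun f t => F.flipped_P i 1⟩
    · exact Or.inl ⟨i, rfl⟩
    · exact Or.inr ⟨P (i + 2) 2, fun j => hne (by decide), ((F.pieceOf_P _ _).trans (F.pieceOf_P _ _).symm),
        fun f t => F.flipped_P i 3⟩
  · push Not at hh
    exact Or.inr ⟨h, fun i e => hh i 0 e.symm, rfl, fun f t => flipped_off hh⟩

theorem not_sameCycle_zero {h : H} (hh : ∀ i, h ≠ P i 0) (i : Fin 3) :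
    ¬ (ρ * α).SameCycle h (P i 0) := by
  intro hc
  have := sameCycle_eq (f := ρ * α) (g := fun h => ∃ i, h = P i 0) (fun h => propext ?_) hc
  · obtain ⟨j, hj⟩ := this.symm.mp ⟨i, rfl⟩
    exact hh j hj
  · have key : ∀ i, ρ (α (P i 0)) = P (i + 1) 0 := fun i => by
      rw [F.edge, F.rot]
      rfl
    constructor
    · rintro ⟨j, hj⟩
      refine ⟨j + 2, (ρ * α).injective ?_⟩
      rw [hj]
      change _ = ρ (α (P (j + 2) 0))
      rw [key, fin_three_add]
    · rintro ⟨j, rfl⟩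
      exact ⟨j + 1, key j⟩

variable {d : H → ℕ} (hd : IsLabelling α ρ d)
include hd

theorem label_zero (i : Fin 3) : d (P i 0) = d (P 0 0) := by
  have key : ∀ i, d (P (i + 1) 0) = d (P i 0) := by
    intro i
    have := hd.face (P i 0)
    rw [F.edge, F.rot] at this
    exact this
  fin_cases i
  · rfl
  · exact key 0
  · exact (key 1).trans (key 0)

/-- The faces that touched the triangle only at a vertex become its neighbours. Their labels are `T`
or `T - 2`, so the new triangle can carry `T - 1`, and the neighbour belonging to `j` is smaller. -/
theorem isLabelling_flipped {j : Fin 3} (hj : d (P j 2) + 2 = d (P 0 0))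
    (hO : ∀ i, d (P i 2) ≤ d (P 0 0)) :
    IsLabelling α' ρ (flipped P d (d (P 0 0) - 1)) := by
  set T := d (P 0 0) with hT
  have hOT : ∀ i, d (P i 2) + 2 = T ∨ d (P i 2) = T := by
    intro i
    have h₀ := hd.step (P i 0)
    have h₁ := hd.step (P i 1)
    rw [F.rot, F.label_zero hd] at h₀
    rw [F.rot] at h₁
    change d (P i 1) = _ ∨ _ = d (P i 1) + 1 at h₀
    change d (P i 2) = _ ∨ _ = d (P i 2) + 1 at h₁
    have := hO i
    omega
  have htri : ∀ i, flipped P d (T - 1) (P i 2) = T - 1 := fun i => F.flipped_P i 2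
  have hlow : ∀ i, flipped P d (T - 1) (P i 3) = d (P (i + 2) 2) := fun i => F.flipped_P i 3
  have hlow' : ∀ i, flipped P d (T - 1) (P i 1) = d (P (i + 1) 2) := fun i => F.flipped_P i 1
  refine ⟨F.flipped_face hd.face, fun h => ?_, fun h hh => ?_, fun h k hh hk hp => ?_⟩
  · rw [← F.swap_swap h]
    generalize σ h = k
    by_cases hk : (∃ i, k = P i 0) ∨ ∃ i, k = P i 3
    · rcases hk with ⟨i, rfl⟩ | ⟨i, rfl⟩
      · rw [F.swap_zero, F.rot, hlow']
        change flipped P d (T - 1) (P (i + 1) 2) = _ ∨ _ = flipped P d (T - 1) (P (i + 1) 2) + 1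
        rw [htri]
        have := hOT (i + 1 + 1)
        omega
      · obtain ⟨j, rfl⟩ : ∃ j, i = j + 1 := ⟨i + 2, (fin_three_add i).symm⟩
        rw [F.swap_three, F.rot, htri]
        change flipped P d (T - 1) (P j 3) = _ ∨ _ = flipped P d (T - 1) (P j 3) + 1
        rw [hlow]
        have := hOT (j + 2)
        omega
    · push Not at hk
      rw [(F.flipped_swap hd.face hk.1 hk.2).1, (F.flipped_swap hd.face hk.1 hk.2).2]
      exact hd.step k
  · rcases F.exists_source h with ⟨i, rfl⟩ | ⟨h', hh₀, -, hsrc⟩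
    · refine ⟨P (j + 1) 2, ?_, ?_⟩
      · have key : ∀ i, (ρ * α').SameCycle (P i 2) (P (i + 1) 2) := by
          intro i
          have := sameCycle_apply (ρ * α') (P i 2)
          rw [Equiv.Perm.mul_apply, show α' (P i 2) = P (i + 1) 1 from F.symm.edge i, F.rot]
            at this
          exact this
        have key₀ : ∀ i, (ρ * α').SameCycle (P 0 2) (P i 2) := by
          intro i
          fin_cases i
          · exact Equiv.Perm.SameCycle.refl _ _
          · exact key 0
          · exact (key 0).trans (key 1)
        exact (key₀ i).symm.trans (key₀ _)
      · rw [F.rot, htri]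
        change flipped P d (T - 1) (P (j + 1) 3) < _
        rw [hlow, fin_three_one_add_two]
        omega
    · rw [hsrc] at hh
      obtain ⟨m, hm, hm'⟩ := hd.lower h' hh
      have hgood : ∀ m, (ρ * α).SameCycle h' m → d (ρ m) < d m → (∀ i, m ≠ P i 0) →
          (∀ i, m ≠ P i 3) → ∃ k, (ρ * α').SameCycle h k ∧
          flipped P d (T - 1) (ρ k) < flipped P d (T - 1) k := by
        intro m hm hm' h₀ h₃
        refine ⟨σ m, F.sameCycle_transport (fun f t _ => hsrc f t)
          (fun f t hf => (F.flipped_swap hf h₀ h₃).1) hm, ?_⟩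
        rw [(F.flipped_swap hd.face h₀ h₃).1, (F.flipped_swap hd.face h₀ h₃).2]
        exact hm'
      have h₀ : ∀ i, m ≠ P i 0 := by
        rintro i rfl
        exact F.not_sameCycle_zero hh₀ i hm
      -- If the smaller neighbour was the old triangle, its place is taken by the face opposite to
      -- the triangle at that vertex, whose label is no larger.
      by_cases h₃ : ∃ i, m = P i 3
      · obtain ⟨i, rfl⟩ := h₃
        have hmα : ρ (α (α (P i 2))) = P i 3 := by
          rw [F.invol, F.rot]
          rfl
        have hni : ¬ ((∃ j, α (P i 2) = P j 0) ∨ ∃ j, α (P i 2) = P j 3) := by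
          rw [← F.inner_iff]
          rintro (⟨j, e⟩ | ⟨j, e⟩)
          · exact absurd (F.inj e).2 (by decide)
          · exact absurd (F.inj e).2 (by decide)
        push Not at hni
        refine hgood (α (P i 2)) (hm.trans ?_) ?_ hni.1 hni.2
        · have := (sameCycle_apply (ρ * α) (α (P i 2))).symm
          rw [Equiv.Perm.mul_apply, hmα] at this
          exact this
        · rw [hd.face, ← hd.face (α (P i 2)), hmα]
          rw [F.rot] at hm'
          change d (P i 0) < _ at hm'
          rw [F.label_zero hd] at hm'
          exact lt_of_le_of_lt (hO i) hm'
      · push Not at h₃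
        exact hgood m hm hm' h₀ h₃
  · rcases F.exists_source h with ⟨i, rfl⟩ | ⟨h', -, hp₁, hsrc₁⟩
    · rw [htri] at hh
      omega
    · rcases F.exists_source k with ⟨i, rfl⟩ | ⟨k', -, hp₂, hsrc₂⟩
      · rw [htri] at hk
        omega
      · refine F.sameCycle_transport (fun f t _ => hsrc₁ f t) (fun f t _ => hsrc₂ f t)
          (hd.zero h' k' (by rw [← hsrc₁ d]; exact hh) (by rw [← hsrc₂ d]; exact hk) ?_)
        rw [hp₁, hp₂, F.pieceOf_of_flip hp]

/-- Only the twelve half-edges at the triangle contribute. There the sum drops by 3 plus the labels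
along the three sides minus the labels of the three opposite faces; this is positive, since the
former are at least `T - 1` and the latter at most `T`, one of them being `T - 2`. -/
theorem sum_flipped_lt [Fintype H] {j : Fin 3} (hj : d (P j 2) + 2 = d (P 0 0))
    (hO : ∀ i, d (P i 2) ≤ d (P 0 0)) :
    ∑ h, flipped P d (d (P 0 0) - 1) h < ∑ h, d h := by
  have hinj : Function.Injective fun p : Fin 3 × Fin 4 => P p.1 p.2 := fun p q h =>
    Prod.ext (F.inj h).1 (F.inj h).2
  have key := Fintype.sum_of_injective _ hinj
    (fun p => (d (P p.1 p.2) : ℤ) - flipped P d (d (P 0 0) - 1) (P p.1 p.2))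
    (fun h => (d h : ℤ) - flipped P d (d (P 0 0) - 1) h) (fun h hh => by
      rw [flipped_off fun i r e => hh ⟨(i, r), e⟩, sub_self]) (fun p => rfl)
  have h₀ : ∀ i r, flipped P d (d (P 0 0) - 1) (P i r) = _ := F.flipped_P
  have hN : ∀ i, d (P i 3) = d (P (i + 2) 1) := fun i => by
    have := F.apply_three hd.face (i + 2)
    rwa [fin_three_add] at this
  rw [Fintype.sum_prod_type] at key
  simp only [Fin.sum_univ_four, Fin.sum_univ_three, h₀, F.label_zero hd, hN] at key
  have hlt : (0 : ℤ) < ∑ h, ((d h : ℤ) - flipped P d (d (P 0 0) - 1) h) := by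
    rw [← key]
    have e₁ : (1 : Fin 3) + 1 = 2 := rfl
    have e₂ : (2 : Fin 3) + 1 = 0 := rfl
    have e₃ : (1 : Fin 3) + 2 = 0 := rfl
    have e₄ : (2 : Fin 3) + 2 = 1 := rfl
    simp only [zero_add, e₁, e₂, e₃, e₄, Matrix.cons_val_zero, Matrix.cons_val_one,
      Matrix.cons_val]
    have g₀ := hO 0
    have g₁ := hO 1
    have g₂ := hO 2
    have s₀ := hd.step (P 0 0)
    have s₁ := hd.step (P 1 0)
    have s₂ := hd.step (P 2 0)
    rw [F.rot, F.label_zero hd] at s₀ s₁ s₂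
    simp only [zero_add] at s₀ s₁ s₂
    fin_cases j <;> simp only [Fin.zero_eta, Fin.mk_one, Fin.reduceFinMk] at hj <;> omega
  rw [Finset.sum_sub_distrib] at hlt
  have := sub_pos.1 hlt
  exact_mod_cast this

end IsTriangleFlip

/-! ### Existence of labellings: distance from a base face -/

section Existence
variable {H : Type} {α ρ : Equiv.Perm H}

/-- The face through `h` is connected to the base face of its piece by at most `n` steps, each of
them leading to an adjacent face. -/
def Reach (α ρ : Equiv.Perm H) : ℕ → H → Prop
  | 0, h => (ρ * α).SameCycle h (pieceOf α ρ h).out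
  | n + 1, h => ∃ k, (ρ * α).SameCycle h k ∧ Reach α ρ n (ρ k)

theorem pieceOf_sameCycle {h k : H} (hk : (ρ * α).SameCycle h k) :
    pieceOf α ρ h = pieceOf α ρ k :=
  sameCycle_eq (f := ρ * α) (g := pieceOf α ρ) (fun h => by
    rw [Equiv.Perm.mul_apply, pieceOf_right, pieceOf_left]) hk

theorem Reach.of_sameCycle {n : ℕ} {h k : H} (hk : (ρ * α).SameCycle h k) (hr : Reach α ρ n h) :
    Reach α ρ n k := by
  cases n with
  | zero =>
    have hr' : (ρ * α).SameCycle h (pieceOf α ρ h).out := hr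
    rw [pieceOf_sameCycle hk] at hr'
    exact hk.symm.trans hr'
  | succ n =>
    obtain ⟨m, hm, hr⟩ := hr
    exact ⟨m, hk.symm.trans hm, hr⟩

variable (hα : ∀ h, α (α h) = h) (hρ : ∀ h, ρ (ρ (ρ (ρ h))) = h)
include hα hρ

/-- Being reachable is invariant under `α` and `ρ`, because steps between adjacent faces can be
reversed; hence it is constant on pieces. -/
theorem exists_reach (h : H) : ∃ n, Reach α ρ n h := by
  have h₁ : ∀ h, (∃ n, Reach α ρ n (ρ h)) → ∃ n, Reach α ρ n h := by
    rintro h ⟨n, hn⟩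
    exact ⟨n + 1, h, Equiv.Perm.SameCycle.refl _ _, hn⟩
  have h₂ : ∀ h, (∃ n, Reach α ρ n h) → ∃ n, Reach α ρ n (ρ h) := by
    intro h hh
    apply h₁
    apply h₁
    apply h₁
    rwa [hρ]
  have h₃ : ∀ h, (∃ n, Reach α ρ n h) → ∃ n, Reach α ρ n (α h) := by
    rintro h ⟨n, hn⟩
    exact h₁ _ ⟨n, hn.of_sameCycle (sameCycle_apply (ρ * α) h)⟩
  have e := pieceOf_eq (f := fun h => ∃ n, Reach α ρ n h) (α := α) (ρ := ρ)
    (fun h => propext ⟨fun hh => by have := h₃ _ hh; rwa [hα] at this, h₃ h⟩)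
    (fun h => propext ⟨h₁ h, h₂ h⟩) (h := h) (k := (pieceOf α ρ h).out) (Quotient.out_eq _).symm
  rw [e]
  refine ⟨0, ?_⟩
  have : pieceOf α ρ (pieceOf α ρ h).out = pieceOf α ρ h := Quotient.out_eq _
  change (ρ * α).SameCycle _ (pieceOf α ρ (pieceOf α ρ h).out).out
  rw [this]

/-- The label is the distance from the base face. Adjacent distances differ by at most one, and
exactness forbids equality through a checkerboard colouring. -/
theorem exists_isLabelling (hex : Exact α ρ) : ∃ d, IsLabelling α ρ d := by
  classical
  -- The constant `1` is a flow because four edges meet at every vertex; its potential is a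
  -- checkerboard colouring.
  obtain ⟨χ, hχ, hχ'⟩ := hex (fun _ => 1) (fun _ => rfl) fun _ => rfl
  have hreach := exists_reach hα hρ
  have hparity : ∀ n h, Reach α ρ n h → χ h = χ (pieceOf α ρ h).out + n := by
    intro n
    induction n with
    | zero =>
      intro h hh
      rw [Nat.cast_zero, add_zero]
      exact sameCycle_eq (f := ρ * α) hχ hh
    | succ n ih =>
      rintro h ⟨k, hk, hr⟩
      have e := ih _ hr
      rw [pieceOf_right, ← pieceOf_sameCycle hk] at e
      have e₁ := hχ' k
      have e₂ : χ h = χ k := sameCycle_eq (f := ρ * α) hχ hk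
      have h2 : (2 : ZMod 2) = 0 := rfl
      push_cast
      linear_combination e₂ + e₁ - e + (-χ (pieceOf α ρ h).out - n) * h2
  set d : H → ℕ := fun h => Nat.find (hreach h) with hd
  have hspec : ∀ h, Reach α ρ (d h) h := fun h => Nat.find_spec (hreach h)
  have hmin : ∀ n h, Reach α ρ n h → d h ≤ n := fun n h hr => Nat.find_min' (hreach h) hr
  have hface : ∀ {h k}, (ρ * α).SameCycle h k → d h = d k := fun {h k} hk =>
    le_antisymm (hmin _ _ ((hspec k).of_sameCycle hk.symm)) (hmin _ _ ((hspec h).of_sameCycle hk))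
  refine ⟨d, fun h => (hface (sameCycle_apply (ρ * α) h)).symm, fun h => ?_, fun h hh => ?_,
    fun h k hh hk hp => ?_⟩
  · have h₁ : d h ≤ d (ρ h) + 1 :=
      hmin _ _ ⟨h, Equiv.Perm.SameCycle.refl _ _, hspec (ρ h)⟩
    have h₂ : d (ρ h) ≤ d h + 1 := by
      refine hmin _ _ ⟨α h, ?_, ?_⟩
      · have := (sameCycle_apply (ρ * α) (α h)).symm
        rwa [Equiv.Perm.mul_apply, hα] at this
      · exact (hspec h).of_sameCycle (sameCycle_apply (ρ * α) h)
    have h₃ : d (ρ h) ≠ d h := by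
      intro e
      have e₁ := hparity _ _ (hspec h)
      have e₂ := hparity _ _ (hspec (ρ h))
      rw [pieceOf_right, e, ← e₁] at e₂
      have := hχ' h
      rw [e₂] at this
      have h2 : (2 : ZMod 2) = 0 := rfl
      rw [← two_mul, h2, zero_mul] at this
      exact absurd this (by decide)
    omega
  · obtain ⟨n, hn⟩ := Nat.exists_eq_succ_of_ne_zero hh
    have := hspec h
    rw [hn] at this
    obtain ⟨k, hk, hr⟩ := this
    refine ⟨k, hk, ?_⟩
    have := hmin _ _ hr
    rw [← hface hk]
    omega
  · have h₁ := hspec h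
    have h₂ := hspec k
    rw [hh] at h₁
    rw [hk] at h₂
    have h₁' : (ρ * α).SameCycle h (pieceOf α ρ h).out := h₁
    have h₂' : (ρ * α).SameCycle k (pieceOf α ρ k).out := h₂
    rw [hp] at h₁'
    exact h₁'.trans h₂'.symm

end Existence

/-! ### Discharging: existence of a small face -/

namespace IsLabelling

variable {H : Type} {α ρ : Equiv.Perm H} {d : H → ℕ}

/-- Both neighbours of the corner `h` have a smaller label, and the opposite face an even smaller
one. -/
def Top (ρ : Equiv.Perm H) (d : H → ℕ) (h : H) : Prop :=
  d (ρ h) + 1 = d h ∧ d (ρ (ρ (ρ h))) + 1 = d h ∧ d (ρ (ρ h)) + 2 = d h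

/-- Both neighbours of the corner `h` have a smaller label, and the opposite face has the same
label. -/
def Saddle (ρ : Equiv.Perm H) (d : H → ℕ) (h : H) : Prop :=
  d (ρ h) + 1 = d h ∧ d (ρ (ρ (ρ h))) + 1 = d h ∧ d (ρ (ρ h)) = d h

/-- The label rises when one crosses the first side at the corner `h` and drops when one crosses
the second one. -/
def Rise (ρ : Equiv.Perm H) (d : H → ℕ) (h : H) : Prop :=
  d (ρ h) + 1 = d h ∧ d (ρ (ρ (ρ h))) = d h + 1

/-- The reverse of `Rise`. -/
def Drop (ρ : Equiv.Perm H) (d : H → ℕ) (h : H) : Prop :=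
  d (ρ h) = d h + 1 ∧ d (ρ (ρ (ρ h))) + 1 = d h

/-- Two consecutive corners of a face are tops. -/
def Out (α ρ : Equiv.Perm H) (d : H → ℕ) (h : H) : Prop :=
  Top ρ d h ∧ Top ρ d (ρ (α h))

open Classical in
/-- The indicator function of a predicate. -/
def ind (p : Prop) : ℤ := if p then 1 else 0

theorem ind_of {p : Prop} (h : p) : ind p = 1 := if_pos h

theorem ind_not {p : Prop} (h : ¬p) : ind p = 0 := if_neg h

theorem ind_nonneg (p : Prop) : 0 ≤ ind p := by
  unfold ind
  split <;> decide

/-- The charge of a corner before the discharging along the edges. -/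
def charge (ρ : Equiv.Perm H) (d : H → ℕ) (h : H) : ℤ :=
  2 * ind (Rise ρ d h) + 2 * ind (Drop ρ d h) + 2 * ind (Saddle ρ d h)

/-- The charge of a corner after the discharging along the edges. -/
def weight (α ρ : Equiv.Perm H) (d : H → ℕ) (h : H) : ℤ :=
  charge ρ d h + ind (Out α ρ d h) - ind (Out α ρ d (α h))

variable (hα : ∀ h, α (α h) = h) (hρ : ∀ h, ρ (ρ (ρ (ρ h))) = h) (hd : IsLabelling α ρ d)
include hρ hd

theorem charge_eq (h : H) : charge ρ d h = if d (ρ h) ≠ d (ρ (ρ (ρ h))) then 2 else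
    if d (ρ h) + 1 = d h ∧ d (ρ (ρ h)) = d h then 2 else 0 := by
  have h₀ := hd.step h
  have h₃ := hd.step (ρ (ρ (ρ h)))
  rw [hρ] at h₃
  simp only [charge, Rise, Drop, Saddle, ind]
  split_ifs <;> omega

/-- The labels around a vertex either alternate between two values, which gives two saddles, or run
from a minimum up to a maximum two larger and back, which gives a rise and a drop. Both patterns
have total charge four. -/
theorem charge_orbit (h : H) :
    charge ρ d h + charge ρ d (ρ h) + charge ρ d (ρ (ρ h)) + charge ρ d (ρ (ρ (ρ h))) = 4 := by
  have h₀ := hd.step h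
  have h₁ := hd.step (ρ h)
  have h₂ := hd.step (ρ (ρ h))
  have h₃ := hd.step (ρ (ρ (ρ h)))
  simp only [charge_eq hρ hd, hρ] at h₃ ⊢
  generalize d h = k₀ at *
  generalize d (ρ h) = k₁ at *
  generalize d (ρ (ρ h)) = k₂ at *
  generalize d (ρ (ρ (ρ h))) = k₃ at *
  rcases h₀ with h₀ | h₀ <;> rcases h₁ with h₁ | h₁ <;> rcases h₂ with h₂ | h₂ <;>
    rcases h₃ with h₃ | h₃ <;> omega

theorem sum_charge [Fintype H] : ∑ h, charge ρ d h = Fintype.card H := by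
  have h₁ : ∀ f : H → ℤ, ∑ h, f (ρ h) = ∑ h, f h := fun f => Equiv.sum_comp ρ f
  have key : ∑ h, (charge ρ d h + charge ρ d (ρ h) + charge ρ d (ρ (ρ h)) +
      charge ρ d (ρ (ρ (ρ h)))) = 4 * Fintype.card H := by
    rw [Finset.sum_congr rfl fun h _ => charge_orbit hρ hd h]
    simp [mul_comm]
  simp only [Finset.sum_add_distrib, h₁ (fun h => charge ρ d (ρ (ρ h))),
    h₁ (fun h => charge ρ d (ρ h)), h₁ (fun h => charge ρ d h)] at key
  omega

theorem sum_weight [Fintype H] : ∑ h, weight α ρ d h = Fintype.card H := by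
  simp only [weight, Finset.sum_sub_distrib, Finset.sum_add_distrib]
  rw [Equiv.sum_comp α (fun h => ind (Out α ρ d h)), add_sub_cancel_right, sum_charge hρ hd]

include hα

omit hρ in
theorem label_across (h : H) : d (α h) = d (ρ h) := by
  have := hd.face (α h)
  rw [hα] at this
  exact this.symm

theorem before (h : H) : d (ρ (ρ (ρ (ρ (α h))))) = d (ρ h) := by
  rw [hρ, label_across hα hd]

/-- When the face across an edge has tops at both ends, the corners on this side are a drop followed
by a rise. A unit given away thus always comes from a drop. -/
theorem out_across {h : H} (ho : Out α ρ d (α h)) : Drop ρ d h ∧ Rise ρ d (ρ (α h)) := by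
  obtain ⟨h₁, h₂⟩ := ho
  rw [hα] at h₂
  have e₁ := label_across hα hd h
  have e₂ := before hα hρ hd h
  have e₃ := hd.face h
  simp only [Top, Drop, Rise, hρ] at *
  omega

theorem weight_cases (h : H) :
    (0 ≤ weight α ρ d h) ∧ (Rise ρ d h → weight α ρ d h = 2) ∧ (Drop ρ d h → 1 ≤ weight α ρ d h) ∧
    (Drop ρ d h → ¬ Rise ρ d (ρ (α h)) → weight α ρ d h = 2) ∧
    (Saddle ρ d h → weight α ρ d h = 2) ∧ (Out α ρ d h → weight α ρ d h = 1) := by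
  have ho := out_across hα hρ hd (h := h)
  have hi : ind (Out α ρ d (α h)) ≤ ind (Drop ρ d h) := by
    unfold ind
    split_ifs <;> first | decide | tauto
  have hr := ind_nonneg (Rise ρ d h)
  have hdr := ind_nonneg (Drop ρ d h)
  have hs := ind_nonneg (Saddle ρ d h)
  have hu := ind_nonneg (Out α ρ d h)
  have hv := ind_nonneg (Out α ρ d (α h))
  unfold weight charge
  refine ⟨by omega, fun h₁ => ?_, fun h₁ => ?_, fun h₁ h₂ => ?_, fun h₁ => ?_, fun h₁ => ?_⟩
  · have h₂ : ¬ Drop ρ d h := by simp only [Rise, Drop] at *; omega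
    have h₃ : ¬ Saddle ρ d h := by simp only [Rise, Saddle] at *; omega
    have h₄ : ¬ Out α ρ d h := by simp only [Rise, Out, Top] at *; omega
    rw [ind_not h₂] at hi
    rw [ind_of h₁, ind_not h₂, ind_not h₃, ind_not h₄]
    omega
  · rw [ind_of h₁] at hi ⊢
    omega
  · have h₃ : ¬ Rise ρ d h := by simp only [Rise, Drop] at *; omega
    have h₄ : ¬ Saddle ρ d h := by simp only [Drop, Saddle] at *; omega
    have h₅ : ¬ Out α ρ d h := by simp only [Drop, Out, Top] at *; omega
    rw [ind_of h₁, ind_not h₃, ind_not h₄, ind_not h₅, ind_not fun h => h₂ (ho h).2]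
    rfl
  · have h₂ : ¬ Drop ρ d h := by simp only [Saddle, Drop] at *; omega
    have h₃ : ¬ Rise ρ d h := by simp only [Rise, Saddle] at *; omega
    have h₄ : ¬ Out α ρ d h := by simp only [Saddle, Out, Top] at *; omega
    rw [ind_not h₂] at hi
    rw [ind_of h₁, ind_not h₂, ind_not h₃, ind_not h₄]
    omega
  · have h₂ : ¬ Drop ρ d h := by simp only [Out, Top, Drop] at *; omega
    have h₃ : ¬ Rise ρ d h := by simp only [Rise, Out, Top] at *; omega
    have h₄ : ¬ Saddle ρ d h := by simp only [Saddle, Out, Top] at *; omega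
    rw [ind_not h₂] at hi
    rw [ind_of h₁, ind_not h₂, ind_not h₃, ind_not h₄]
    omega

omit hα in
theorem rise_or (h : H) : Rise ρ d h ∨ Drop ρ d h ∨ Saddle ρ d h ∨ Top ρ d h ∨
    (d (ρ h) = d h + 1 ∧ d (ρ (ρ (ρ h))) = d h + 1) := by
  have h₀ := hd.step h
  have h₁ := hd.step (ρ h)
  have h₂ := hd.step (ρ (ρ h))
  have h₃ := hd.step (ρ (ρ (ρ h)))
  rw [hρ] at h₃
  simp only [Rise, Drop, Saddle, Top]
  omega

/-- The face at `h` is a monogon, a bigon, or a triangle with a top at the corner `h`. -/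
def IsSmall (α ρ : Equiv.Perm H) (d : H → ℕ) (h : H) : Prop :=
  d h ≠ 0 ∧ (ρ (α h) = h ∨ ρ (α (ρ (α h))) = h ∨ ρ (α (ρ (α (ρ (α h))))) = h ∧ Top ρ d h)

omit hρ hd hα in
theorem apply_mem_iff {f : Equiv.Perm H} {C : Finset H} (hC : ∀ h ∈ C, f h ∈ C) (h : H) :
    f h ∈ C ↔ h ∈ C := by
  classical
  refine ⟨fun hh => ?_, hC h⟩
  have : C.image f = C := Finset.eq_of_subset_of_card_le
    (fun k hk => by
      obtain ⟨m, hm, rfl⟩ := Finset.mem_image.1 hk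
      exact hC m hm)
    (Finset.card_image_of_injective _ f.injective).ge
  rw [← this, Finset.mem_image] at hh
  obtain ⟨k, hk, e⟩ := hh
  rwa [← f.injective e]

omit hρ hd hα in
theorem sum_apply {f : Equiv.Perm H} {C : Finset H} (hC : ∀ h ∈ C, f h ∈ C) (g : H → ℤ) :
    ∑ h ∈ C, g (f h) = ∑ h ∈ C, g h :=
  Finset.sum_equiv f (fun h => (apply_mem_iff hC h).symm) fun _ _ => rfl

/-- Around a face the comparison with the neighbours changes equally often in each direction. -/
theorem sum_rise_eq_sum_drop {C : Finset H} (hC : ∀ h ∈ C, ρ (α h) ∈ C) :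
    ∑ h ∈ C, ind (Rise ρ d h) = ∑ h ∈ C, ind (Drop ρ d h) := by
  have hC' : ∀ h ∈ C, (ρ * α) h ∈ C := hC
  -- The change of the indicator of a lower neighbour from one side to the next telescopes over the
  -- face.
  have key : ∀ h, ind (d (ρ (ρ (α h))) + 1 = d (ρ (α h))) - ind (d (ρ h) + 1 = d h) =
      ind (Rise ρ d (ρ (α h))) - ind (Drop ρ d (ρ (α h))) := by
    intro h
    have h₀ := hd.step h
    have h₁ := hd.step (ρ (α h))
    have hb := before hα hρ hd h
    have hf := hd.face h
    simp only [Rise, Drop, ind]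
    split_ifs <;> omega
  have e := Finset.sum_congr (rfl : C = C) fun h _ => key h
  rw [Finset.sum_sub_distrib, Finset.sum_sub_distrib] at e
  have e₁ := sum_apply hC' fun h => ind (d (ρ h) + 1 = d h)
  have e₂ := sum_apply hC' fun h => ind (Rise ρ d h)
  have e₃ := sum_apply hC' fun h => ind (Drop ρ d h)
  simp only [Equiv.Perm.mul_apply] at e₁ e₂ e₃
  omega

/-- Drops and rises are equally numerous, a rise weighs 2 and a drop at least 1. With a single pair,
one more unit has to be found. -/
theorem four_le_sum_of_drop (hsmall : ∀ h, ¬ IsSmall α ρ d h) {C : Finset H}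
    (hC : ∀ h ∈ C, ρ (α h) ∈ C) {h₀ : H} (h₀C : h₀ ∈ C) (hdrop : Drop ρ d h₀) :
    4 ≤ ∑ h ∈ C, weight α ρ d h := by
  classical
  have w := weight_cases hα hρ hd
  have hb := before hα hρ hd
  have hf := hd.face
  have hne : d h₀ ≠ 0 := by
    have := hdrop.2
    omega
  have hsub : ∀ s : Finset H, s ⊆ C → ∑ h ∈ s, weight α ρ d h ≤ ∑ h ∈ C, weight α ρ d h :=
    fun s hs => Finset.sum_le_sum_of_subset_of_nonneg hs fun h _ _ => (w h).1
  have hcount := sum_rise_eq_sum_drop hα hρ hd hC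
  have hle : ∑ h ∈ C, (2 * ind (Rise ρ d h) + ind (Drop ρ d h)) ≤ ∑ h ∈ C, weight α ρ d h := by
    refine Finset.sum_le_sum fun h _ => ?_
    by_cases hr : Rise ρ d h
    · have hn : ¬ Drop ρ d h := by simp only [Rise, Drop] at *; omega
      rw [ind_of hr, ind_not hn, (w h).2.1 hr]
      decide
    · rw [ind_not hr]
      by_cases hn : Drop ρ d h
      · rw [ind_of hn]
        have := (w h).2.2.1 hn
        omega
      · rw [ind_not hn]
        exact (w h).1
  rw [Finset.sum_add_distrib, ← Finset.mul_sum] at hle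
  -- Two drops come with two rises, giving at least 6.
  by_cases h2 : 2 ≤ ∑ h ∈ C, ind (Drop ρ d h)
  · omega
  have huniq : ∀ {p : H → Prop}, ∑ h ∈ C, ind (p h) < 2 → ∀ h ∈ C, ∀ k ∈ C, p h → p k → h = k := by
    intro p hp h hh k hk ph pk
    by_contra hne
    have : ∑ m ∈ ({h, k} : Finset H), ind (p m) ≤ ∑ m ∈ C, ind (p m) :=
      Finset.sum_le_sum_of_subset_of_nonneg (by
        intro m hm
        rw [Finset.mem_insert, Finset.mem_singleton] at hm
        rcases hm with rfl | rfl <;> assumption) fun m _ _ => ind_nonneg _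
    rw [Finset.sum_pair hne, ind_of ph, ind_of pk] at this
    omega
  have hud := huniq (p := Drop ρ d) (by omega)
  have hur := huniq (p := Rise ρ d) (by omega)
  -- If the rise follows the drop directly, they give only 3. After the rise the neighbours are
  -- lower, so the next corner is a saddle, worth 2, or a top; a top is followed by a saddle, or by
  -- another top and then receives a unit as `Out`. The excluded small faces ensure that these
  -- corners do not run back into the drop.
  by_cases hr : Rise ρ d (ρ (α h₀))
  · have hs := hsmall h₀
    simp only [IsSmall, not_and, not_or] at hs
    obtain ⟨hs₁, hs₂, hs₃⟩ := hs hne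
    set h₁ := ρ (α h₀) with e₁
    set h₂ := ρ (α h₁) with e₂
    have c₁ : h₁ ∈ C := hC _ h₀C
    have c₂ : h₂ ∈ C := hC _ c₁
    have c₃ : ρ (α h₂) ∈ C := hC _ c₂
    have h₁₂ : h₂ ≠ h₁ := by
      intro e
      apply hs₁
      rw [e₂, e₁] at e
      exact α.injective (ρ.injective e)
    have n₂ : ¬ Rise ρ d h₂ := fun h => h₁₂ (hur _ c₂ _ c₁ h hr)
    have n₂' : ¬ Drop ρ d h₂ := fun h => hs₂ (hud _ c₂ _ h₀C h hdrop)
    have d₁ := hf h₀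
    have d₂ := hf h₁
    rw [← e₁] at d₁
    rw [← e₂] at d₂
    have b₂ := hb h₁
    rw [← e₂] at b₂
    have low₂ := hr.1
    have hsum := hsub {h₀, h₁, h₂} (by
      intro m hm
      simp only [Finset.mem_insert, Finset.mem_singleton] at hm
      rcases hm with rfl | rfl | rfl <;> assumption)
    rw [Finset.sum_insert (by
      simp only [Finset.mem_insert, Finset.mem_singleton, not_or]
      exact ⟨fun e => hs₁ e.symm, fun e => hs₂ e.symm⟩), Finset.sum_pair h₁₂.symm,
      (w h₁).2.1 hr] at hsum
    have hw₀ := (w h₀).2.2.1 hdrop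
    rcases rise_or hρ hd h₂ with h | h | h | h | h
    · exact absurd h n₂
    · exact absurd h n₂'
    · rw [(w h₂).2.2.2.2.1 h] at hsum
      omega
    · have b₃ := hb h₂
      have d₃ := hf h₂
      have h₃₀ : ρ (α h₂) ≠ h₀ := by
        intro e
        have hs := hsmall h₂
        simp only [IsSmall, not_and, not_or] at hs
        refine (hs (by omega)).2.2 ?_ h
        rw [e, ← e₁, ← e₂]
      have n₃ : ¬ Rise ρ d (ρ (α h₂)) := fun h => by
        have e := hur _ c₃ _ c₁ h hr
        rw [e₁] at e
        exact hs₂ (α.injective (ρ.injective e))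
      have n₃' : ¬ Drop ρ d (ρ (α h₂)) := fun h => h₃₀ (hud _ c₃ _ h₀C h hdrop)
      have l₂ := h.1
      rcases rise_or hρ hd (ρ (α h₂)) with g | g | g | g | g
      · exact absurd g n₃
      · exact absurd g n₃'
      · have hsum := hsub {h₁, ρ (α h₂)} (by
          intro m hm
          simp only [Finset.mem_insert, Finset.mem_singleton] at hm
          rcases hm with rfl | rfl <;> assumption)
        rw [Finset.sum_pair (by
          intro e
          rw [e₁] at e
          exact hs₂ (α.injective (ρ.injective e)).symm), (w h₁).2.1 hr, (w _).2.2.2.2.1 g] at hsum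
        omega
      · rw [(w h₂).2.2.2.2.2 ⟨h, g⟩] at hsum
        omega
      · omega
    · omega
  -- A drop not followed by a rise gives nothing away and weighs 2; the rise elsewhere adds 2.
  · have hex : ∃ k ∈ C, Rise ρ d k := by
      by_contra hn
      push Not at hn
      have h₁ : ∑ h ∈ C, ind (Rise ρ d h) = 0 := Finset.sum_eq_zero fun h hh => ind_not (hn h hh)
      have h₂ := Finset.single_le_sum (f := fun h => ind (Drop ρ d h))
        (fun h _ => ind_nonneg _) h₀C
      rw [ind_of hdrop] at h₂
      omega
    obtain ⟨k, hk, hkr⟩ := hex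
    have hsum := hsub {h₀, k} (by
      intro m hm
      rw [Finset.mem_insert, Finset.mem_singleton] at hm
      rcases hm with rfl | rfl <;> assumption)
    rw [Finset.sum_pair (by
      rintro rfl
      simp only [Rise, Drop] at *
      omega), (w h₀).2.2.2.1 hdrop hr, (w k).2.1 hkr] at hsum
    exact hsum

/-- Without drops a lower neighbour forces all neighbours to be lower, so every corner is a saddle
or a top. In a triangle tops are excluded and two saddles suffice. In a longer face the weight is at
least the number of corners. -/
theorem four_le_sum_of_not_drop [Finite H] (hsmall : ∀ h, ¬ IsSmall α ρ d h) {C : Finset H}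
    (hC : ∀ h ∈ C, ρ (α h) ∈ C) {h₀ : H} (h₀C : h₀ ∈ C) (hdrop : ∀ h ∈ C, ¬ Drop ρ d h)
    (hlow : d (ρ h₀) < d h₀) (hcyc : ∀ h ∈ C, (ρ * α).SameCycle h₀ h) :
    4 ≤ ∑ h ∈ C, weight α ρ d h := by
  classical
  have w := weight_cases hα hρ hd
  have hb := before hα hρ hd
  have hf := hd.face
  have hC' : ∀ h ∈ C, (ρ * α) h ∈ C := hC
  -- Passing from a lower neighbour to a higher one would be a drop.
  have hpow : ∀ n : ℕ, ((ρ * α) ^ n) h₀ ∈ C ∧ d (ρ (((ρ * α) ^ n) h₀)) < d (((ρ * α) ^ n) h₀) := by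
    intro n
    induction n with
    | zero => exact ⟨h₀C, hlow⟩
    | succ n ih =>
      rw [pow_succ', Equiv.Perm.mul_apply]
      generalize ((ρ * α) ^ n) h₀ = h at ih ⊢
      rw [Equiv.Perm.mul_apply]
      refine ⟨hC h ih.1, ?_⟩
      have := hdrop _ (hC h ih.1)
      have h₁ := hb h
      have h₂ := hf h
      have h₃ := hd.step (ρ (α h))
      have h₄ := hd.step h
      simp only [Drop] at this
      omega
  have hall : ∀ h ∈ C, d (ρ h) < d h := by
    intro h hh
    obtain ⟨n, rfl⟩ := (hcyc h hh).exists_nat_pow_eq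
    exact (hpow n).2
  have hcorner : ∀ h ∈ C, Saddle ρ d (ρ (α h)) ∨ Top ρ d (ρ (α h)) := by
    intro h hh
    have h₁ := hb h
    have h₂ := hf h
    have h₃ := hall h hh
    have h₄ := hall _ (hC h hh)
    have h₅ := hd.step h
    have := rise_or hρ hd (ρ (α h))
    simp only [Rise, Drop, Saddle, Top] at *
    omega
  have hcorner' : ∀ h ∈ C, Saddle ρ d h ∨ Top ρ d h := by
    intro h hh
    have := hcorner ((ρ * α).symm h) (by
      rw [← apply_mem_iff hC', Equiv.apply_symm_apply]
      exact hh)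
    have e : ρ (α ((ρ * α).symm h)) = h := (ρ * α).apply_symm_apply h
    rwa [e] at this
  have hne : ∀ h ∈ C, d h ≠ 0 := fun h hh => by
    have := hall h hh
    omega
  have hd₁ : ∀ h ∈ C, ρ (α h) ≠ h := fun h hh e => hsmall h ⟨hne h hh, Or.inl e⟩
  have hd₂ : ∀ h ∈ C, ρ (α (ρ (α h))) ≠ h := fun h hh e => hsmall h ⟨hne h hh, Or.inr (Or.inl e)⟩
  have c₁ := hC _ h₀C
  have c₂ := hC _ c₁
  have c₃ := hC _ c₂
  by_cases h₃ : ρ (α (ρ (α (ρ (α h₀))))) = h₀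
  · have hs : ∀ h ∈ C, ρ (α (ρ (α (ρ (α h))))) = h → weight α ρ d h = 2 := by
      intro h hh e
      rcases hcorner' h hh with g | g
      · exact (w h).2.2.2.2.1 g
      · exact absurd ⟨hne h hh, Or.inr (Or.inr ⟨e, g⟩)⟩ (hsmall h)
    have hsum : ∑ h ∈ {h₀, ρ (α h₀)}, weight α ρ d h ≤ ∑ h ∈ C, weight α ρ d h :=
      Finset.sum_le_sum_of_subset_of_nonneg (by
        intro m hm
        rw [Finset.mem_insert, Finset.mem_singleton] at hm
        rcases hm with rfl | rfl <;> assumption) fun h _ _ => (w h).1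
    rw [Finset.sum_pair (hd₁ _ h₀C).symm, hs _ h₀C h₃, hs _ c₁ (by rw [h₃])] at hsum
    exact hsum
  · have hle : ∑ h ∈ C, (2 * ind (Saddle ρ d h) + ind (Out α ρ d h)) ≤
        ∑ h ∈ C, weight α ρ d h := by
      refine Finset.sum_le_sum fun h _ => ?_
      by_cases hs : Saddle ρ d h
      · have hn : ¬ Out α ρ d h := by simp only [Saddle, Out, Top] at *; omega
        rw [ind_of hs, ind_not hn, (w h).2.2.2.2.1 hs]
        decide
      · rw [ind_not hs]
        by_cases hn : Out α ρ d h
        · rw [ind_of hn, (w h).2.2.2.2.2 hn]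
          decide
        · rw [ind_not hn]
          exact (w h).1
    -- For each side, one of its two corners is a saddle, or both are tops and the side is `Out`.
    -- Summed over the face, each saddle is counted twice.
    have hge : ∑ h ∈ C, (1 : ℤ) ≤
        ∑ h ∈ C, (ind (Saddle ρ d h) + ind (Saddle ρ d (ρ (α h))) + ind (Out α ρ d h)) := by
      refine Finset.sum_le_sum fun h hh => ?_
      have i₁ := ind_nonneg (Saddle ρ d h)
      have i₂ := ind_nonneg (Saddle ρ d (ρ (α h)))
      have i₃ := ind_nonneg (Out α ρ d h)
      rcases hcorner' h hh with g | g
      · rw [ind_of g]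
        omega
      · rcases hcorner h hh with g' | g'
        · rw [ind_of g']
          omega
        · rw [ind_of (p := Out α ρ d h) ⟨g, g'⟩]
          omega
    have hcard : 4 ≤ C.card := by
      have hs : ({h₀, ρ (α h₀), ρ (α (ρ (α h₀))), ρ (α (ρ (α (ρ (α h₀)))))} : Finset H) ⊆ C := by
        intro m hm
        simp only [Finset.mem_insert, Finset.mem_singleton] at hm
        rcases hm with rfl | rfl | rfl | rfl <;> assumption
      refine le_trans (le_of_eq ?_) (Finset.card_le_card hs)
      rw [Finset.card_insert_of_notMem, Finset.card_insert_of_notMem, Finset.card_pair]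
      · exact (hd₁ _ c₂).symm
      · simp only [Finset.mem_insert, Finset.mem_singleton, not_or]
        exact ⟨(hd₁ _ c₁).symm, (hd₂ _ c₁).symm⟩
      · simp only [Finset.mem_insert, Finset.mem_singleton, not_or]
        exact ⟨(hd₁ _ h₀C).symm, (hd₂ _ h₀C).symm, fun e => h₃ e.symm⟩
    have hshift := sum_apply hC' fun h => ind (Saddle ρ d h)
    simp only [Equiv.Perm.mul_apply] at hshift
    rw [Finset.sum_add_distrib, Finset.sum_add_distrib, hshift] at hge
    rw [Finset.sum_add_distrib, ← Finset.mul_sum] at hle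
    rw [Finset.sum_const, nsmul_eq_mul, mul_one] at hge
    have : (4 : ℤ) ≤ C.card := by exact_mod_cast hcard
    omega

/-- The total weight is `4V`. Without small faces every face with a nonzero label weighs at least 4,
and at most one face per piece has label zero. By Euler's formula this forces at least four times
`V` plus the number of pieces, which exceeds `4V`. -/
theorem exists_isSmall [Finite H] [Nonempty H] {V : ℕ} (hV : Nat.card H = 4 * V)
    (hplanar : numCycles (ρ * α) = V + 2 * Nat.card (MulAction.orbitRel.Quotient
      (Subgroup.closure ({ρ, α} : Set (Equiv.Perm H))) H)) : ∃ h, IsSmall α ρ d h := by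
  classical
  by_contra hn
  push Not at hn
  have : Fintype H := Fintype.ofFinite H
  have : Fintype (Cycles (ρ * α)) := Fintype.ofFinite _
  have hsum : ∑ h, weight α ρ d h = ∑ z : Cycles (ρ * α),
      ∑ h with cycleOf (ρ * α) h = z, weight α ρ d h :=
    (Finset.sum_fiberwise _ _ _).symm
  rw [sum_weight hρ hd, ← Nat.card_eq_fintype_card, hV] at hsum
  have hbound : ∀ z : Cycles (ρ * α), 4 * ind (¬ d z.out = 0) ≤
      ∑ h with cycleOf (ρ * α) h = z, weight α ρ d h := by
    intro z
    by_cases hz : d z.out = 0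
    · rw [ind_not (not_not.2 hz)]
      exact Finset.sum_nonneg fun h _ => (weight_cases hα hρ hd h).1
    · rw [ind_of hz]
      have hmem : ∀ h, h ∈ Finset.univ.filter (fun h => cycleOf (ρ * α) h = z) ↔
          (ρ * α).SameCycle z.out h := by
        intro h
        rw [Finset.mem_filter, and_iff_right (Finset.mem_univ _)]
        exact ⟨fun e => Quotient.exact ((Quotient.out_eq z).trans e.symm),
          fun e => (Quotient.sound e).symm.trans (Quotient.out_eq z)⟩
      have hC : ∀ h ∈ Finset.univ.filter (fun h => cycleOf (ρ * α) h = z), ρ (α h) ∈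
          Finset.univ.filter (fun h => cycleOf (ρ * α) h = z) := fun h hh =>
        (hmem _).2 (((hmem h).1 hh).trans (sameCycle_apply (ρ * α) h))
      by_cases hdrop : ∃ h, (ρ * α).SameCycle z.out h ∧ Drop ρ d h
      · obtain ⟨h, hh, hdrop⟩ := hdrop
        exact four_le_sum_of_drop hα hρ hd hn hC ((hmem h).2 hh) hdrop
      · push Not at hdrop
        obtain ⟨h, hh, hlow⟩ := hd.lower _ hz
        exact four_le_sum_of_not_drop hα hρ hd hn hC ((hmem h).2 hh)
          (fun h hh => hdrop h ((hmem h).1 hh)) hlow fun k hk => hh.symm.trans ((hmem k).1 hk)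
  have hle := Finset.sum_le_sum fun z (_ : z ∈ (Finset.univ : Finset (Cycles (ρ * α)))) => hbound z
  rw [← hsum, ← Finset.mul_sum] at hle
  have hcompl : ∑ z : Cycles (ρ * α), ind (¬ d z.out = 0) + ∑ z : Cycles (ρ * α),
      ind (d z.out = 0) = Fintype.card (Cycles (ρ * α)) := by
    rw [← Finset.sum_add_distrib, ← Finset.card_univ, Finset.card_eq_sum_ones]
    push_cast
    refine Finset.sum_congr rfl fun z _ => ?_
    by_cases hz : d z.out = 0
    · rw [ind_not (not_not.2 hz), ind_of hz, zero_add]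
    · rw [ind_of hz, ind_not hz, add_zero]
  have hzero : ∑ z : Cycles (ρ * α), ind (d z.out = 0) ≤
      Nat.card (MulAction.orbitRel.Quotient
        (Subgroup.closure ({ρ, α} : Set (Equiv.Perm H))) H) := by
    have e : ∑ z : Cycles (ρ * α), ind (d z.out = 0) =
        Nat.card {z : Cycles (ρ * α) // d z.out = 0} := by
      rw [Nat.card_eq_fintype_card, Fintype.card_subtype, Finset.card_filter]
      push_cast
      refine Finset.sum_congr rfl fun z _ => ?_
      by_cases hz : d z.out = 0
      · rw [ind_of hz, if_pos hz]
      · rw [ind_not hz, if_neg hz]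
    rw [e, Nat.cast_le]
    refine Nat.card_le_card_of_injective (fun z => pieceOf α ρ z.1.out) fun z z' e => ?_
    have := hd.zero _ _ z.2 z'.2 e
    apply Subtype.ext
    rw [← Quotient.out_eq z.1, ← Quotient.out_eq z'.1]
    exact Quotient.sound this
  have hpos : 0 < Nat.card (MulAction.orbitRel.Quotient
      (Subgroup.closure ({ρ, α} : Set (Equiv.Perm H))) H) := by
    have : Nonempty (MulAction.orbitRel.Quotient
      (Subgroup.closure ({ρ, α} : Set (Equiv.Perm H))) H) :=
      ⟨pieceOf α ρ (Classical.arbitrary H)⟩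
    exact Nat.card_pos
  rw [numCycles, Nat.card_eq_fintype_card] at hplanar
  rw [hplanar] at hcompl
  push_cast at hcompl hle
  omega

end IsLabelling

/-! ### Small faces of planar link diagrams -/

theorem IsLabelling.conj {H H' : Type} {α ρ : Equiv.Perm H} {α' ρ' : Equiv.Perm H'} {d : H → ℕ}
    (hd : IsLabelling α ρ d) (e : H ≃ H') (hα : ∀ x, α' (e x) = e (α x))
    (hρ : ∀ x, ρ' (e x) = e (ρ x)) : IsLabelling α' ρ' fun h => d (e.symm h) := by
  have hρ' : ∀ y, e.symm (ρ' y) = ρ (e.symm y) := fun y => by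
    rw [Equiv.symm_apply_eq, ← hρ, Equiv.apply_symm_apply]
  have hα' : ∀ y, e.symm (α' y) = α (e.symm y) := fun y => by
    rw [Equiv.symm_apply_eq, ← hα, Equiv.apply_symm_apply]
  have hcyc : ∀ {h k}, (ρ * α).SameCycle (e.symm h) k → (ρ' * α').SameCycle h (e k) := by
    intro h k hk
    have := sameCycle_eq (f := ρ * α) (g := fun h => cycleOf (ρ' * α') (e h)) (fun h => by
      change cycleOf _ (e (ρ (α h))) = _
      rw [← hρ, ← hα]
      exact Quotient.sound (sameCycle_apply (ρ' * α') _).symm) hk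
    rw [Equiv.apply_symm_apply] at this
    exact Quotient.exact this
  refine ⟨fun h => ?_, fun h => ?_, fun h hh => ?_, fun h k hh hk hp => ?_⟩
  · rw [hρ', hα', hd.face]
  · rw [hρ']
    exact hd.step _
  · obtain ⟨k, hk, hk'⟩ := hd.lower _ hh
    refine ⟨e k, hcyc hk, ?_⟩
    rwa [hρ', Equiv.symm_apply_apply]
  · have := hd.zero _ _ hh hk (pieceOf_eq (f := fun h => pieceOf α ρ (e.symm h))
      (fun h => by rw [hα', pieceOf_left]) (fun h => by rw [hρ', pieceOf_right]) hp)
    have := hcyc this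
    rwa [Equiv.apply_symm_apply] at this

namespace LinkDiagram

variable {L : LinkDiagram}

theorem rotate_fst (h : L.HalfEdge) : (L.rotate h).1.1 = h.1.1 := rfl

theorem acrossEdge_snd (h : L.HalfEdge) : (L.acrossEdge h).2 = !h.2 := by
  obtain ⟨q, _ | _⟩ := h <;> rfl

theorem next_of_acrossEdge {q q' : Passage L.Crossing} {o o' : Bool}
    (h : L.acrossEdge (q, o) = (q', o')) :
    (o = true ∧ L.next q = q') ∨ (o = false ∧ L.next q' = q) := by
  cases o
  · right
    refine ⟨rfl, ?_⟩
    have := congrArg Prod.fst h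
    rw [acrossEdge_false] at this
    exact ((Equiv.symm_apply_eq _).1 this).symm
  · exact Or.inl ⟨rfl, congrArg Prod.fst h⟩

theorem acrossEdge_of_face {c c' : L.Crossing} {b b' o o' : Bool}
    (h : L.rotate (L.acrossEdge ((c, b), o)) = ((c', b'), o')) :
    L.acrossEdge ((c, b), o) = ((c', !b'), !o) ∧
      o' = if L.sign c' = 1 then xor (!o) b' else xor (!o) (!b') := by
  have h₁ := acrossEdge_snd (L := L) ((c, b), o)
  rcases hx : L.acrossEdge ((c, b), o) with ⟨⟨c₁, b₁⟩, o₁⟩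
  rw [hx] at h h₁
  rw [rotate_apply] at h
  obtain rfl : o₁ = !o := h₁
  obtain rfl : c₁ = c' := congrArg (fun h => h.1.1) h
  obtain rfl : (!b₁) = b' := congrArg (fun h => h.1.2) h
  refine ⟨by rw [Bool.not_not], (congrArg Prod.snd h).symm.trans ?_⟩
  rw [Bool.not_not]

/-- An edge closing up straight through its crossing would have the same face on both sides,
contrary to the labels of adjacent faces being different. -/
theorem acrossEdge_fst_ne {d : L.HalfEdge → ℕ} (hd : IsLabelling L.acrossEdge L.rotate d)
    (h : L.HalfEdge) : (L.acrossEdge h).1 ≠ h.1 := by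
  intro e
  have h₁ : L.acrossEdge h = L.rotate (L.rotate h) := by
    rw [rotate_pow_two, ← acrossEdge_snd, ← e]
  have h₂ := hd.face h
  have h₃ := hd.step (L.rotate (L.rotate (L.rotate h)))
  rw [rotate_pow_four] at h₃
  rw [h₁] at h₂
  omega

/-- An edge from a crossing to itself must join its two different passages, and this is all that a
kink requires in a Gauss diagram. -/
theorem exists_kink {d : L.HalfEdge → ℕ} (hd : IsLabelling L.acrossEdge L.rotate d)
    {h : L.HalfEdge} (hh : (L.rotate (L.acrossEdge h)).1.1 = h.1.1) :
    ∃ c b, L.next (c, b) = (c, !b) := by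
  have hne := acrossEdge_fst_ne hd h
  rw [rotate_fst] at hh
  obtain ⟨⟨c, b⟩, o⟩ := h
  rcases hx : L.acrossEdge ((c, b), o) with ⟨⟨c', b'⟩, o'⟩
  rw [hx] at hh hne
  obtain rfl : c' = c := hh
  have hb : b' = !b := by
    cases b <;> cases b' <;> simp_all
  subst hb
  rcases next_of_acrossEdge hx with ⟨-, h⟩ | ⟨-, h⟩
  · exact ⟨c', b, h⟩
  · exact ⟨c', !b, by rw [h, Bool.not_not]⟩

/-- The conditions on `true` and `false` make one side of the bigon the overstrand at both
crossings; closing up of the face then forces opposite signs. -/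
theorem exists_bigon {a b : L.Crossing} (hab : a ≠ b) {o o' : Bool}
    (h₁ : L.rotate (L.acrossEdge ((a, true), o)) = ((b, false), o'))
    (h₂ : L.rotate (L.acrossEdge ((b, false), o')) = ((a, true), o)) :
    ∃ a b, a ≠ b ∧ L.sign a = -L.sign b ∧ L.next (a, true) = (b, true) ∧
      (L.next (a, false) = (b, false) ∨ L.next (b, false) = (a, false)) := by
  obtain ⟨e₁, f₁⟩ := acrossEdge_of_face h₁
  obtain ⟨e₂, f₂⟩ := acrossEdge_of_face h₂
  have hs : L.sign a = -L.sign b := by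
    rcases Int.units_eq_one_or (L.sign a) with ha | ha <;>
      rcases Int.units_eq_one_or (L.sign b) with hb | hb <;>
      rw [hb] at f₁ ⊢ <;> rw [ha] at f₂ ⊢ <;> first | rfl | (exfalso; revert f₁ f₂; cases o <;> cases o' <;> decide)
  have hu := next_of_acrossEdge e₂
  rcases next_of_acrossEdge e₁ with ⟨-, h⟩ | ⟨-, h⟩
  · refine ⟨a, b, hab, hs, h, ?_⟩
    rcases hu with ⟨-, hu⟩ | ⟨-, hu⟩
    · exact Or.inr hu
    · exact Or.inl hu
  · refine ⟨b, a, hab.symm, by rw [hs, neg_neg], h, ?_⟩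
    rcases hu with ⟨-, hu⟩ | ⟨-, hu⟩
    · exact Or.inl hu
    · exact Or.inr hu

/-- The diagram whose passages are traversed in the order conjugate by `s`. -/
abbrev conjNext (L : LinkDiagram) (s : Equiv.Perm (Passage L.Crossing)) : LinkDiagram where
  Crossing := L.Crossing
  finite := L.finite
  next := s * L.next * s⁻¹
  sign := L.sign
  circles := L.circles

/-- The half-edges of the crossings at the corners `h i`. -/
def corners (h : Fin 3 → L.HalfEdge) (i : Fin 3) (r : Fin 4) : L.HalfEdge :=
  ![h i, L.rotate (h i), L.rotate (L.rotate (h i)), L.rotate (L.rotate (L.rotate (h i)))] r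

theorem corners_fst (h : Fin 3 → L.HalfEdge) (i : Fin 3) (r : Fin 4) :
    (corners h i r).1.1 = (h i).1.1 := by
  fin_cases r <;> rfl

/-- Interchanging the two crossings on every side of a triangle in the Gauss diagram is, on the
surface, the geometric flip of the triangle. -/
theorem isTriangleFlip_conjNext {h : Fin 3 → L.HalfEdge}
    (hface : ∀ i, L.rotate (L.acrossEdge (h i)) = h (i + 1))
    (hinj : Function.Injective fun i => (h i).1.1) {s : Equiv.Perm (Passage L.Crossing)}
    (hs : ∀ i, s (h i).1 = (L.acrossEdge (h i)).1) (hs' : ∀ i, s (L.acrossEdge (h i)).1 = (h i).1)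
    (hfix : ∀ q, (∀ i, q ≠ (h i).1 ∧ q ≠ (L.acrossEdge (h i)).1) → s q = q) :
    IsTriangleFlip L.acrossEdge L.rotate (L.conjNext s).acrossEdge
      (s.prodCongr (Equiv.refl Bool)) (corners h) := by
  have h₃ : ∀ i, L.rotate (L.rotate (L.rotate (h (i + 1)))) = L.acrossEdge (h i) := fun i => by
    rw [← hface, rotate_pow_four]
  have h₁ : ∀ i, L.rotate (h (i + 1)) = ((L.acrossEdge (h i)).1, (h i).2) := fun i => by
    rw [← hface, rotate_pow_two, acrossEdge_snd, Bool.not_not]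
  refine ⟨fun {i r j t} e => ?_, fun i r => ?_, L.acrossEdge_acrossEdge, fun i => (h₃ i).symm,
    fun i => ?_, fun i => ?_, fun i => ?_, fun i => ?_, fun k hk => ?_, fun k => ?_⟩
  · have hij : i = j := hinj (by
      have := congrArg (fun h => h.1.1) e
      simpa only [corners_fst] using this)
    subst hij
    refine ⟨rfl, ?_⟩
    rcases hx : h i with ⟨⟨c, b⟩, o⟩
    simp only [corners, hx, rotate_apply] at e
    revert e
    by_cases hc : L.sign c = 1 <;> fin_cases r <;> fin_cases t <;> cases b <;> cases o <;> simp [hc]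
  · fin_cases r
    · rfl
    · rfl
    · rfl
    · exact L.rotate_pow_four _
  · change (s (h i).1, (h i).2) = L.rotate (h (i + 1))
    rw [h₁, hs]
  · change (s (L.rotate (h (i + 1))).1, (L.rotate (h (i + 1))).2) = h i
    rw [h₁, hs']
  · change (s (L.rotate (L.rotate (h i))).1, (L.rotate (L.rotate (h i))).2) =
      L.rotate (L.rotate (L.rotate (h (i + 1))))
    rw [h₃, rotate_pow_two, hs, ← acrossEdge_snd]
  · change (s (L.rotate (L.rotate (L.rotate (h (i + 1))))).1,
      (L.rotate (L.rotate (L.rotate (h (i + 1))))).2) = L.rotate (L.rotate (h i))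
    rw [h₃, rotate_pow_two, hs', ← acrossEdge_snd]
  · refine Prod.ext (hfix _ fun i => ⟨fun e => ?_, fun e => ?_⟩) rfl
    · by_cases ho : k.2 = (h i).2
      · exact hk i 0 (Prod.ext e.symm ho.symm)
      · refine hk i 2 ((L.rotate_pow_two (h i)).trans (Prod.ext e.symm ?_))
        revert ho
        cases k.2 <;> cases (h i).2 <;> simp
    · by_cases ho : k.2 = (h i).2
      · exact hk (i + 1) 1 ((h₁ i).trans (Prod.ext e.symm ho.symm))
      · refine hk (i + 1) 3 ((h₃ i).trans (Prod.ext e.symm ?_))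
        rw [acrossEdge_snd]
        revert ho
        cases k.2 <;> cases (h i).2 <;> simp
  · obtain ⟨q, _ | _⟩ := k
    · change (((s * L.next * s⁻¹).symm (s q), true) : L.HalfEdge) = (s (L.next.symm q), true)
      refine Prod.ext ?_ rfl
      rw [Equiv.symm_apply_eq]
      simp
    · change (((s * L.next * s⁻¹) (s q), false) : L.HalfEdge) = (s (L.next q), false)
      refine Prod.ext ?_ rfl
      simp

/-- The face at `h` is a triangle whose corners lie at three distinct crossings, with a top at the
corner `h`. -/
structure TopTriangle (L : LinkDiagram) (d : L.HalfEdge → ℕ) (h : L.HalfEdge) : Prop where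
  planar : L.IsPlanar
  label : IsLabelling L.acrossEdge L.rotate d
  face : L.rotate (L.acrossEdge (L.rotate (L.acrossEdge (L.rotate (L.acrossEdge h))))) = h
  top : IsLabelling.Top L.rotate d h
  ne₁ : (L.rotate (L.acrossEdge h)).1.1 ≠ h.1.1
  ne₂ : (L.rotate (L.acrossEdge (L.rotate (L.acrossEdge h)))).1.1 ≠ (L.rotate (L.acrossEdge h)).1.1
  ne₃ : (L.rotate (L.acrossEdge (L.rotate (L.acrossEdge h)))).1.1 ≠ h.1.1

theorem face_changeCrossing (c : L.Crossing) (h : L.HalfEdge) :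
    (L.changeCrossing c).rotate ((L.changeCrossing c).acrossEdge (L.flipHalfEdge {c} h)) =
      L.flipHalfEdge {c} (L.rotate (L.acrossEdge h)) := by
  rw [changeCrossing_acrossEdge, changeCrossing_rotate]

theorem flipHalfEdge_of_eq {c : L.Crossing} {h : L.HalfEdge} (hc : h.1.1 = c) :
    L.flipHalfEdge {c} h = ((h.1.1, !h.1.2), h.2) :=
  Prod.ext (flipAt_of_mem (S := {c}) (q := h.1) hc) rfl

theorem flipHalfEdge_of_ne {c : L.Crossing} {h : L.HalfEdge} (hc : h.1.1 ≠ c) :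
    L.flipHalfEdge {c} h = h :=
  Prod.ext (flipAt_of_notMem (S := {c}) (q := h.1) hc) rfl

theorem flipHalfEdge_fst (c : L.Crossing) (h : L.HalfEdge) :
    (L.flipHalfEdge {c} h).1.1 = h.1.1 :=
  flipAt_fst {c} h.1

theorem TopTriangle.changeCrossing {d : L.HalfEdge → ℕ} {h : L.HalfEdge} (H : L.TopTriangle d h)
    (c : L.Crossing) : (L.changeCrossing c).TopTriangle
      (fun h => d ((L.flipHalfEdge {c}).symm h)) (L.flipHalfEdge {c} h) where
  planar := isPlanar_changeCrossing H.planar c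
  label := H.label.conj (L.flipHalfEdge {c}) (L.changeCrossing_acrossEdge c)
    (L.changeCrossing_rotate c)
  face := by
    rw [face_changeCrossing, face_changeCrossing, face_changeCrossing, H.face]
  top := by
    have := H.top
    unfold IsLabelling.Top at this ⊢
    rw [changeCrossing_rotate, changeCrossing_rotate, changeCrossing_rotate]
    simpa only [Equiv.symm_apply_apply] using this
  ne₁ := by
    rw [face_changeCrossing, flipHalfEdge_fst, flipHalfEdge_fst]
    exact H.ne₁
  ne₂ := by
    rw [face_changeCrossing, face_changeCrossing, flipHalfEdge_fst, flipHalfEdge_fst]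
    exact H.ne₂
  ne₃ := by
    rw [face_changeCrossing, face_changeCrossing, flipHalfEdge_fst, flipHalfEdge_fst]
    exact H.ne₃

end LinkDiagram

/-! ### Reduction of planar link diagrams -/

namespace LinkDiagram

variable {L : LinkDiagram}

open Classical in
/-- The permutation of passages which underlies the third Reidemeister move. -/
def triangleSwaps {C : Type} (x y w : C) : Equiv.Perm (Passage C) :=
  Equiv.swap (x, true) (y, true) * Equiv.swap (x, false) (w, true) *
    Equiv.swap (y, false) (w, false)

theorem triangleSwaps_apply {C : Type} {x y w : C} (hxy : x ≠ y) (hxw : x ≠ w) (hyw : y ≠ w)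
    (q : Fin 3 × Bool) : triangleSwaps x y w (![x, y, w] q.1, q.2) =
      (![x, y, w] (triangleSwap q).1, (triangleSwap q).2) := by
  obtain ⟨i, b⟩ := q
  fin_cases i <;> cases b <;>
    simp [triangleSwaps, triangleSwap, Equiv.swap_apply_def, hxy, hxw, hyw, hxy.symm, hxw.symm,
      hyw.symm]

theorem triangleSwaps_of_ne {C : Type} {x y w : C} {q : Passage C} (hx : q.1 ≠ x) (hy : q.1 ≠ y)
    (hw : q.1 ≠ w) : triangleSwaps x y w q = q := by
  obtain ⟨c, b⟩ := q
  have hx : c ≠ x := hx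
  have hy : c ≠ y := hy
  have hw : c ≠ w := hw
  simp [triangleSwaps, Equiv.swap_apply_def, hx, hy, hw]

/-- The values `true`, `false`, `false` around the triangle mean that one strand is over at both of
its crossings and another under at both, as the third move demands. The geometric closing conditions
become its equations between signs. -/
theorem TopTriangle.step {d : L.HalfEdge → ℕ} {h : L.HalfEdge} (H : L.TopTriangle d h)
    [Fintype L.HalfEdge]
    (hb₀ : h.1.2 = true) (hb₁ : (L.rotate (L.acrossEdge h)).1.2 = false)
    (hb₂ : (L.rotate (L.acrossEdge (L.rotate (L.acrossEdge h)))).1.2 = false) :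
    ∃ (x y w : L.Crossing) (t m b : ℤˣ) (d' : L.HalfEdge → ℕ), x ≠ y ∧ x ≠ w ∧ y ≠ w ∧
      L.Consecutive t (x, true) (y, true) ∧ L.Consecutive m (x, false) (w, true) ∧
      L.Consecutive b (y, false) (w, false) ∧ m * L.sign x = b * L.sign y ∧
      m * L.sign w = t * L.sign y ∧ (L.conjNext (triangleSwaps x y w)).IsPlanar ∧
      IsLabelling (L.conjNext (triangleSwaps x y w)).acrossEdge L.rotate d' ∧
      ∑ h, d' h < ∑ h, d h := by
  obtain ⟨hplanar, hd, hf, htop, ne₁, ne₂, ne₃⟩ := H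
  obtain ⟨⟨y, b₀⟩, o₀⟩ := h
  obtain rfl : b₀ = true := hb₀
  rcases hx₁ : L.rotate (L.acrossEdge ((y, true), o₀)) with ⟨⟨x, b₁⟩, o₁⟩
  rw [hx₁] at hf hb₁ hb₂ ne₁ ne₂ ne₃
  obtain rfl : b₁ = false := hb₁
  rcases hx₂ : L.rotate (L.acrossEdge ((x, false), o₁)) with ⟨⟨w, b₂⟩, o₂⟩
  rw [hx₂] at hf hb₂ ne₂ ne₃
  obtain rfl : b₂ = false := hb₂
  have hxy : x ≠ y := ne₁
  have hxw : x ≠ w := Ne.symm ne₂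
  have hyw : y ≠ w := Ne.symm ne₃
  obtain ⟨e₀, f₀⟩ := acrossEdge_of_face hx₁
  obtain ⟨e₁, f₁⟩ := acrossEdge_of_face hx₂
  obtain ⟨e₂, f₂⟩ := acrossEdge_of_face hf
  have sw := triangleSwaps_apply hxy hxw hyw
  have F : IsTriangleFlip L.acrossEdge L.rotate (L.conjNext (triangleSwaps x y w)).acrossEdge
      ((triangleSwaps x y w).prodCongr (Equiv.refl Bool))
      (corners ![((y, true), o₀), ((x, false), o₁), ((w, false), o₂)]) := by
    refine isTriangleFlip_conjNext (fun i => ?_) (fun i j e => ?_) (fun i => ?_) (fun i => ?_)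
      (fun q hq => ?_)
    · fin_cases i
      · exact hx₁
      · exact hx₂
      · exact hf
    · fin_cases i <;> fin_cases j <;> first | rfl | (exfalso; revert e; simp [hxy, hxw, hyw, hxy.symm, hxw.symm, hyw.symm])
    · fin_cases i
      · exact (sw (1, true)).trans (congrArg Prod.fst e₀).symm
      · exact (sw (0, false)).trans (congrArg Prod.fst e₁).symm
      · exact (sw (2, false)).trans (congrArg Prod.fst e₂).symm
    · fin_cases i
      · exact (congrArg (fun h => triangleSwaps x y w h.1) e₀).trans (sw (0, true))
      · exact (congrArg (fun h => triangleSwaps x y w h.1) e₁).trans (sw (2, true))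
      · exact (congrArg (fun h => triangleSwaps x y w h.1) e₂).trans (sw (1, false))
    · have q₀ := hq 0
      have q₁ := hq 1
      have q₂ := hq 2
      change q ≠ (y, true) ∧ q ≠ (L.acrossEdge ((y, true), o₀)).1 at q₀
      change q ≠ (x, false) ∧ q ≠ (L.acrossEdge ((x, false), o₁)).1 at q₁
      change q ≠ (w, false) ∧ q ≠ (L.acrossEdge ((w, false), o₂)).1 at q₂
      rw [e₀] at q₀
      rw [e₁] at q₁
      rw [e₂] at q₂
      obtain ⟨c, b⟩ := q
      refine triangleSwaps_of_ne ?_ ?_ ?_ <;> rintro rfl <;> cases b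
      · exact q₁.1 rfl
      · exact q₀.2 rfl
      · exact q₂.2 rfl
      · exact q₀.1 rfl
      · exact q₂.1 rfl
      · exact q₁.2 rfl
  have hτ₀ := htop.2.2
  have hτ₁ := htop.1
  have hτ₂ := htop.2.1
  -- The neighbours along the two sides at the top are smaller by one. The faces opposite at the
  -- other two vertices are adjacent to these, so their labels do not exceed that of the triangle.
  have hO : ∀ i, d (corners ![((y, true), o₀), ((x, false), o₁), ((w, false), o₂)] i 2) ≤
      d (corners ![((y, true), o₀), ((x, false), o₁), ((w, false), o₂)] 0 0) := by
    have l₁ := hd.face ((y, true), o₀)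
    have l₂ := hd.face ((x, false), o₁)
    have l₃ := hd.face ((w, false), o₂)
    rw [hx₁] at l₁
    rw [hx₂] at l₂
    have b₁ := IsLabelling.before L.acrossEdge_acrossEdge L.rotate_pow_four hd ((y, true), o₀)
    have b₀ := IsLabelling.before L.acrossEdge_acrossEdge L.rotate_pow_four hd ((w, false), o₂)
    rw [hx₁] at b₁
    rw [hf] at b₀
    have s₁ := hd.step (L.rotate (L.rotate ((x, false), o₁)))
    have s₂ := hd.step (L.rotate ((w, false), o₂))
    intro i
    fin_cases i
    · change d (L.rotate (L.rotate ((y, true), o₀))) ≤ d ((y, true), o₀)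
      omega
    · change d (L.rotate (L.rotate ((x, false), o₁))) ≤ d ((y, true), o₀)
      omega
    · change d (L.rotate (L.rotate ((w, false), o₂))) ≤ d ((y, true), o₀)
      omega
  have hcons : ∀ {o : Bool} {u v : Passage L.Crossing} {o'}, L.acrossEdge (u, o) = (v, o') →
      L.Consecutive (if o then 1 else -1) u v ∧ L.Consecutive (if o then -1 else 1) v u := by
    intro o u v o' e
    rcases next_of_acrossEdge e with ⟨rfl, h⟩ | ⟨rfl, h⟩
    · exact ⟨Or.inl ⟨rfl, h⟩, Or.inr ⟨rfl, h⟩⟩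
    · exact ⟨Or.inr ⟨rfl, h⟩, Or.inl ⟨rfl, h⟩⟩
  refine ⟨x, y, w, if o₀ then -1 else 1, if o₁ then 1 else -1, if o₂ then -1 else 1,
    IsTriangleFlip.flipped (corners ![((y, true), o₀), ((x, false), o₁), ((w, false), o₂)]) d
      (d ((y, true), o₀) - 1), hxy, hxw, hyw,
    (hcons e₀).2, (hcons e₁).1, (hcons e₂).2, ?_, ?_, ?_, ?_, ?_⟩
  · rcases Int.units_eq_one_or (L.sign x) with hx | hx <;>
      rcases Int.units_eq_one_or (L.sign y) with hy | hy <;>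
      rw [hx] at f₀ ⊢ <;> rw [hy] at f₂ ⊢ <;> clear * - f₀ f₂ <;> revert o₀ o₁ o₂ <;> decide
  · rcases Int.units_eq_one_or (L.sign w) with hx | hx <;>
      rcases Int.units_eq_one_or (L.sign y) with hy | hy <;>
      rw [hx] at f₁ ⊢ <;> rw [hy] at f₂ ⊢ <;> clear * - f₁ f₂ <;> revert o₀ o₁ o₂ <;> decide
  · rw [isPlanar_iff_exact] at hplanar ⊢
    exact F.exact hplanar
  · exact F.isLabelling_flipped hd (j := 0) hτ₀ hO
  · exact F.sum_flipped_lt hd (j := 0) hτ₀ hO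

theorem card_halfEdge (L : LinkDiagram) : Nat.card L.HalfEdge = 4 * Nat.card L.Crossing := by
  rw [Nat.card_prod, Nat.card_prod, Nat.card_eq_fintype_card (α := Bool), Fintype.card_bool]
  omega

instance (L : LinkDiagram) (c : L.Crossing) [Fintype L.HalfEdge] :
    Fintype (L.changeCrossing c).HalfEdge :=
  inferInstanceAs (Fintype L.HalfEdge)

/-- A property of planar link diagrams with a given number of crossings holds if it is invariant
under crossing changes and moves past triangles, and if it holds whenever the diagram has a kink or
a bigon which is removable. -/
theorem reduction {A : LinkDiagram → Prop} {v : ℕ}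
    (change : ∀ L : LinkDiagram, Nat.card L.Crossing = v → L.IsPlanar →
      ∀ c, A (L.changeCrossing c) → A L)
    (kink : ∀ L : LinkDiagram, Nat.card L.Crossing = v → L.IsPlanar →
      ∀ c b, L.next (c, b) = (c, !b) → A L)
    (bigon : ∀ L : LinkDiagram, Nat.card L.Crossing = v → L.IsPlanar →
      ∀ a b, a ≠ b → L.sign a = -L.sign b → L.next (a, true) = (b, true) →
      (L.next (a, false) = (b, false) ∨ L.next (b, false) = (a, false)) → A L)
    (triangle : ∀ L : LinkDiagram, Nat.card L.Crossing = v → L.IsPlanar →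
      ∀ (x y w : L.Crossing) (t m b : ℤˣ), x ≠ y → x ≠ w → y ≠ w →
      L.Consecutive t (x, true) (y, true) → L.Consecutive m (x, false) (w, true) →
      L.Consecutive b (y, false) (w, false) → m * L.sign x = b * L.sign y →
      m * L.sign w = t * L.sign y → (L.conjNext (triangleSwaps x y w)).IsPlanar →
      A (L.conjNext (triangleSwaps x y w)) → A L)
    (L : LinkDiagram) (hv : Nat.card L.Crossing = v) (hL : L.IsPlanar) [Nonempty L.Crossing] :
    A L := by
  -- The induction is on the sum of the labels, with the number of crossings fixed. Crossing changes
  -- keep the surface and hence the labels; flipping the triangle lowers the sum.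
  have main : ∀ (N : ℕ) (L : LinkDiagram) [Fintype L.HalfEdge] (d : L.HalfEdge → ℕ),
      Nat.card L.Crossing = v → L.IsPlanar → Nonempty L.Crossing →
      IsLabelling L.acrossEdge L.rotate d → ∑ h, d h = N → A L := by
    intro N
    induction N using Nat.strong_induction_on with
    | _ N ih =>
    have tri₀ : ∀ (L : LinkDiagram) [Fintype L.HalfEdge] (d : L.HalfEdge → ℕ) (h : L.HalfEdge),
        Nat.card L.Crossing = v → ∑ h, d h = N → L.TopTriangle d h → h.1.2 = true →
        (L.rotate (L.acrossEdge h)).1.2 = false →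
        (L.rotate (L.acrossEdge (L.rotate (L.acrossEdge h)))).1.2 = false → A L := by
      intro L _ d h hv hN H hb₀ hb₁ hb₂
      obtain ⟨x, y, w, t, m, b, d', hxy, hxw, hyw, h₁, h₂, h₃, h₄, h₅, hp, hl, hs⟩ :=
        H.step hb₀ hb₁ hb₂
      exact triangle L hv H.planar x y w t m b hxy hxw hyw h₁ h₂ h₃ h₄ h₅ hp
        (ih _ (hN ▸ hs) (L.conjNext (triangleSwaps x y w)) d' hv hp ⟨x⟩ hl rfl)
    have hsum : ∀ (L : LinkDiagram) [Fintype L.HalfEdge] (d : L.HalfEdge → ℕ) (c : L.Crossing),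
        ∑ h : (L.changeCrossing c).HalfEdge, d ((L.flipHalfEdge {c}).symm h) = ∑ h, d h :=
      fun L _ d c => Equiv.sum_comp (L.flipHalfEdge {c}).symm d
    -- The over-under pattern is corrected one corner at a time by crossing changes. The three
    -- crossings are distinct, so changing one leaves the other corners alone.
    have tri₁ : ∀ (L : LinkDiagram) [Fintype L.HalfEdge] (d : L.HalfEdge → ℕ) (h : L.HalfEdge),
        Nat.card L.Crossing = v → ∑ h, d h = N → L.TopTriangle d h → h.1.2 = true →
        (L.rotate (L.acrossEdge h)).1.2 = false → A L := by
      intro L _ d h hv hN H hb₀ hb₁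
      by_cases hb₂ : (L.rotate (L.acrossEdge (L.rotate (L.acrossEdge h)))).1.2 = false
      · exact tri₀ L d h hv hN H hb₀ hb₁ hb₂
      refine change L hv H.planar (L.rotate (L.acrossEdge (L.rotate (L.acrossEdge h)))).1.1 ?_
      refine tri₀ _ _ _ hv ((hsum L d _).trans hN) (H.changeCrossing _) ?_ ?_ ?_
      · rw [flipHalfEdge_of_ne H.ne₃.symm]
        exact hb₀
      · rw [face_changeCrossing, flipHalfEdge_of_ne H.ne₂.symm]
        exact hb₁
      · rw [face_changeCrossing, face_changeCrossing, flipHalfEdge_of_eq rfl]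
        simpa using hb₂
    have tri₂ : ∀ (L : LinkDiagram) [Fintype L.HalfEdge] (d : L.HalfEdge → ℕ) (h : L.HalfEdge),
        Nat.card L.Crossing = v → ∑ h, d h = N → L.TopTriangle d h → h.1.2 = true → A L := by
      intro L _ d h hv hN H hb₀
      by_cases hb₁ : (L.rotate (L.acrossEdge h)).1.2 = false
      · exact tri₁ L d h hv hN H hb₀ hb₁
      refine change L hv H.planar (L.rotate (L.acrossEdge h)).1.1 ?_
      refine tri₁ _ _ _ hv ((hsum L d _).trans hN) (H.changeCrossing _) ?_ ?_
      · rw [flipHalfEdge_of_ne H.ne₁.symm]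
        exact hb₀
      · rw [face_changeCrossing, flipHalfEdge_of_eq rfl]
        simpa using hb₁
    have tri : ∀ (L : LinkDiagram) [Fintype L.HalfEdge] (d : L.HalfEdge → ℕ) (h : L.HalfEdge),
        Nat.card L.Crossing = v → ∑ h, d h = N → L.TopTriangle d h → A L := by
      intro L _ d h hv hN H
      by_cases hb₀ : h.1.2 = true
      · exact tri₂ L d h hv hN H hb₀
      refine change L hv H.planar h.1.1 ?_
      refine tri₂ _ _ _ hv ((hsum L d _).trans hN) (H.changeCrossing _) ?_
      rw [flipHalfEdge_of_eq rfl]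
      simpa using hb₀
    intro L _ d hv hL hne hd hN
    have hkink : ∀ h : L.HalfEdge, (L.rotate (L.acrossEdge h)).1.1 = h.1.1 → A L := by
      intro h hh
      obtain ⟨c, b, e⟩ := exists_kink hd hh
      exact kink L hv hL c b e
    obtain ⟨h, -, hh⟩ := hd.exists_isSmall L.acrossEdge_acrossEdge L.rotate_pow_four
      L.card_halfEdge hL
    rcases hh with hh | hh | ⟨hh, htop⟩
    · exact hkink h (by rw [hh])
    · by_cases e : (L.rotate (L.acrossEdge h)).1.1 = h.1.1
      · exact hkink h e
      · have big : ∀ (L : LinkDiagram) (h : L.HalfEdge), Nat.card L.Crossing = v → L.IsPlanar →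
            L.rotate (L.acrossEdge (L.rotate (L.acrossEdge h))) = h →
            (L.rotate (L.acrossEdge h)).1.1 ≠ h.1.1 → h.1.2 = true →
            (L.rotate (L.acrossEdge h)).1.2 = false → A L := by
          intro L h hv hL hh e hb hb'
          obtain ⟨⟨a, b₀⟩, o₀⟩ := h
          obtain rfl : b₀ = true := hb
          rcases hx : L.rotate (L.acrossEdge ((a, true), o₀)) with ⟨⟨b, b₁⟩, o₁⟩
          rw [hx] at hh e hb'
          obtain rfl : b₁ = false := hb'
          obtain ⟨a, b, hab, hs, h₁, h₂⟩ := exists_bigon (Ne.symm e) hx hh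
          exact bigon L hv hL a b hab hs h₁ h₂
        have big' : ∀ (L : LinkDiagram) (h : L.HalfEdge), Nat.card L.Crossing = v → L.IsPlanar →
            L.rotate (L.acrossEdge (L.rotate (L.acrossEdge h))) = h →
            (L.rotate (L.acrossEdge h)).1.1 ≠ h.1.1 → h.1.2 = true → A L := by
          intro L h hv hL hh e hb
          by_cases hb' : (L.rotate (L.acrossEdge h)).1.2 = false
          · exact big L h hv hL hh e hb hb'
          refine change L hv hL (L.rotate (L.acrossEdge h)).1.1 ?_
          refine big _ (L.flipHalfEdge {(L.rotate (L.acrossEdge h)).1.1} h) hv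
            (isPlanar_changeCrossing hL _) ?_ ?_ ?_ ?_
          · rw [face_changeCrossing, face_changeCrossing, hh]
          · rw [face_changeCrossing, flipHalfEdge_fst, flipHalfEdge_fst]
            exact e
          · rw [flipHalfEdge_of_ne (Ne.symm e)]
            exact hb
          · rw [face_changeCrossing, flipHalfEdge_of_eq rfl]
            simpa using hb'
        by_cases hb : h.1.2 = true
        · exact big' L h hv hL hh e hb
        refine change L hv hL h.1.1 ?_
        refine big' _ (L.flipHalfEdge {h.1.1} h) hv (isPlanar_changeCrossing hL _) ?_ ?_ ?_
        · rw [face_changeCrossing, face_changeCrossing, hh]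
        · rw [face_changeCrossing, flipHalfEdge_fst, flipHalfEdge_fst]
          exact e
        · rw [flipHalfEdge_of_eq rfl]
          simpa using hb
    · by_cases e₁ : (L.rotate (L.acrossEdge h)).1.1 = h.1.1
      · exact hkink h e₁
      by_cases e₂ : (L.rotate (L.acrossEdge (L.rotate (L.acrossEdge h)))).1.1 =
          (L.rotate (L.acrossEdge h)).1.1
      · exact hkink _ e₂
      -- Coinciding corners of the triangle mean that one of its edges is a kink.
      by_cases e₃ : (L.rotate (L.acrossEdge (L.rotate (L.acrossEdge h)))).1.1 = h.1.1
      · refine hkink (L.rotate (L.acrossEdge (L.rotate (L.acrossEdge h)))) ?_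
        rw [hh, e₃]
      exact tri L d h hv hN ⟨hL, hd, hh, htop, e₁, e₂, e₃⟩
  have : Fintype L.HalfEdge := Fintype.ofFinite _
  obtain ⟨d, hd⟩ := exists_isLabelling L.acrossEdge_acrossEdge L.rotate_pow_four
    ((isPlanar_iff_exact L).1 hL)
  exact main _ L d hv hL ‹_› hd rfl

end LinkDiagram

/-! ### Independence of the cut -/

namespace LinkDiagram

theorem delete_congr {C : Type} {fin : Finite C} {n n' : Equiv.Perm (Passage C)} {s s' : C → ℤˣ}
    {k k' : ℕ} (h : LinkDiagram.mk C fin n s k = LinkDiagram.mk C fin n' s' k') (E : Set C) :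
    (LinkDiagram.mk C fin n s k).delete E = (LinkDiagram.mk C fin n' s' k').delete E := by
  injection h with _ h₁ h₂ h₃
  subst h₁ h₂ h₃
  rfl

theorem smooth_congr {C : Type} {fin : Finite C} {n n' : Equiv.Perm (Passage C)} {s s' : C → ℤˣ}
    {k k' : ℕ} (h : LinkDiagram.mk C fin n s k = LinkDiagram.mk C fin n' s' k') (c : C) :
    (LinkDiagram.mk C fin n s k).smooth c = (LinkDiagram.mk C fin n' s' k').smooth c := by
  injection h with _ h₁ h₂ h₃
  subst h₁ h₂ h₃
  rfl

variable (L : LinkDiagram)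

theorem cutAfter_delete_closure (r : Passage L.Crossing) (E : Set L.Crossing) :
    ((L.cutAfter r).delete E).closure = L.delete E :=
  (TangleDiagram.delete_closure (L.cutAfter r) E).trans (delete_congr (L.cutAfter_closure r) E)

theorem cutAfter_smooth_closure (r : Passage L.Crossing) (c : L.Crossing) :
    ((L.cutAfter r).smooth c).closure = L.smooth c :=
  (TangleDiagram.smooth_closure (L.cutAfter r) c).trans (smooth_congr (L.cutAfter_closure r) c)

theorem cutAfter_conj {X : Type} [DecidableEq (Option X)] (f s : Equiv.Perm X) (r : X) :
    Equiv.optionCongr (s * f * s⁻¹) * Equiv.swap none (some (s r)) =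
      Equiv.optionCongr s * (Equiv.optionCongr f * Equiv.swap none (some r)) *
        Equiv.optionCongr s⁻¹ := by
  ext1 x
  obtain ⟨y, rfl⟩ := (Equiv.optionCongr s).surjective x
  have e : Equiv.swap none (some (s r)) (Equiv.optionCongr s y) =
      Equiv.optionCongr s (Equiv.swap none (some r) y) := by
    have := Equiv.swap_apply_apply (Equiv.optionCongr s) none (some r)
    change Equiv.swap none (some (s r)) = _ at this
    rw [this, Equiv.Perm.mul_apply, Equiv.Perm.mul_apply]
    exact congrArg (fun z => Equiv.optionCongr s (Equiv.swap none (some r) z))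
      ((Equiv.optionCongr s).symm_apply_apply y)
  have e' : ∀ y, Equiv.optionCongr s⁻¹ (Equiv.optionCongr s y) = y := by
    rintro (_ | y) <;> simp
  simp only [Equiv.Perm.mul_apply, e, e']
  generalize Equiv.swap none (some r) y = z
  rcases z with _ | z <;> simp

theorem cutAfter_changeCrossing (r : Passage L.Crossing) (c : L.Crossing) :
    (L.cutAfter r).changeCrossing c = (L.changeCrossing c).cutAfter (flipAt {c} r) := by
  classical
  have e : (flipAt ({c} : Set L.Crossing))⁻¹ = flipAt {c} :=
    inv_eq_of_mul_eq_one_left (flipAt_mul_self _)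
  refine TangleDiagram.mk_congr ?_ rfl rfl
  have := cutAfter_conj L.next (flipAt {c}) r
  rw [e] at this
  exact this.symm

theorem cutAfter_conjNext (r : Passage L.Crossing) (s : Equiv.Perm (Passage L.Crossing)) :
    (L.cutAfter r).conjNext s = (L.conjNext s).cutAfter (s r) := by
  classical
  refine TangleDiagram.mk_congr ?_ rfl rfl
  exact (cutAfter_conj L.next s r).symm

/-- Cut a circle without crossings. -/
abbrev cutCircle (L : LinkDiagram) : TangleDiagram where
  Crossing := L.Crossing
  finite := L.finite
  next := Equiv.optionCongr L.next
  sign := L.sign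
  circles := L.circles - 1

theorem _root_.ConwayTangle.TangleDiagram.eq_cut (T : TangleDiagram) :
    (∃ r, T = T.closure.cutAfter r) ∨ (0 < T.closure.circles ∧ T = T.closure.cutCircle) := by
  classical
  rcases h : T.next.symm none with _ | r
  · right
    rw [Equiv.symm_apply_eq] at h
    have hc : T.closure.circles = T.circles + 1 := by
      simp [TangleDiagram.closure, h.symm]
    refine ⟨by omega, TangleDiagram.mk_congr ?_ rfl ?_⟩
    · ext1 x
      rcases x with _ | q
      · exact h.symm
      · rcases hq : T.next (some q) with _ | q'
        · have := T.next.injective (hq.trans h)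
          simp at this
        · exact hq.symm.trans (Equiv.removeNone_some T.next ⟨_, hq⟩).symm
    · rw [hc]
      rfl
  · left
    rw [Equiv.symm_apply_eq] at h
    exact ⟨r, T.eq_cutAfter h.symm⟩

theorem _root_.ConwayTangle.TangleDiagram.nabla_eq_zero {T : TangleDiagram}
    (h : ∀ S, ¬ T.IsDescending S) : T.nabla = 0 := by
  classical
  rw [T.nabla_eq_sum]
  exact Finset.sum_eq_zero fun S _ => if_neg (h S)

theorem nabla_cutAfter_eq_zero (h : 0 < L.circles) (r : Passage L.Crossing) :
    (L.cutAfter r).nabla = 0 :=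
  TangleDiagram.nabla_eq_zero fun _ hS => h.ne' hS.1.1

theorem nabla_cutCircle_eq_zero [Nonempty L.Crossing] : L.cutCircle.nabla = 0 := by
  refine TangleDiagram.nabla_eq_zero fun S hS => ?_
  obtain ⟨c⟩ := ‹Nonempty L.Crossing›
  have h := sameCycle_eq (f := L.cutCircle.smoothedNext S) (g := fun x => x = none)
    (fun x => by rcases x with _ | x <;> simp [TangleDiagram.smoothedNext])
    (hS.1.2 (some (c, true)))
  simp at h

/-- The polynomial of the tangle obtained by cutting the diagram does not depend on the cut. -/
def CutInvariant : Prop := ∀ r r', (L.cutAfter r).nabla = (L.cutAfter r').nabla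

variable {L}

/-- Covers also the cut through a circle without crossings: with crossings present that cut gives
zero, and so does every other cut, which leaves the circle as a closed component. -/
theorem CutInvariant.nabla_eq (h : L.CutInvariant) {T T' : TangleDiagram} (hT : T.closure = L)
    (hT' : T'.closure = L) : T.nabla = T'.nabla := by
  have key : ∀ T : TangleDiagram, T.closure = L →
      (∃ r, T = L.cutAfter r) ∨ (0 < L.circles ∧ T = L.cutCircle) := by
    rintro T rfl
    exact T.eq_cut
  rcases key T hT with ⟨r, rfl⟩ | ⟨hc, rfl⟩ <;> rcases key T' hT' with ⟨r', rfl⟩ | ⟨hc', rfl⟩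
  · exact h r r'
  · have : Nonempty L.Crossing := ⟨r.1⟩
    rw [nabla_cutCircle_eq_zero, L.nabla_cutAfter_eq_zero hc']
  · have : Nonempty L.Crossing := ⟨r'.1⟩
    rw [nabla_cutCircle_eq_zero, L.nabla_cutAfter_eq_zero hc]
  · rfl

/-- `B` contains the edges inside a local picture, where a cut would obstruct the move. One step
moves such a cut out of the picture. -/
theorem CutInvariant.of_step (step : ∀ r, (L.cutAfter (L.next r)).nabla = (L.cutAfter r).nabla)
    {B : Set (Passage L.Crossing)} (hB : ∀ r ∈ B, L.next r ∉ B)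
    (h : ∀ r r', r ∉ B → r' ∉ B → (L.cutAfter r).nabla = (L.cutAfter r').nabla) :
    L.CutInvariant := by
  have key : ∀ r, ∃ r', r' ∉ B ∧ (L.cutAfter r).nabla = (L.cutAfter r').nabla := by
    intro r
    by_cases hr : r ∈ B
    · exact ⟨_, hB r hr, (step r).symm⟩
    · exact ⟨r, hr, rfl⟩
  intro r r'
  obtain ⟨q, hq, e⟩ := key r
  obtain ⟨q', hq', e'⟩ := key r'
  rw [e, e', h q q' hq hq']

theorem exists_pick {s : ℤˣ} {u v : Passage L.Crossing} (h : L.Consecutive s u v) :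
    ∃ t, L.next (pick t u v) = pick (!t) u v ∧ (s : ℤ) = sgn t := by
  rcases h with ⟨rfl, h⟩ | ⟨rfl, h⟩
  · exact ⟨true, h, rfl⟩
  · exact ⟨false, h, rfl⟩

theorem pick_ne_pick {α : Type*} {u v u' v' : α} (h₁ : u ≠ u') (h₂ : u ≠ v') (h₃ : v ≠ u')
    (h₄ : v ≠ v') (t t' : Bool) : pick t u v ≠ pick t' u' v' := by
  cases t <;> cases t' <;> assumption

theorem pick_not_ne_pick {α : Type*} {u v : α} (h : u ≠ v) (t : Bool) :
    pick (!t) u v ≠ pick t u v := by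
  cases t
  · exact h
  · exact h.symm

theorem nabla_cutAfter_kink {c : L.Crossing} {b : Bool} (h : L.next (c, b) = (c, !b)) :
    ∃ B : Set (Passage L.Crossing), (∀ r ∈ B, L.next r ∉ B) ∧
      ∀ r ∉ B, ((L.cutAfter r).delete {c}).nabla = (L.cutAfter r).nabla := by
  refine ⟨{(c, b)}, ?_, fun r hr => ?_⟩
  · rintro _ rfl
    rw [h]
    simp
  · exact (L.cutAfter r).nabla_delete_kink
      ((L.cutAfter_next_of_ne (Ne.symm hr)).trans (congrArg some h))

theorem nabla_cutAfter_bigon {a b : L.Crossing} (hab : a ≠ b) (hsign : L.sign a = -L.sign b)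
    (hover : L.next (a, true) = (b, true))
    (hunder : L.next (a, false) = (b, false) ∨ L.next (b, false) = (a, false)) :
    ∃ B : Set (Passage L.Crossing), (∀ r ∈ B, L.next r ∉ B) ∧
      ∀ r ∉ B, ((L.cutAfter r).delete {a, b}).nabla = (L.cutAfter r).nabla := by
  obtain ⟨m, hm⟩ : ∃ m, L.next (pick m (a, false) (b, false)) = pick (!m) (a, false) (b, false) := by
    rcases hunder with h | h
    · exact ⟨true, h⟩
    · exact ⟨false, h⟩
  have hne := pick_ne_pick (u := (a, true)) (v := (b, true)) (u' := (a, false)) (v' := (b, false))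
    (by simp) (by simp) (by simp) (by simp)
  refine ⟨{pick true (a, true) (b, true), pick m (a, false) (b, false)}, ?_, fun r hr => ?_⟩
  · rintro _ (rfl | rfl)
    · rw [show L.next (pick true (a, true) (b, true)) = pick (!true) (a, true) (b, true) from hover]
      rintro (h | h)
      · exact pick_not_ne_pick (by simpa using hab) _ h
      · exact hne _ _ h
    · rw [hm]
      rintro (h | h)
      · exact hne _ _ h.symm
      · exact pick_not_ne_pick (by simpa using hab) _ h
  · rw [Set.mem_insert_iff, Set.mem_singleton_iff, not_or] at hr
    exact (L.cutAfter r).nabla_bigon hab hsign true m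
      ((L.cutAfter_next_of_ne (Ne.symm hr.1)).trans (congrArg some hover))
      ((L.cutAfter_next_of_ne (Ne.symm hr.2)).trans (congrArg some hm))

theorem nabla_cutAfter_triangle {x y w : L.Crossing} {t m b : ℤˣ} (hxy : x ≠ y) (hxw : x ≠ w)
    (hyw : y ≠ w) (htop : L.Consecutive t (x, true) (y, true))
    (hmiddle : L.Consecutive m (x, false) (w, true))
    (hbottom : L.Consecutive b (y, false) (w, false))
    (h₁ : m * L.sign x = b * L.sign y) (h₂ : m * L.sign w = t * L.sign y) :
    ∃ B : Set (Passage L.Crossing), (∀ r ∈ B, L.next r ∉ B) ∧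
      ∀ r ∉ B, ((L.conjNext (triangleSwaps x y w)).cutAfter (triangleSwaps x y w r)).nabla =
        (L.cutAfter r).nabla := by
  obtain ⟨t', ht, ht'⟩ := exists_pick htop
  obtain ⟨m', hm, hm'⟩ := exists_pick hmiddle
  obtain ⟨b', hb, hb'⟩ := exists_pick hbottom
  have htm := pick_ne_pick (u := (x, true)) (v := (y, true)) (u' := (x, false)) (v' := (w, true))
    (by simp) (by simpa using hxw) (by simp) (by simpa using hyw)
  have htb := pick_ne_pick (u := (x, true)) (v := (y, true)) (u' := (y, false)) (v' := (w, false))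
    (by simp) (by simp) (by simp) (by simp)
  have hmb := pick_ne_pick (u := (x, false)) (v := (w, true)) (u' := (y, false)) (v' := (w, false))
    (by simpa using hxy) (by simpa using hxw) (by simp) (by simp)
  have hmul : ∀ {s u v v' : ℤˣ}, s * u = v * v' → (u : ℤ) = s * v * v' := by
    intro s u v v' h
    rw [mul_assoc, ← Units.val_mul, ← Units.val_mul, ← h, ← mul_assoc, Int.units_mul_self, one_mul]
  refine ⟨{pick t' (x, true) (y, true), pick m' (x, false) (w, true),
    pick b' (y, false) (w, false)}, ?_, fun r hr => ?_⟩
  · rintro _ (rfl | rfl | rfl)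
    · rw [ht]
      rintro (h | h | h)
      · exact pick_not_ne_pick (by simpa using hxy) _ h
      · exact htm _ _ h
      · exact htb _ _ h
    · rw [hm]
      rintro (h | h | h)
      · exact htm _ _ h.symm
      · exact pick_not_ne_pick (by simp) _ h
      · exact hmb _ _ h
    · rw [hb]
      rintro (h | h | h)
      · exact htb _ _ h.symm
      · exact hmb _ _ h.symm
      · exact pick_not_ne_pick (by simpa using hyw) _ h
  · rw [Set.mem_insert_iff, Set.mem_insert_iff, Set.mem_singleton_iff, not_or, not_or] at hr
    rw [← cutAfter_conjNext]
    refine (L.cutAfter r).nabla_triangle hxy hxw hyw (fun q => triangleSwaps_of_ne)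
      (triangleSwaps_apply hxy hxw hyw) t' m' b'
      ((L.cutAfter_next_of_ne (Ne.symm hr.1)).trans (congrArg some ht))
      ((L.cutAfter_next_of_ne (Ne.symm hr.2.1)).trans (congrArg some hm))
      ((L.cutAfter_next_of_ne (Ne.symm hr.2.2)).trans (congrArg some hb)) ?_ ?_
    · rw [← hm', ← hb']
      exact hmul h₁
    · rw [← hm', ← ht']
      exact hmul h₂

theorem card_delete_lt {C : Type} [Finite C] {E : Set C} {c : C} (hc : c ∈ E) :
    Nat.card {c // c ∉ E} < Nat.card C :=
  Finite.card_subtype_lt (x := c) (not_not.2 hc)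

/-- Smoothings and deletions have fewer crossings, so all cuts of them agree by induction. This
gives the single steps along a component, the invariance of the claim under crossing changes, and
the cases of a kink and a bigon in `reduction`. -/
theorem cutInvariant_of_isPlanar (L : LinkDiagram) (hL : L.IsPlanar) : L.CutInvariant := by
  obtain ⟨v, hv⟩ : ∃ v, Nat.card L.Crossing = v := ⟨_, rfl⟩
  induction v using Nat.strong_induction_on generalizing L with
  | _ v ih =>
  rcases isEmpty_or_nonempty L.Crossing with he | hne
  · exact fun r => (he.false r.1).elim
  have step : ∀ L : LinkDiagram, Nat.card L.Crossing = v → L.IsPlanar →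
      ∀ r, (L.cutAfter (L.next r)).nabla = (L.cutAfter r).nabla := by
    intro L hv hL r
    refine L.cutAfter_nabla_next r fun c => ?_
    exact (ih _ (hv ▸ card_delete_lt (Set.mem_singleton c)) (L.smooth c)
      (L.isPlanar_smooth hL c) rfl).nabla_eq (L.cutAfter_smooth_closure _ _)
      (L.cutAfter_smooth_closure _ _)
  refine reduction (A := CutInvariant) (fun L hv hL c hA r r' => ?_) (fun L hv hL c b h => ?_)
    (fun L hv hL a b hab hs h₁ h₂ => ?_)
    (fun L hv hL x y w t m b hxy hxw hyw h₁ h₂ h₃ h₄ h₅ hp hA => ?_) L hv hL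
  -- Both cuts satisfy a skein relation with the same weight, and the smoothed terms agree by
  -- induction.
  · have e₁ := (L.cutAfter r).skein c
    have e₂ := (L.cutAfter r').skein c
    rw [cutAfter_changeCrossing] at e₁ e₂
    have e₃ := hA (flipAt {c} r) (flipAt {c} r')
    have e₄ := (ih _ (hv ▸ card_delete_lt (Set.mem_singleton c)) (L.smooth c)
      (L.isPlanar_smooth hL c) rfl).nabla_eq (L.cutAfter_smooth_closure r c)
      (L.cutAfter_smooth_closure r' c)
    have e₅ : (L.cutAfter r).wt c = (L.cutAfter r').wt c := rfl
    rw [e₄, e₅, ← e₂, e₃] at e₁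
    exact sub_left_injective e₁
  · obtain ⟨B, hB, hB'⟩ := nabla_cutAfter_kink h
    refine CutInvariant.of_step (step L hv hL) hB fun r r' hr hr' => ?_
    rw [← hB' r hr, ← hB' r' hr']
    exact (ih _ (hv ▸ card_delete_lt (Set.mem_singleton c)) (L.delete {c})
      (L.isPlanar_delete_kink hL h) rfl).nabla_eq (L.cutAfter_delete_closure _ _)
      (L.cutAfter_delete_closure _ _)
  · obtain ⟨B, hB, hB'⟩ := nabla_cutAfter_bigon hab hs h₁ h₂
    refine CutInvariant.of_step (step L hv hL) hB fun r r' hr hr' => ?_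
    rw [← hB' r hr, ← hB' r' hr']
    exact (ih _ (hv ▸ card_delete_lt (Set.mem_insert a {b})) (L.delete {a, b})
      (L.isPlanar_delete_bigon hL hab h₁ h₂) rfl).nabla_eq (L.cutAfter_delete_closure _ _)
      (L.cutAfter_delete_closure _ _)
  · obtain ⟨B, hB, hB'⟩ := nabla_cutAfter_triangle hxy hxw hyw h₁ h₂ h₃ h₄ h₅
    refine CutInvariant.of_step (step L hv hL) hB fun r r' hr hr' => ?_
    rw [← hB' r hr, ← hB' r' hr']
    exact hA _ _

end LinkDiagram

/-! ### Existence and uniqueness of the Conway polynomial -/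

namespace LinkDiagram

variable {L : LinkDiagram}

open Classical in
/-- The polynomial of a tangle obtained by cutting the diagram. -/
def conway (L : LinkDiagram) : ℤ[X] :=
  if h : Nonempty L.Crossing then (L.cutAfter (h.some, true)).nabla else L.cutCircle.nabla

theorem conway_eq_cutAfter (hL : L.IsPlanar) (r : Passage L.Crossing) :
    L.conway = (L.cutAfter r).nabla := by
  rw [conway, dif_pos ⟨r.1⟩]
  exact L.cutInvariant_of_isPlanar hL _ _

theorem conway_eq_cutCircle [h : IsEmpty L.Crossing] : L.conway = L.cutCircle.nabla := by
  rw [conway, dif_neg (not_nonempty_iff.2 h)]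

theorem _root_.ConwayTangle.TangleDiagram.nabla_eq_conway {T : TangleDiagram}
    (hL : L.IsPlanar) (hT : T.closure = L) : T.nabla = L.conway := by
  subst hT
  rcases isEmpty_or_nonempty T.closure.Crossing with he | ⟨⟨c⟩⟩
  · rw [conway_eq_cutCircle]
    rcases T.eq_cut with ⟨r, -⟩ | ⟨-, h⟩
    · exact (he.false r.1).elim
    · exact congrArg TangleDiagram.nabla h
  · rw [conway_eq_cutAfter hL (c, true)]
    exact (T.closure.cutInvariant_of_isPlanar hL).nabla_eq rfl (T.closure.cutAfter_closure _)

theorem exists_notMem {B : Set (Passage L.Crossing)} (hB : ∀ r ∈ B, L.next r ∉ B)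
    (c : L.Crossing) : ∃ r, r ∉ B := by
  by_cases h : (c, true) ∈ B
  · exact ⟨_, hB _ h⟩
  · exact ⟨_, h⟩

/-- The cut may be placed on an edge not involved in the move, where invariance of the tangle
polynomial applies. -/
theorem Move.conway_eq {L' : LinkDiagram} (hL : L.IsPlanar) (hL' : L'.IsPlanar) (h : Move L L') :
    L.conway = L'.conway := by
  cases h with
  | relabel L' e hnext hsign hcircles =>
    rcases isEmpty_or_nonempty L.Crossing with he | ⟨⟨c⟩⟩
    · have : IsEmpty L'.Crossing := e.symm.isEmpty
      rw [conway_eq_cutCircle, conway_eq_cutCircle]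
      refine (TangleDiagram.nabla_relabel (T := L.cutCircle) (T' := L'.cutCircle) e ?_ hsign ?_).symm
      · rintro (_ | q)
        · rfl
        · exact congrArg some (hnext q)
      · exact congrArg (· - 1) hcircles
    · rw [conway_eq_cutAfter hL (c, true), conway_eq_cutAfter hL' (e c, true)]
      refine (TangleDiagram.nabla_relabel (T := L.cutAfter (c, true))
        (T' := L'.cutAfter (e c, true)) e ?_ hsign hcircles).symm
      rintro (_ | q)
      · rw [cutAfter_next_none]
        exact (L'.cutAfter_next_none _).trans (congrArg some (hnext (c, true)))
      · by_cases hq : q = (c, true)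
        · subst hq
          rw [cutAfter_next_self]
          exact L'.cutAfter_next_self _
        · rw [cutAfter_next_of_ne _ hq]
          refine (L'.cutAfter_next_of_ne (q := (e q.1, q.2)) ?_).trans (congrArg some (hnext q))
          intro e'
          apply hq
          obtain ⟨h₁, h₂⟩ := Prod.mk.inj e'
          exact Prod.ext (e.injective h₁) h₂
  | one c b h =>
    obtain ⟨B, hB, hB'⟩ := nabla_cutAfter_kink h
    obtain ⟨r, hr⟩ := exists_notMem hB c
    rw [conway_eq_cutAfter hL r, ← hB' r hr]
    exact TangleDiagram.nabla_eq_conway hL' (L.cutAfter_delete_closure _ _)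
  | two a b hab hsign hover hunder =>
    obtain ⟨B, hB, hB'⟩ := nabla_cutAfter_bigon hab hsign hover hunder
    obtain ⟨r, hr⟩ := exists_notMem hB a
    rw [conway_eq_cutAfter hL r, ← hB' r hr]
    exact TangleDiagram.nabla_eq_conway hL' (L.cutAfter_delete_closure _ _)
  | three x y w hxy hxw hyw t m b htop hmiddle hbottom h₁ h₂ =>
    obtain ⟨B, hB, hB'⟩ := nabla_cutAfter_triangle hxy hxw hyw htop hmiddle hbottom h₁ h₂
    obtain ⟨r, hr⟩ := exists_notMem hB x
    rw [conway_eq_cutAfter hL r, ← hB' r hr]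
    exact TangleDiagram.nabla_eq_conway hL' (cutAfter_closure _ _)

theorem conway_skein (hL : L.IsPlanar) (c : L.Crossing) :
    L.conway - (L.changeCrossing c).conway = C (L.sign c : ℤ) * X * (L.smooth c).conway := by
  have h := (L.cutAfter (c, true)).skein c
  rw [cutAfter_changeCrossing, ← conway_eq_cutAfter hL,
    TangleDiagram.nabla_eq_conway (L.isPlanar_smooth hL c) (L.cutAfter_smooth_closure _ c)] at h
  exact (congrArg (L.conway - ·) (conway_eq_cutAfter (isPlanar_changeCrossing hL c)
    (flipAt {c} (c, true)))).trans h

theorem _root_.ConwayTangle.TangleDiagram.nabla_eq_one (T : TangleDiagram)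
    [h : IsEmpty T.Crossing] (hT : T.circles = 0) : T.nabla = 1 := by
  classical
  have hd : T.IsDescending ((∅ : Finset T.Crossing) : Set T.Crossing) := by
    refine ⟨⟨hT, ?_⟩, fun s => h.elim s⟩
    rintro (_ | q)
    · exact Equiv.Perm.SameCycle.refl _ _
    · exact h.elim q.1
  rw [T.nabla_eq_sum, Finset.sum_eq_single ∅
    (fun S _ hS => absurd (Finset.eq_empty_of_forall_notMem fun c _ => h.false c) hS)
    (fun hS => absurd (Finset.mem_univ _) hS), if_pos hd, Finset.prod_empty]

theorem conway_unknot : unknot.toLinkDiagram.conway = 1 := by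
  have : IsEmpty unknot.toLinkDiagram.Crossing := inferInstanceAs (IsEmpty Empty)
  rw [conway_eq_cutCircle]
  exact TangleDiagram.nabla_eq_one _ rfl

end LinkDiagram

/-! ### Uniqueness -/

namespace LinkDiagram

variable {L : LinkDiagram}

theorem nonempty_smooth (L : LinkDiagram) (c : L.Crossing) :
    Nonempty (L.smooth c).Crossing ∨ 0 < (L.smooth c).circles := by
  rw [← L.cutAfter_smooth_closure (c, true) c]
  exact closure_nonempty _

theorem nonempty_delete (L : LinkDiagram) (c : L.Crossing) (E : Set L.Crossing) :
    Nonempty (L.delete E).Crossing ∨ 0 < (L.delete E).circles := by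
  rw [← L.cutAfter_delete_closure (c, true) E]
  exact closure_nonempty _

theorem changeCrossing_changeCrossing (L : LinkDiagram) (c : L.Crossing) :
    (L.changeCrossing c).changeCrossing c = L := by
  classical
  refine mk_congr ?_ ?_ rfl
  · change flipAt {c} * (flipAt {c} * L.next * flipAt {c}) * flipAt {c} = L.next
    rw [mul_assoc, mul_assoc, mul_assoc, flipAt_mul_self, mul_one, ← mul_assoc, flipAt_mul_self,
      one_mul]
  · change Function.update (Function.update L.sign c (-L.sign c)) c
      (-Function.update L.sign c (-L.sign c) c) = L.sign
    rw [Function.update_self, neg_neg, Function.update_idem, Function.update_eq_self]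

/-- The diagram of the unknot with one positive crossing, together with `k` circles. -/
abbrev curl (k : ℕ) : LinkDiagram where
  Crossing := Unit
  finite := inferInstance
  next := flipAt Set.univ
  sign := fun _ => 1
  circles := k

theorem curl_next (k : ℕ) (b : Bool) : (curl k).next ((), b) = ((), !b) :=
  flipAt_of_mem (S := Set.univ) (q := ((), b)) trivial

theorem isPlanar_curl (k : ℕ) : (curl k).IsPlanar := by
  rw [isPlanar_iff_exact]
  intro ω hω hsum
  have e : ∀ b, (curl k).acrossEdge (((), b), true) = (((), !b), false) := fun b =>
    Prod.ext (curl_next k b) rfl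
  have e' : ∀ b, (curl k).acrossEdge (((), b), false) = (((), !b), true) := fun b => by
    have := congrArg (curl k).acrossEdge (e (!b))
    rw [acrossEdge_acrossEdge, Bool.not_not] at this
    exact this.symm
  have r : ∀ b o, (curl k).rotate (((), b), o) = (((), !b), xor o (!b)) := fun b o => rfl
  have h₁ := hω (((), true), true)
  have h₂ := hω (((), true), false)
  rw [e] at h₁
  rw [e'] at h₂
  -- The curl has three faces: the one meeting both underpass half-edges is given the value zero,
  -- and the others take the flow along their edge.
  refine ⟨fun h => if h.1.2 then ω h else 0, ?_, ?_⟩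
  · rintro ⟨⟨⟨⟩, b⟩, o⟩
    cases b <;> cases o <;> simp [e, e', r]
  · rintro ⟨⟨⟨⟩, b⟩, o⟩
    cases b <;> cases o <;> simp [r]
    · exact h₁.symm
    · exact h₂.symm

theorem numCyclesAvoiding_of_forall_not {X : Type} {f : Equiv.Perm X} {p : X → Prop}
    (hp : ∀ x, ¬ p x) : numCyclesAvoiding f p = numCycles f :=
  Nat.card_congr (Equiv.subtypeUnivEquiv fun _ x _ => hp x)

theorem smooth_circles_of_unit {next : Equiv.Perm (Passage Unit)} {sign : Unit → ℤˣ} {k : ℕ}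
    (h : ∀ b, next ((), b) = ((), !b)) :
    ((LinkDiagram.mk Unit inferInstance next sign k).smooth ()).circles = k + 2 := by
  have e : next * flipAt {()} = 1 := by
    ext1 ⟨⟨⟩, b⟩
    have : flipAt {()} ((), b) = ((), !b) := flipAt_of_mem (S := {()}) (q := ((), b)) rfl
    rw [Equiv.Perm.mul_apply, this, h, Bool.not_not]
    rfl
  change k + numCyclesAvoiding (next * flipAt {()}) _ = _
  rw [numCyclesAvoiding_of_forall_not fun q hq => hq rfl, e, numCycles_eq_card id
    Function.surjective_id (fun _ => rfl) (fun x y h => by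
      obtain rfl : x = y := h
      exact Equiv.Perm.SameCycle.refl _ _)]
  simp

theorem delete_circles_of_unit {next : Equiv.Perm (Passage Unit)} {sign : Unit → ℤˣ} {k : ℕ}
    (h : ∀ b, next ((), b) = ((), !b)) :
    ((LinkDiagram.mk Unit inferInstance next sign k).delete {()}).circles = k + 1 := by
  change k + numCyclesAvoiding next _ = _
  rw [numCyclesAvoiding_of_forall_not fun q hq => hq rfl, numCycles_eq_card (fun _ => ())
    (fun _ => ⟨((), true), rfl⟩) (fun _ => rfl) (fun ⟨⟨⟩, b⟩ ⟨⟨⟩, b'⟩ _ => by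
      by_cases hb : b' = b
      · rw [hb]
      · have hb : b' = !b := by cases b <;> cases b' <;> simp_all
        rw [hb, ← h]
        exact sameCycle_apply _ _)]
  simp

end LinkDiagram

section Uniqueness

variable {D : ClassicalLinkDiagram → ℤ[X]}
  (hinv : ∀ L L' : ClassicalLinkDiagram,
    LinkDiagram.Move L.toLinkDiagram L'.toLinkDiagram → D L = D L')
  (hunknot : D unknot = 0)
  (hskein : ∀ (Lp Lm L0 : ClassicalLinkDiagram) (c : Lp.Crossing), Lp.sign c = 1 →
    Lm.toLinkDiagram = Lp.toLinkDiagram.changeCrossing c →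
    L0.toLinkDiagram = Lp.toLinkDiagram.smooth c → D Lp - D Lm = X * D L0)
include hinv hunknot hskein

/-- The skein relation at a curl adds one circle: both signs of the curl reduce to `k + 1` circles,
the smoothing has `k + 2`, and `X` can be cancelled in `ℤ[X]`. -/
theorem eq_zero_of_isEmpty (k : ℕ) (L : ClassicalLinkDiagram) (hL : IsEmpty L.Crossing)
    (hk : L.circles = k + 1) : D L = 0 := by
  have hrel : ∀ L L' : ClassicalLinkDiagram, IsEmpty L.Crossing → IsEmpty L'.Crossing →
      L'.circles = L.circles → D L = D L' := fun L L' h h' hc =>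
    hinv L L' (LinkDiagram.Move.relabel _ _ (Equiv.equivOfIsEmpty _ _) (fun q => h.elim q.1)
      (fun c => h.elim c) hc)
  induction k generalizing L with
  | zero => exact (hrel unknot L (inferInstanceAs (IsEmpty Empty)) hL hk).symm.trans hunknot
  | succ k ih =>
    have hempty : IsEmpty {x : Unit // x ∉ ({()} : Set Unit)} := ⟨fun x => x.2 rfl⟩
    let M : ClassicalLinkDiagram := ⟨LinkDiagram.curl k, LinkDiagram.isPlanar_curl k, Or.inl ⟨()⟩⟩
    let M' : ClassicalLinkDiagram := ⟨(LinkDiagram.curl k).changeCrossing (),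
      LinkDiagram.isPlanar_changeCrossing (LinkDiagram.isPlanar_curl k) (), Or.inl ⟨()⟩⟩
    let M₀ : ClassicalLinkDiagram := ⟨(LinkDiagram.curl k).smooth (),
      LinkDiagram.isPlanar_smooth _ (LinkDiagram.isPlanar_curl k) (),
      LinkDiagram.nonempty_smooth (LinkDiagram.curl k) ()⟩
    have hzero : ∀ N : ClassicalLinkDiagram, ∀ (next : Equiv.Perm (Passage Unit))
        (sign : Unit → ℤˣ), N.toLinkDiagram = LinkDiagram.mk Unit inferInstance next sign k →
        (∀ b, next ((), b) = ((), !b)) → D N = 0 := by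
      rintro ⟨N, hN, hN'⟩ next sign rfl h
      let N₀ : ClassicalLinkDiagram := ⟨_, LinkDiagram.isPlanar_delete_kink _ hN (h true),
        LinkDiagram.nonempty_delete _ () _⟩
      exact (hinv _ N₀ (LinkDiagram.Move.one
        (LinkDiagram.mk Unit inferInstance next sign k) () true (h true))).trans
        (ih N₀ hempty (LinkDiagram.delete_circles_of_unit h))
    have e := hskein M M' M₀ () rfl rfl rfl
    have hflip : ∀ b, flipAt {()} ((), b) = ((), !b) := fun b =>
      flipAt_of_mem (S := {()}) (q := ((), b)) rfl
    rw [hzero M _ _ rfl (LinkDiagram.curl_next k), hzero M' _ _ rfl fun b => by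
      rw [Equiv.Perm.mul_apply, Equiv.Perm.mul_apply, hflip, LinkDiagram.curl_next, hflip,
        Bool.not_not], sub_zero] at e
    have hM₀ : D M₀ = 0 := (mul_eq_zero.1 e.symm).resolve_left X_ne_zero
    exact (hrel M₀ L hempty hL
      (hk.trans (LinkDiagram.smooth_circles_of_unit (LinkDiagram.curl_next k)).symm)).symm.trans hM₀

/-- Applied to the difference of two candidates. Smoothings, and deletions of kinks and bigons, have
fewer crossings, so vanishing satisfies the hypotheses of `reduction`. -/
theorem eq_zero_of_skein (L : ClassicalLinkDiagram) : D L = 0 := by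
  obtain ⟨v, hv⟩ : ∃ v, Nat.card L.Crossing = v := ⟨_, rfl⟩
  induction v using Nat.strong_induction_on generalizing L with
  | _ v ih =>
  rcases isEmpty_or_nonempty L.Crossing with he | hne
  · obtain ⟨k, hk⟩ : ∃ k, L.circles = k + 1 := by
      rcases L.nonempty with ⟨⟨c⟩⟩ | h
      · exact (he.false c).elim
      · exact ⟨L.circles - 1, by omega⟩
    exact eq_zero_of_isEmpty hinv hunknot hskein k L he hk
  have key := LinkDiagram.reduction (v := v)
    (A := fun L => ∀ hp hn, D ⟨L, hp, hn⟩ = 0) (fun L hv hL c hA hp hn => ?_)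
    (fun L hv hL c b h hp hn => ?_) (fun L hv hL a b hab hs h₁ h₂ hp hn => ?_)
    (fun L hv hL x y w t m b hxy hxw hyw h₁ h₂ h₃ h₄ h₅ hp hA hp' hn => ?_) L.toLinkDiagram hv
    L.planar
  · exact key L.planar L.nonempty
  · have hc : D ⟨L.changeCrossing c, LinkDiagram.isPlanar_changeCrossing hp c, Or.inl ⟨c⟩⟩ = 0 :=
      hA _ _
    -- The skein relation is stated at a positive crossing; at a negative one it is applied to the
    -- changed diagram, whose change at `c` is the original.
    rcases Int.units_eq_one_or (L.sign c) with h | h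
    · have e := hskein ⟨L, hp, hn⟩
        ⟨L.changeCrossing c, LinkDiagram.isPlanar_changeCrossing hp c, Or.inl ⟨c⟩⟩
        ⟨L.smooth c, L.isPlanar_smooth hp c, L.nonempty_smooth c⟩ c h rfl rfl
      rwa [hc, ih _ (hv ▸ LinkDiagram.card_delete_lt (Set.mem_singleton c))
        ⟨L.smooth c, L.isPlanar_smooth hp c, L.nonempty_smooth c⟩ rfl, mul_zero, sub_zero] at e
    · have hp' := LinkDiagram.isPlanar_changeCrossing hp c
      have e := hskein ⟨L.changeCrossing c, hp', Or.inl ⟨c⟩⟩ ⟨L, hp, hn⟩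
        ⟨(L.changeCrossing c).smooth c, LinkDiagram.isPlanar_smooth _ hp' c,
          LinkDiagram.nonempty_smooth (L.changeCrossing c) c⟩ c (by simp [LinkDiagram.changeCrossing, h])
        (L.changeCrossing_changeCrossing c).symm rfl
      rw [hc, ih _ (hv ▸ LinkDiagram.card_delete_lt (Set.mem_singleton c))
        ⟨(L.changeCrossing c).smooth c, LinkDiagram.isPlanar_smooth _ hp' c,
          LinkDiagram.nonempty_smooth (L.changeCrossing c) c⟩ rfl, mul_zero, zero_sub] at e
      exact neg_eq_zero.1 e
  · exact (hinv _ ⟨L.delete {c}, L.isPlanar_delete_kink hp h, L.nonempty_delete c _⟩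
      (LinkDiagram.Move.one L c b h)).trans
      (ih _ (hv ▸ LinkDiagram.card_delete_lt (Set.mem_singleton c)) _ rfl)
  · exact (hinv _ ⟨L.delete {a, b}, L.isPlanar_delete_bigon hp hab h₁ h₂, L.nonempty_delete a _⟩
      (LinkDiagram.Move.two L a b hab hs h₁ h₂)).trans
      (ih _ (hv ▸ LinkDiagram.card_delete_lt (Set.mem_insert a {b})) _ rfl)
  · exact (hinv _ ⟨L.conjNext (LinkDiagram.triangleSwaps x y w), hp, Or.inl ⟨x⟩⟩
      (LinkDiagram.Move.three L x y w hxy hxw hyw t m b h₁ h₂ h₃ h₄ h₅)).trans (hA _ _)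

end Uniqueness

theorem IsConwayPolynomial.unique {P Q : ClassicalLinkDiagram → ℤ[X]} (hP : IsConwayPolynomial P)
    (hQ : IsConwayPolynomial Q) : P = Q := by
  refine _root_.funext fun L => sub_eq_zero.1 (eq_zero_of_skein (D := fun L => P L - Q L)
    (fun L L' h => ?_) ?_ (fun Lp Lm L0 c hc hm h0 => ?_) L)
  · rw [hP.invariant L L' h, hQ.invariant L L' h]
  · rw [hP.unknot, hQ.unknot, sub_self]
  · have h₁ := hP.skein Lp Lm L0 c hc hm h0
    have h₂ := hQ.skein Lp Lm L0 c hc hm h0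
    linear_combination h₁ - h₂

theorem isConwayPolynomial_conway :
    IsConwayPolynomial fun L : ClassicalLinkDiagram => L.toLinkDiagram.conway where
  invariant L L' h := LinkDiagram.Move.conway_eq L.planar L'.planar h
  unknot := LinkDiagram.conway_unknot
  skein Lp Lm L0 c hc hm h0 := by
    have h := LinkDiagram.conway_skein Lp.planar c
    rw [hc, Units.val_one, C_1, one_mul, ← hm, ← h0] at h
    exact h

end

end ConwayTangle


theorem mainTheorem3 :
    (∃! P : ConwayTangle.ClassicalLinkDiagram → Polynomial ℤ,
      ConwayTangle.IsConwayPolynomial P) ∧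
    ∀ P : ConwayTangle.ClassicalLinkDiagram → Polynomial ℤ,
      ConwayTangle.IsConwayPolynomial P →
      ∀ (m : ℕ) (T : ConwayTangle.ClassicalTangleDiagram),
        T.numClosedComponents + 1 = m →
        T.closure.numComponents = m ∧ T.nabla = P T.closure := by
  refine ⟨⟨_, ConwayTangle.isConwayPolynomial_conway,
    fun P hP => hP.unique ConwayTangle.isConwayPolynomial_conway⟩, fun P hP m T hm => ⟨?_, ?_⟩⟩
  · exact T.toTangleDiagram.closure_numComponents.trans hm
  · rw [hP.unique ConwayTangle.isConwayPolynomial_conway]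
    exact ConwayTangle.TangleDiagram.nabla_eq_conway T.planar rfl
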